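/- **Theorem (Absence of Lavrentiev's phenomenon for vector-valued maps).** Let $n,d\ge 1$ and let $\Omega\subset\mathbb{R}^n$ be a bounded Lipschitz domain. Write $\boldsymbol\xi=(\boldsymbol\xi^1,\dots,\boldsymbol\xi^d)\in\mathbb{R}^{n\times d}$ with $\boldsymbol\xi^i\in\mathbb{R}^n$. *Weak $N$-functions.* For a Euclidean space $E$, a function $M:\Omega\times E\to[0,\infty)$ is a weak $N$-function if it is measurable in $x$ and continuous in $\xi$; for a.e. $x\in\Omega$, $M(x,0)=0$, $M(x,\cdot)$ is convex and $M(x,-\xi)=M(x,\xi)$ for all $\xi$; and there are convex functions $m_1,m_2:[0,\infty)\to[0,\infty)$ with $m_1(0)=0$, $m_1(s)>0$ for $s>0$, and $m_1(|\xi|)\le M(x,\xi)\le m_2(|\xi|)$ for a.e. $x\in\Omega$ and all $\xi$. We write $M\in\Delta_2$ if there are constants $c,C>0$ and a nonnegative integrable $h:\Omega\to\mathbb{R}$ such that, for a.e. $x\in\Omega$, $M(x,2\xi)\le cM(x,\xi)+h(x)$ whenever $|\xi|>C$. *Condition $(\mathsf{B}^{gen}_\gamma)$.* For a ball $B$ put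 $M^-_B(\xi)=\operatorname{ess\,inf}_{y\in B\cap\Omega}M(y,\xi)$ and $M^+_B(\xi)=\operatorname{ess\,sup}_{y\in B\cap\Omega}M(y,\xi)$. A function $M:\Omega\times E\to[0,\infty)$ satisfies $(\mathsf{B}^{gen}_\gamma)$ if $M(x,\xi)=\sum_{j=1}^{k}N_j(x,\xi_j)$ for some $k\ge1$, where the components $\xi_j\in\mathbb{R}^{\ell_j}$ are the images of $\xi\in E$ under linear maps that jointly determine $\xi$, the $N_j:\Omega\times\mathbb{R}^{\ell_j}\to[0,\infty)$ are weak $N$-functions, and there are constants $c^\Diamond,C^\Diamond>1$ such that for every ball $B$ of radius $r\le1$, every $j$ and every $\xi_j\in\mathbb{R}^{\ell_j}$, $$(N_j)^-_B(C^\Diamond\xi_j)\le\sup_{|\eta_j|=1}(N_j)^-_B(c^\Diamond r^{\gamma-1}\eta_j)\quad\Longrightarrow\quad (N_j)^+_B(\xi_j)\le (N_j)^-_B(C^\Diamond\xi_j)+1 .$$ *Spaces.* $L_M$ is the smallest linear space containing all measurable $\xi:\Omega\to\mathbb{R}^{n\times d}$ with $\int_\Omega M(x,\xi(x))\,dx<\infty$.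 Set $$V^1L_M(\Omega)=\{u\in W^{1,1}(\Omega;\mathbb{R}^d):\nabla u\in L_M\},\qquad V^1_0L_M(\Omega)=\{u\in W^{1,1}_0(\Omega;\mathbb{R}^d):\nabla u\in L_M\},$$ where $W^{1,1}_0$ is the closure of $C_c^\infty(\Omega;\mathbb{R}^d)$ in $W^{1,1}(\Omega;\mathbb{R}^d)$. For $\gamma\in(0,1]$, $C^{0,\gamma}(\Omega)$ is the set of maps $u:\Omega\to\mathbb{R}^d$ with $\sup_{x\ne y\in\Omega}|u(x)-u(y)|/|x-y|^\gamma<\infty$. *Assumptions.* Let $M:\Omega\times\mathbb{R}^{n\times d}\to[0,\infty)$ be a weak $N$-function that is continuous on $\Omega\times\mathbb{R}^{n\times d}$, satisfies $M\in\Delta_2$, and has the form $M(x,\boldsymbol\xi)=\sum_{i=1}^dM_i(x,\boldsymbol\xi^i)$ with weak $N$-functions $M_i:\Omega\times\mathbb{R}^n\to[0,\infty)$. Let $F:\Omega\times\mathbb{R}^d\times\mathbb{R}^{n\times d}\to[0,\infty)$ be measurable in the first variable and continuous in the second and third variables, and suppose that for some constants $0<\nu,\beta<1<L$ $$\nu M(x,\beta\boldsymbol\xi)\le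 F(x,\mathbf z,\boldsymbol\xi)\le L\,(M(x,\boldsymbol\xi)+1)\qquad\text{for all }x\in\Omega,\ \mathbf z\in\mathbb{R}^d,\ \boldsymbol\xi\in\mathbb{R}^{n\times d}.$$ Let $\mathcal F[u]=\int_\Omega F(x,u,\nabla u)\,dx$. *Conclusion.* 1. If $u_0\in V^1L_M(\Omega)$ and $M$ satisfies $(\mathsf{B}^{gen}_0)$, then $$\inf_{u_0+V^1_0L_M(\Omega)}\mathcal F[u]=\inf_{u_0+C_c^\infty(\Omega;\mathbb{R}^d)}\mathcal F[u].$$ 2. If $\gamma\in(0,1)$, $u_0\in V^1L_M(\Omega)\cap C^{0,\gamma}(\Omega)$ and $M$ satisfies $(\mathsf{B}^{gen}_\gamma)$, then $$\inf_{u_0+V^1_0L_M(\Omega)\cap C^{0,\gamma}(\Omega)}\mathcal F[u]=\inf_{u_0+C_c^\infty(\Omega;\mathbb{R}^d)}\mathcal F[u].$$ 3. If $u_0\in V^1L_M(\Omega)\cap C^{0,1}(\Omega)$, then (without any balance condition) $$\inf_{u_0+V^1_0L_M(\Omega)\cap C^{0,1}(\Omega)}\mathcal F[u]=\inf_{u_0+C_c^\infty(\Omega;\mathbb{R}^d)}\mathcal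 F[u].$$ -/

import Mathlib

open MeasureTheory Set Filter Topology TopologicalSpace
open scoped NNReal ENNReal ContDiff Distributions

noncomputable section

namespace MusielakOrlicz

/-- Euclidean space of dimension `n`. -/
abbrev Euc (n : ℕ) : Type := EuclideanSpace ℝ (Fin n)

/-- The space of gradients of maps from `ℝⁿ` to `ℝᵈ`: tuples `ξ = (ξ¹, …, ξᵈ)` of vectors of `ℝⁿ`,
with the Euclidean (Frobenius) norm. -/
abbrev Grad (n d : ℕ) : Type := PiLp 2 (fun _ : Fin d => Euc n)

/-- A bounded Lipschitz domain: a nonempty, connected, bounded open set which, near each of its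
boundary points and in suitable orthonormal coordinates, is the set of points lying strictly above
the graph of a Lipschitz function. Here `e` is the vertical direction and the graph function `g` is
defined on the hyperplane orthogonal to `e`. -/
structure IsBoundedLipschitzDomain {n : ℕ} (Ω : Opens (Euc n)) : Prop where
  connected : IsConnected (Ω : Set (Euc n))
  bounded : Bornology.IsBounded (Ω : Set (Euc n))
  lipschitz : ∀ x₀ ∈ frontier (Ω : Set (Euc n)),
    ∃ (e : Euc n) (g : (Submodule.span ℝ {e})ᗮ → ℝ) (K : ℝ≥0) (r : ℝ),
      ‖e‖ = 1 ∧ LipschitzWith K g ∧ 0 < r ∧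
        ∀ x ∈ Metric.ball x₀ r,
          (x ∈ Ω ↔ g ((Submodule.span ℝ {e})ᗮ.orthogonalProjectionOnto x) < inner ℝ e x)

section WeakNFunctions

variable {n : ℕ} {E : Type} [NormedAddCommGroup E] [NormedSpace ℝ E]

/-- Weak `N`-functions `M : Ω × E → [0, ∞)`. Only the values `M x ξ` with `x ∈ Ω` matter. -/
structure IsWeakNFunction (Ω : Opens (Euc n)) (M : Euc n → E → ℝ) : Prop where
  nonneg : ∀ x ∈ Ω, ∀ ξ, 0 ≤ M x ξ
  measurable : ∀ ξ, AEMeasurable (fun x => M x ξ) (volume.restrict Ω)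
  continuous : ∀ x ∈ Ω, Continuous (M x)
  zero : ∀ᵐ x ∂(volume.restrict (Ω : Set (Euc n))), M x 0 = 0
  convex : ∀ᵐ x ∂(volume.restrict (Ω : Set (Euc n))), ConvexOn ℝ univ (M x)
  even : ∀ᵐ x ∂(volume.restrict (Ω : Set (Euc n))), ∀ ξ, M x (-ξ) = M x ξ
  bounds : ∃ m₁ m₂ : ℝ → ℝ,
    ConvexOn ℝ (Ici 0) m₁ ∧ ConvexOn ℝ (Ici 0) m₂ ∧
    m₁ 0 = 0 ∧ (∀ s, 0 < s → 0 < m₁ s) ∧ (∀ s, 0 ≤ s → 0 ≤ m₂ s) ∧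
    ∀ᵐ x ∂(volume.restrict (Ω : Set (Euc n))), ∀ ξ, m₁ ‖ξ‖ ≤ M x ξ ∧ M x ξ ≤ m₂ ‖ξ‖

/-- The `Δ₂` condition close to infinity. -/
def DeltaTwo (Ω : Opens (Euc n)) (M : Euc n → E → ℝ) : Prop :=
  ∃ (c C : ℝ) (h : Euc n → ℝ), 0 < c ∧ 0 < C ∧ (∀ x ∈ Ω, 0 ≤ h x) ∧
    IntegrableOn h Ω ∧
    ∀ᵐ x ∂(volume.restrict (Ω : Set (Euc n))), ∀ ξ, C < ‖ξ‖ → M x ((2 : ℝ) • ξ) ≤ c * M x ξ + h x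

/-- `M⁻_B(ξ)`, the essential infimum of `M(y, ξ)` over the points `y` of `B` that lie in `Ω`. -/
def lowerEnv (Ω : Opens (Euc n)) (M : Euc n → E → ℝ) (B : Set (Euc n)) (ξ : E) : ℝ≥0∞ :=
  essInf (fun y => ENNReal.ofReal (M y ξ)) (volume.restrict (B ∩ Ω))

/-- `M⁺_B(ξ)`, the essential supremum of `M(y, ξ)` over the points `y` of `B` that lie in `Ω`. -/
def upperEnv (Ω : Opens (Euc n)) (M : Euc n → E → ℝ) (B : Set (Euc n)) (ξ : E) : ℝ≥0∞ :=
  essSup (fun y => ENNReal.ofReal (M y ξ)) (volume.restrict (B ∩ Ω))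

/-- The general (fully anisotropic) balance condition with exponent `γ`. The components
`ξ_j ∈ ℝ^{ℓ_j}` of `ξ` are its images under linear maps `P j` which together determine `ξ`. -/
def BGen (γ : ℝ) (Ω : Opens (Euc n)) (M : Euc n → E → ℝ) : Prop :=
  ∃ (L : ℕ) (ℓ : Fin L → ℕ) (P : ∀ j, E →ₗ[ℝ] Euc (ℓ j)) (N : ∀ j, Euc n → Euc (ℓ j) → ℝ),
    0 < L ∧
    (∀ ξ, (∀ j, P j ξ = 0) → ξ = 0) ∧
    (∀ j, IsWeakNFunction Ω (N j)) ∧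
    (∀ x ∈ Ω, ∀ ξ, M x ξ = ∑ j, N j x (P j ξ)) ∧
    ∃ c C : ℝ, 1 < c ∧ 1 < C ∧
      ∀ (z : Euc n) (r : ℝ), 0 < r → r ≤ 1 → ∀ (j : Fin L) (ξ : Euc (ℓ j)),
        lowerEnv Ω (N j) (Metric.ball z r) (C • ξ) ≤
            ⨆ (η : Euc (ℓ j)) (_ : ‖η‖ = 1),
              lowerEnv Ω (N j) (Metric.ball z r) ((c * r ^ (γ - 1)) • η) →
          upperEnv Ω (N j) (Metric.ball z r) ξ ≤
            lowerEnv Ω (N j) (Metric.ball z r) (C • ξ) + 1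

/-- The Musielak–Orlicz class: measurable `ξ : Ω → E` with `∫_Ω M(x, ξ(x)) dx < ∞`. -/
def orliczClass (Ω : Opens (Euc n)) (M : Euc n → E → ℝ) : Set (Euc n → E) :=
  {ξ | AEStronglyMeasurable ξ (volume.restrict Ω) ∧
    ∫⁻ x in Ω, ENNReal.ofReal (M x (ξ x)) < ⊤}

/-- The Musielak–Orlicz space `L_M`: the smallest linear space containing the class. -/
def orliczSpace (Ω : Opens (Euc n)) (M : Euc n → E → ℝ) : Submodule ℝ (Euc n → E) :=
  Submodule.span ℝ (orliczClass Ω M)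

end WeakNFunctions

section Sobolev

variable {n d : ℕ}

/-- `G` is a distributional gradient of `u` on `Ω`. -/
def IsWeakGrad (Ω : Opens (Euc n)) (u : Euc n → Euc d) (G : Euc n → Grad n d) : Prop :=
  LocallyIntegrableOn u Ω ∧ LocallyIntegrableOn G Ω ∧
    ∀ (φ : 𝓓(Ω, ℝ)) (i : Fin d) (k : Fin n),
      ∫ x in Ω, fderiv ℝ φ x (EuclideanSpace.single k 1) * u x i = -∫ x in Ω, φ x * G x i k

open Classical in
/-- The distributional gradient of `u` on `Ω`, which is unique up to equality almost everywhere on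
`Ω` (and `0` if there is none). -/
def weakGrad (Ω : Opens (Euc n)) (u : Euc n → Euc d) : Euc n → Grad n d :=
  if h : ∃ G, IsWeakGrad Ω u G then h.choose else 0

/-- The Sobolev space `W^{1,1}(Ω; ℝᵈ)`. -/
def sobolev (Ω : Opens (Euc n)) (d : ℕ) : Set (Euc n → Euc d) :=
  {u | IntegrableOn u Ω ∧ (∃ G, IsWeakGrad Ω u G) ∧ IntegrableOn (weakGrad Ω u) Ω}

/-- The norm of `W^{1,1}(Ω; ℝᵈ)`. -/
def sobolevNorm (Ω : Opens (Euc n)) (u : Euc n → Euc d) : ℝ≥0∞ :=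
  eLpNorm u 1 (volume.restrict Ω) + eLpNorm (weakGrad Ω u) 1 (volume.restrict Ω)

/-- `C_c^∞(Ω; ℝᵈ)` as a set of functions. -/
def testMaps (Ω : Opens (Euc n)) (d : ℕ) : Set (Euc n → Euc d) :=
  range fun φ : 𝓓(Ω, Euc d) => (φ : Euc n → Euc d)

/-- `W^{1,1}_0(Ω; ℝᵈ)`, the closure of `C_c^∞(Ω; ℝᵈ)` in `W^{1,1}(Ω; ℝᵈ)`. -/
def sobolevZero (Ω : Opens (Euc n)) (d : ℕ) : Set (Euc n → Euc d) :=
  {u | u ∈ sobolev Ω d ∧ ∀ ε : ℝ≥0∞, 0 < ε → ∃ φ ∈ testMaps Ω d, sobolevNorm Ω (u - φ) < ε}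

/-- `V¹L_M(Ω)`. -/
def V1L (Ω : Opens (Euc n)) (M : Euc n → Grad n d → ℝ) : Set (Euc n → Euc d) :=
  {u | u ∈ sobolev Ω d ∧ weakGrad Ω u ∈ orliczSpace Ω M}

/-- `V¹₀L_M(Ω)`. -/
def V1L0 (Ω : Opens (Euc n)) (M : Euc n → Grad n d → ℝ) : Set (Euc n → Euc d) :=
  {u | u ∈ sobolevZero Ω d ∧ weakGrad Ω u ∈ orliczSpace Ω M}

/-- `C^{0,γ}(Ω; ℝᵈ)`: finite Hölder seminorm on `Ω`. -/
def holderMaps (Ω : Opens (Euc n)) (d : ℕ) (γ : ℝ≥0) : Set (Euc n → Euc d) :=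
  {u | ∃ C : ℝ≥0, HolderOnWith C γ u Ω}

/-- The functional `𝓕[u] = ∫_Ω F(x, u, ∇u) dx` (for `F ≥ 0`), with values in `[0, ∞]`. -/
def energy (Ω : Opens (Euc n)) (F : Euc n → Euc d → Grad n d → ℝ) (u : Euc n → Euc d) : ℝ≥0∞ :=
  ∫⁻ x in Ω, ENNReal.ofReal (F x (u x) (weakGrad Ω u x))

/-- `inf { 𝓕[u] : u ∈ u₀ + S }`. -/
def infEnergy (Ω : Opens (Euc n)) (F : Euc n → Euc d → Grad n d → ℝ) (u₀ : Euc n → Euc d)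
    (S : Set (Euc n → Euc d)) : ℝ≥0∞ :=
  sInf ((fun v => energy Ω F (u₀ + v)) '' S)

end Sobolev

end MusielakOrlicz

end

open MusielakOrlicz

/-! Test maps belong to every competitor class, so only one inequality has content: for `v` in the
larger class, the energy of `u₀ + v` must be reached, up to any error, from `u₀ + C_c^∞`. Since `F ≤
L (M + 1)`, it suffices to approximate `v` by test maps in `W^{1,1}` and in the modular of `M` at
every scale (`Approximable`); `infEnergy_testMaps_le` then follows by dominated convergence. The
condition Δ₂ makes all scales of the modular comparable (`DeltaTwo.exists_scale`), so a majorant at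
one small scale is enough (`Approximable.of_dominated`).

The approximants are mollifications of the extension of `v` by zero. Cut-offs reduce to a small ball
in which some direction points uniformly into `Ω`; a kernel centred at a small multiple of that
direction pushes the support inside `Ω` (`exists_testMap_eq_moll`).

The heart is a majorant for the modular of the mollified gradient. Jensen's inequality for `M x`
brings in values `M x (∇v(y))`, whereas only `M y (∇v(y))` is integrable. The balance condition
exchanges `x` and `y`, but only while the values stay below a threshold that depends on the ball.
The averaged gradient itself respects the threshold: with the derivative on the kernel, a `γ`-Hölder
map gives a bound of order `r ^ (γ - 1)`. The single gradients `∇v(y)` need not; `convex_average_le`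
shrinks the large ones and enlarges their weights accordingly, which leaves the barycentre unchanged
up to a factor at most 2. For `γ = 1` the mollified gradients are bounded and no comparison is
needed.

Two reductions complete the proof. For `γ > 0` the zero extension must be Hölder on the whole space;
this holds because a map in `W^{1,1}_0` cannot stay away from zero near the boundary
(`ZeroPair.exists_norm_lt`). For `γ = 0` the map is first made bounded by componentwise truncation,
which does not increase the modular because `M` splits into a sum over the components. -/

namespace MusielakOrlicz

/-! ### Measurability of superpositions and convergence of integrals. -/

section Measure

variable {α : Type*} [MeasurableSpace α] {μ : Measure α}

/-- Superposition of a Carathéodory function with a measurable map is measurable. -/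
lemma aemeasurable_caratheodory {H : Type*} [TopologicalSpace H] [PseudoMetrizableSpace H]
    {f : α → H → ℝ} (hm : ∀ h, AEMeasurable (fun x => f x h) μ)
    (hc : ∀ᵐ x ∂μ, Continuous (f x)) {ξ : α → H} (hξ : AEStronglyMeasurable ξ μ) :
    AEMeasurable (fun x => f x (ξ x)) μ := by
  obtain ⟨ζ, hζ, hξζ⟩ := hξ
  have key : AEMeasurable (fun x => f x (ζ x)) μ := by
    -- Continuity in the second variable permits replacing `ζ` by simple functions, for which only
    -- the sections `f · c` occur.
    refine aemeasurable_of_tendsto_metrizable_ae' (f := fun k x => f x (hζ.approx k x)) ?_ ?_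
    · intro k
      have : (fun x => f x (hζ.approx k x)) = fun x => ∑ c ∈ (hζ.approx k).range,
          ((hζ.approx k) ⁻¹' {c}).indicator (fun x => f x c) x := by
        ext x
        rw [Finset.sum_eq_single (hζ.approx k x)]
        · rw [indicator_of_mem (by simp)]
        · intro b _ hb
          exact indicator_of_notMem (fun h => hb (by simpa using h.symm)) _
        · intro h
          exact absurd (SimpleFunc.mem_range_self _ x) h
      rw [this]
      exact Finset.aemeasurable_fun_sum _ fun c _ =>
        (hm c).indicator ((hζ.approx k).measurableSet_preimage _)
    · filter_upwards [hc] with x hx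
      exact (hx.tendsto _).comp (hζ.tendsto_approx x)
  exact key.congr (by filter_upwards [hξζ] with x hx; rw [hx])

/-- Dominated convergence to zero with majorants that converge in `L¹`. -/
lemma tendsto_lintegral_zero_of_le_add {f b : ℕ → α → ℝ≥0∞} {a : α → ℝ≥0∞}
    (hf : ∀ k, AEMeasurable (f k) μ) (ham : AEMeasurable a μ)
    (hfb : ∀ k, ∀ᵐ x ∂μ, f k x ≤ a x + b k x) (ha : ∫⁻ x, a x ∂μ ≠ ⊤)
    (hb : Tendsto (fun k => ∫⁻ x, b k x ∂μ) atTop (𝓝 0))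
    (h0 : ∀ᵐ x ∂μ, Tendsto (fun k => f k x) atTop (𝓝 0)) :
    Tendsto (fun k => ∫⁻ x, f k x ∂μ) atTop (𝓝 0) := by
  -- The part of `f k` below `a` is dominated by `a`; the excess over `a` is at most `b k`.
  have h1 : Tendsto (fun k => ∫⁻ x, min (f k x) (a x) ∂μ) atTop (𝓝 0) := by
    have := tendsto_lintegral_of_dominated_convergence' (μ := μ) (F := fun k x => min (f k x) (a x))
      (f := fun _ => 0) a (fun k => (hf k).min ham) (fun k => ae_of_all _ fun x => min_le_right _ _)
      ha ?_
    · simpa using this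
    · filter_upwards [h0] with x hx
      exact tendsto_of_tendsto_of_tendsto_of_le_of_le tendsto_const_nhds hx (fun _ => zero_le)
        (fun _ => min_le_left _ _)
  have h2 := h1.add hb
  rw [add_zero] at h2
  refine tendsto_of_tendsto_of_tendsto_of_le_of_le tendsto_const_nhds h2 (fun _ => zero_le) ?_
  intro k
  dsimp only
  rw [← lintegral_add_left' ((hf k).min ham)]
  refine lintegral_mono_ae ?_
  filter_upwards [hfb k] with x hx
  rcases le_total (f k x) (a x) with h | h
  · rw [min_eq_left h]; exact le_self_add
  · rw [min_eq_right h]; exact hx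

/-- A sequence converging in `L¹` has a subsequence converging almost everywhere. -/
lemma exists_subseq_tendsto_ae {H : Type*} [NormedAddCommGroup H] {f : ℕ → α → H} {g : α → H}
    (hf : ∀ k, AEStronglyMeasurable (f k) μ) (hg : AEStronglyMeasurable g μ)
    (h : Tendsto (fun k => ∫⁻ x, ‖f k x - g x‖ₑ ∂μ) atTop (𝓝 0)) :
    ∃ ns : ℕ → ℕ, StrictMono ns ∧
      ∀ᵐ x ∂μ, Tendsto (fun k => f (ns k) x) atTop (𝓝 (g x)) := by
  refine TendstoInMeasure.exists_seq_tendsto_ae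
    (tendstoInMeasure_of_tendsto_eLpNorm (p := 1) one_ne_zero hf hg ?_)
  simpa [eLpNorm_one_eq_lintegral_enorm] using h

end Measure

/-! ### Mollification in `L¹`. -/

section Mollify

variable {n : ℕ} {V : Type*} [NormedAddCommGroup V] [NormedSpace ℝ V]

/-- Translations are continuous in `L¹`. -/
lemma tendsto_lintegral_translate_sub {V : Type*} [NormedAddCommGroup V] {f : Euc n → V} (hf : Integrable f) :
    Tendsto (fun y : Euc n => ∫⁻ x, ‖f (x - y) - f x‖ₑ) (𝓝 0) (𝓝 0) := by
  have hp : Fact ((1 : ℝ≥0∞) ≠ ⊤) := ⟨ENNReal.one_ne_top⟩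
  have hm : MemLp f 1 volume := memLp_one_iff_integrable.2 hf
  -- The integral is a distance in `L¹`, and translations act continuously there; `DomAddAct`
  -- translates by adding to the argument, hence the sign.
  have hc : Continuous fun y : Euc n => edist (DomAddAct.mk (-y) +ᵥ hm.toLp f) (hm.toLp f) := by
    refine Continuous.edist ?_ continuous_const
    exact Continuous.vadd (DomAddAct.continuous_mk.comp continuous_neg) continuous_const
  have h0 := hc.tendsto 0
  have hval : ∀ y : Euc n, edist (DomAddAct.mk (-y) +ᵥ hm.toLp f) (hm.toLp f)
      = ∫⁻ x, ‖f (x - y) - f x‖ₑ := by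
    intro y
    rw [DomAddAct.mk_vadd_toLp, Lp.edist_toLp_toLp, eLpNorm_one_eq_lintegral_enorm]
    refine lintegral_congr fun x => ?_
    simp [vadd_eq_add, sub_eq_neg_add]
  simp only [hval] at h0
  simpa using h0

/-- The weighted translates `∫ k(y) f(x - y) dy`. -/
noncomputable def moll (k : Euc n → ℝ) (f : Euc n → V) (x : Euc n) : V := ∫ y, k y • f (x - y)

/-- A mollification kernel: smooth, nonnegative, compactly supported, of mass one. -/
structure IsKernel (k : Euc n → ℝ) : Prop where
  contDiff : ContDiff ℝ ∞ k
  nonneg : ∀ y, 0 ≤ k y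
  compact : HasCompactSupport k
  integral : ∫ y, k y = 1

lemma IsKernel.integrable {k : Euc n → ℝ} (hk : IsKernel k) : Integrable k :=
  hk.contDiff.continuous.integrable_of_hasCompactSupport hk.compact

lemma IsKernel.lintegral {k : Euc n → ℝ} (hk : IsKernel k) : ∫⁻ y, ENNReal.ofReal (k y) = 1 := by
  rw [← ofReal_integral_eq_lintegral_ofReal hk.integrable (ae_of_all _ hk.nonneg), hk.integral,
    ENNReal.ofReal_one]

lemma integrable_smul_translate {k : Euc n → ℝ} (hk : Continuous k) (hc : HasCompactSupport k)
    {f : Euc n → V} (hf : LocallyIntegrable f) (x : Euc n) :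
    Integrable fun y => k y • f (x - y) := by
  exact hc.convolutionExists_left (ContinuousLinearMap.lsmul ℝ ℝ) hk hf x

lemma moll_eq_convolution (k : Euc n → ℝ) (f : Euc n → V) :
    moll k f = convolution k f (ContinuousLinearMap.lsmul ℝ ℝ) volume := rfl

lemma contDiff_moll {k : Euc n → ℝ} (hk : IsKernel k) {f : Euc n → V}
    (hf : LocallyIntegrable f) : ContDiff ℝ ∞ (moll k f) := by
  rw [moll_eq_convolution]
  exact hk.compact.contDiff_convolution_left _ hk.contDiff hf

/-- Minkowski's inequality, obtained from Tonelli: the kernel has mass one, so the error is an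
average of translation errors. -/
lemma lintegral_moll_sub_le {k : Euc n → ℝ} (hk : IsKernel k) [CompleteSpace V] {f : Euc n → V}
    (hf : Integrable f) {C : ℝ≥0∞} (hC : ∀ y, k y ≠ 0 → ∫⁻ x, ‖f (x - y) - f x‖ₑ ≤ C) :
    ∫⁻ x, ‖moll k f x - f x‖ₑ ≤ C := by
  have hpt : ∀ x, ‖moll k f x - f x‖ₑ ≤ ∫⁻ y, ENNReal.ofReal (k y) * ‖f (x - y) - f x‖ₑ := by
    intro x
    have h1 : f x = ∫ y, k y • f x := by rw [integral_smul_const, hk.integral, one_smul]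
    have h2 : moll k f x - f x = ∫ y, k y • (f (x - y) - f x) := by
      conv_lhs => rw [h1]
      rw [moll, ← integral_sub (integrable_smul_translate hk.contDiff.continuous hk.compact
        hf.locallyIntegrable x) (hk.integrable.smul_const _)]
      simp only [smul_sub]
    rw [h2]
    refine (enorm_integral_le_lintegral_enorm _).trans (le_of_eq ?_)
    refine lintegral_congr fun y => ?_
    rw [enorm_smul, Real.enorm_of_nonneg (hk.nonneg y)]
  have hmeas : AEMeasurable (fun p : Euc n × Euc n =>
      ENNReal.ofReal (k p.2) * ‖f (p.1 - p.2) - f p.1‖ₑ) (volume.prod volume) := by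
    have h1 : AEMeasurable (fun p : Euc n × Euc n => ENNReal.ofReal (k p.2))
        (volume.prod volume) :=
      (hk.contDiff.continuous.measurable.comp measurable_snd).ennreal_ofReal.aemeasurable
    have h2 : AEStronglyMeasurable (fun p : Euc n × Euc n => f (p.1 - p.2) - f p.1)
        (volume.prod volume) :=
      (hf.aestronglyMeasurable.comp_quasiMeasurePreserving
        (quasiMeasurePreserving_sub_of_right_invariant volume volume)).sub
        hf.aestronglyMeasurable.comp_fst
    exact h1.mul h2.enorm
  calc ∫⁻ x, ‖moll k f x - f x‖ₑ
      ≤ ∫⁻ x, ∫⁻ y, ENNReal.ofReal (k y) * ‖f (x - y) - f x‖ₑ := lintegral_mono hpt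
    _ = ∫⁻ y, ∫⁻ x, ENNReal.ofReal (k y) * ‖f (x - y) - f x‖ₑ := lintegral_lintegral_swap hmeas
    _ = ∫⁻ y, ENNReal.ofReal (k y) * ∫⁻ x, ‖f (x - y) - f x‖ₑ := by
        refine lintegral_congr fun y => ?_
        rw [lintegral_const_mul' _ _ ENNReal.ofReal_ne_top]
    _ ≤ ∫⁻ y, ENNReal.ofReal (k y) * C := by
        refine lintegral_mono fun y => ?_
        by_cases h : k y = 0
        · simp [h]
        · exact mul_le_mul_right (hC y h) _
    _ = C := by
        rw [lintegral_mul_const _ hk.contDiff.continuous.measurable.ennreal_ofReal, hk.lintegral,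
          one_mul]

/-- Mollification with kernels whose supports shrink to the origin converges in `L¹`. -/
lemma tendsto_lintegral_moll_sub [CompleteSpace V] {k : ℕ → Euc n → ℝ} (hk : ∀ m, IsKernel (k m))
    {r : ℕ → ℝ} (hr : Tendsto r atTop (𝓝 0)) (hkr : ∀ m y, k m y ≠ 0 → ‖y‖ ≤ r m)
    {f : Euc n → V} (hf : Integrable f) :
    Tendsto (fun m => ∫⁻ x, ‖moll (k m) f x - f x‖ₑ) atTop (𝓝 0) := by
  rw [ENNReal.tendsto_nhds_zero]
  intro ε hε
  have h1 := (ENNReal.tendsto_nhds_zero.1 (tendsto_lintegral_translate_sub hf)) ε hε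
  obtain ⟨δ, hδ, h2⟩ := Metric.eventually_nhds_iff.1 h1
  filter_upwards [hr.eventually (gt_mem_nhds hδ)] with m hm
  exact lintegral_moll_sub_le (hk m) hf fun y hy =>
    h2 (by simpa using lt_of_le_of_lt (hkr m y hy) hm)

/-- Rescaled kernels. -/
noncomputable def scaleKernel (ρ : Euc n → ℝ) (ε : ℝ) (y : Euc n) : ℝ := (ε ^ n)⁻¹ * ρ (ε⁻¹ • y)

lemma isKernel_scaleKernel {ρ : Euc n → ℝ} (hρ : IsKernel ρ) {ε : ℝ} (hε : 0 < ε) :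
    IsKernel (scaleKernel ρ ε) where
  contDiff := contDiff_const.mul (hρ.contDiff.comp (contDiff_id.const_smul ε⁻¹))
  nonneg y := mul_nonneg (by positivity) (hρ.nonneg _)
  compact := HasCompactSupport.mul_left (f := fun _ => (ε ^ n)⁻¹) (hρ.compact.comp_smul (inv_ne_zero hε.ne'))
  integral := by
    simp only [scaleKernel]
    rw [integral_const_mul, Measure.integral_comp_inv_smul_of_nonneg _ _ hε.le, hρ.integral]
    simp [hε.ne']

lemma fderiv_scaleKernel {ρ : Euc n → ℝ} (hρ : IsKernel ρ) (ε : ℝ) (y : Euc n) :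
    fderiv ℝ (scaleKernel ρ ε) y = ((ε ^ n)⁻¹ * ε⁻¹) • fderiv ℝ ρ (ε⁻¹ • y) := by
  have h1 : HasFDerivAt ρ (fderiv ℝ ρ (ε⁻¹ • y)) (ε⁻¹ • y) :=
    (hρ.contDiff.differentiable (by simp) _).hasFDerivAt
  have h2 : HasFDerivAt (fun y : Euc n => ε⁻¹ • y) (ε⁻¹ • ContinuousLinearMap.id ℝ (Euc n)) y :=
    (hasFDerivAt_id y).const_smul ε⁻¹
  have h3 := (h1.comp y h2).const_mul ((ε ^ n)⁻¹)
  refine h3.fderiv.trans ?_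
  ext v
  simp [mul_assoc]

lemma integrable_norm_fderiv {k : Euc n → ℝ} (hk : IsKernel k) :
    Integrable fun y => ‖fderiv ℝ k y‖ :=
  ((hk.contDiff.continuous_fderiv (by simp)).integrable_of_hasCompactSupport
    (hk.compact.fderiv (𝕜 := ℝ))).norm

/-- The factor `ε⁻¹`, multiplied by an oscillation of order `ε ^ γ`, produces the exponent `γ - 1`
of the balance condition. -/
lemma integral_norm_fderiv_scaleKernel {ρ : Euc n → ℝ} (hρ : IsKernel ρ) {ε : ℝ} (hε : 0 < ε) :
    ∫ y, ‖fderiv ℝ (scaleKernel ρ ε) y‖ = ε⁻¹ * ∫ y, ‖fderiv ℝ ρ y‖ := by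
  simp only [fderiv_scaleKernel hρ, norm_smul]
  rw [integral_const_mul,
    Measure.integral_comp_inv_smul_of_nonneg _ (fun y => ‖fderiv ℝ ρ y‖) hε.le]
  rw [Real.norm_of_nonneg (by positivity)]
  simp only [finrank_euclideanSpace, Fintype.card_fin, smul_eq_mul]
  field_simp

end Mollify

/-! ### Gradients of mollified maps with zero boundary values. -/

section Gradient

variable {n d : ℕ}

/-- The identification of derivatives with tuples of gradients. -/
noncomputable def gradL : (Euc n →L[ℝ] Euc d) →L[ℝ] Grad n d :=
  ((PiLp.continuousLinearEquiv 2 ℝ (fun _ : Fin d => Euc n)).symm :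
      (Fin d → Euc n) →L[ℝ] Grad n d).comp <|
    ContinuousLinearMap.pi fun i =>
      ((EuclideanSpace.equiv (Fin n) ℝ).symm : (Fin n → ℝ) →L[ℝ] Euc n).comp <|
        ContinuousLinearMap.pi fun k => (EuclideanSpace.proj i).comp
          (ContinuousLinearMap.apply ℝ (Euc d) (EuclideanSpace.single k (1 : ℝ)))

@[simp]
lemma gradL_apply (A : Euc n →L[ℝ] Euc d) (i : Fin d) (k : Fin n) :
    gradL A i k = A (EuclideanSpace.single k 1) i := rfl

lemma apply_eq_inner_gradL (A : Euc n →L[ℝ] Euc d) (v : Euc n) (i : Fin d) :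
    A v i = inner ℝ (gradL A i) v := by
  have hv : v = ∑ k, v k • EuclideanSpace.single k (1 : ℝ) := by
    ext j
    simp [Finset.sum_apply, Pi.single_apply]
  conv_lhs => rw [hv]
  rw [map_sum]
  simp [PiLp.inner_apply]

/-- The operator norm is at most the Frobenius norm, by Cauchy–Schwarz in each row. -/
lemma norm_le_norm_gradL (A : Euc n →L[ℝ] Euc d) : ‖A‖ ≤ ‖gradL A‖ := by
  refine A.opNorm_le_bound (norm_nonneg _) fun v => ?_
  refine le_of_sq_le_sq ?_ (by positivity)
  rw [mul_pow, EuclideanSpace.norm_sq_eq, PiLp.norm_sq_eq_of_L2, Finset.sum_mul]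
  refine Finset.sum_le_sum fun i _ => ?_
  rw [apply_eq_inner_gradL, ← mul_pow]
  exact pow_le_pow_left₀ (norm_nonneg _) (norm_inner_le_norm _ _) 2

/-- The classical gradient. -/
noncomputable def grad (u : Euc n → Euc d) (x : Euc n) : Grad n d := gradL (fderiv ℝ u x)

lemma continuous_grad {u : Euc n → Euc d} (hu : ContDiff ℝ ∞ u) : Continuous (grad u) :=
  gradL.continuous.comp (hu.continuous_fderiv (by simp))

lemma hasCompactSupport_grad {u : Euc n → Euc d} (hu : HasCompactSupport u) :
    HasCompactSupport (grad u) :=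
  (hu.fderiv (𝕜 := ℝ)).comp_left (map_zero gradL)

lemma hasFDerivAt_moll {k : Euc n → ℝ} (hk : IsKernel k) {v : Euc n → Euc d}
    (hv : LocallyIntegrable v) (x : Euc n) :
    HasFDerivAt (moll k v) (∫ y, ((fderiv ℝ k y).smulRight (v (x - y)) : Euc n →L[ℝ] Euc d)) x := by
  have h := hk.compact.hasFDerivAt_convolution_left (ContinuousLinearMap.lsmul ℝ ℝ)
    (hk.contDiff.of_le (by simp)) hv x
  refine HasFDerivAt.congr_fderiv (f := moll _ _) h ?_
  rw [convolution_def]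
  refine integral_congr_ae (ae_of_all _ fun y => ?_)
  ext w
  simp

lemma integrable_smulRight {k : Euc n → ℝ} (hk : IsKernel k) {v : Euc n → Euc d}
    (hv : LocallyIntegrable v) (x : Euc n) :
    Integrable fun y => ((fderiv ℝ k y).smulRight (v (x - y)) : Euc n →L[ℝ] Euc d) := by
  have h := (hk.compact.fderiv (𝕜 := ℝ)).convolutionExists_left
    ((ContinuousLinearMap.lsmul ℝ ℝ : ℝ →L[ℝ] Euc d →L[ℝ] Euc d).precompL (Euc n))
    (hk.contDiff.continuous_fderiv (by simp)) hv x
  refine Integrable.congr h (ae_of_all _ fun y => ?_)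
  ext w
  simp

lemma norm_integral_smulRight_le {k : Euc n → ℝ} {C : ℝ}
    (hC : ∀ y, ‖fderiv ℝ k y‖ ≤ C) {v : Euc n → Euc d} (hv : Integrable v) (x : Euc n) :
    ‖∫ y, ((fderiv ℝ k y).smulRight (v (x - y)) : Euc n →L[ℝ] Euc d)‖ ≤ C * ∫ y, ‖v y‖ := by
  rw [← integral_sub_left_eq_self (fun y => ‖v y‖) volume x, ← integral_const_mul]
  refine norm_integral_le_of_norm_le ((hv.comp_sub_left x).norm.const_mul C)
    (ae_of_all _ fun y => ?_)
  rw [ContinuousLinearMap.norm_smulRight_apply]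
  exact mul_le_mul_of_nonneg_right (hC y) (norm_nonneg _)

lemma norm_moll_le {V : Type*} [NormedAddCommGroup V] [NormedSpace ℝ V] {k : Euc n → ℝ} {C : ℝ}
    (hC : ∀ y, ‖k y‖ ≤ C) {f : Euc n → V} (hf : Integrable f) (x : Euc n) :
    ‖moll k f x‖ ≤ C * ∫ y, ‖f y‖ := by
  rw [← integral_sub_left_eq_self (fun y => ‖f y‖) volume x, ← integral_const_mul]
  refine norm_integral_le_of_norm_le ((hf.comp_sub_left x).norm.const_mul C)
    (ae_of_all _ fun y => ?_)
  rw [norm_smul]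
  exact mul_le_mul_of_nonneg_right (hC y) (norm_nonneg _)

lemma grad_moll_of_smooth {k : Euc n → ℝ} (hk : IsKernel k) {u : Euc n → Euc d}
    (hu : ContDiff ℝ ∞ u) (huc : HasCompactSupport u) (x : Euc n) :
    grad (moll k u) x = moll k (grad u) x := by
  have h := huc.hasFDerivAt_convolution_right (ContinuousLinearMap.lsmul ℝ ℝ)
    hk.integrable.locallyIntegrable (hu.of_le (by simp)) x
  have h2 : HasFDerivAt (moll k u) (∫ y, k y • fderiv ℝ u (x - y)) x := by
    refine HasFDerivAt.congr_fderiv (f := moll _ _) h ?_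
    rw [convolution_def]
    refine integral_congr_ae (ae_of_all _ fun y => ?_)
    ext w
    simp
  have hint : Integrable fun y => k y • fderiv ℝ u (x - y) :=
    integrable_smul_translate hk.contDiff.continuous hk.compact
      (hu.continuous_fderiv (by simp)).locallyIntegrable x
  rw [grad, h2.fderiv, ← ContinuousLinearMap.integral_comp_comm _ hint]
  simp [moll, grad]

/-- Pairs `(v, G)` where `v`, extended by zero, is a limit in `W^{1,1}` of test maps and `G` is the
limit of the gradients. -/
structure ZeroPair (Ω : Opens (Euc n)) (v : Euc n → Euc d) (G : Euc n → Grad n d) : Prop where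
  integrable : Integrable v
  integrable_grad : Integrable G
  support : ∀ x, x ∉ Ω → v x = 0
  support_grad : ∀ x, x ∉ Ω → G x = 0
  approx : ∃ φ : ℕ → 𝓓(Ω, Euc d),
    Tendsto (fun m => ∫⁻ x, ‖φ m x - v x‖ₑ) atTop (𝓝 0) ∧
    Tendsto (fun m => ∫⁻ x, ‖grad (φ m) x - G x‖ₑ) atTop (𝓝 0)

lemma integrable_testMap {Ω : Opens (Euc n)} (φ : 𝓓(Ω, Euc d)) : Integrable φ :=
  φ.continuous.integrable_of_hasCompactSupport φ.hasCompactSupport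

lemma integrable_grad_testMap {Ω : Opens (Euc n)} (φ : 𝓓(Ω, Euc d)) : Integrable (grad φ) :=
  (continuous_grad φ.contDiff).integrable_of_hasCompactSupport
    (hasCompactSupport_grad φ.hasCompactSupport)

lemma tendsto_integral_norm_sub {V : Type*} [NormedAddCommGroup V] {f : ℕ → Euc n → V}
    {g : Euc n → V} (hf : ∀ m, Integrable (f m)) (hg : Integrable g)
    (h : Tendsto (fun m => ∫⁻ x, ‖f m x - g x‖ₑ) atTop (𝓝 0)) :
    Tendsto (fun m => ∫ x, ‖f m x - g x‖) atTop (𝓝 0) := by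
  have h2 := (ENNReal.tendsto_toReal ENNReal.zero_ne_top).comp h
  refine h2.congr fun m => ?_
  exact (integral_norm_eq_lintegral_enorm ((hf m).sub hg).aestronglyMeasurable).symm

/-- The identity is known for test maps. With the derivative on the kernel, the left side is
continuous in `v` for the `L¹` norm, and the right side is so in `G`; hence it survives the limit.
-/
lemma ZeroPair.grad_moll {Ω : Opens (Euc n)} {v : Euc n → Euc d} {G : Euc n → Grad n d}
    (h : ZeroPair Ω v G) {k : Euc n → ℝ} (hk : IsKernel k) (x : Euc n) :
    grad (moll k v) x = moll k G x := by
  obtain ⟨φ, h1, h2⟩ := h.approx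
  obtain ⟨C₁, hC₁⟩ := (hk.contDiff.continuous_fderiv (by simp)).bounded_above_of_compact_support
    (hk.compact.fderiv (𝕜 := ℝ))
  obtain ⟨C₂, hC₂⟩ := hk.contDiff.continuous.bounded_above_of_compact_support hk.compact
  have t1 := tendsto_integral_norm_sub (fun m => integrable_testMap (φ m)) h.integrable h1
  have t2 := tendsto_integral_norm_sub (fun m => integrable_grad_testMap (φ m))
    h.integrable_grad h2
  have l1 : Tendsto (fun m => grad (moll k (φ m)) x) atTop (𝓝 (grad (moll k v) x)) := by
    refine (gradL.continuous.tendsto _).comp ?_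
    rw [tendsto_iff_norm_sub_tendsto_zero]
    refine squeeze_zero (fun _ => norm_nonneg _) (fun m => ?_) (by simpa using t1.const_mul C₁)
    rw [(hasFDerivAt_moll hk (integrable_testMap (φ m)).locallyIntegrable x).fderiv,
      (hasFDerivAt_moll hk h.integrable.locallyIntegrable x).fderiv,
      ← integral_sub (integrable_smulRight hk (integrable_testMap (φ m)).locallyIntegrable x)
        (integrable_smulRight hk h.integrable.locallyIntegrable x)]
    refine le_trans (le_of_eq ?_)
      (norm_integral_smulRight_le hC₁ ((integrable_testMap (φ m)).sub h.integrable) x)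
    congr 2
    ext y w
    simp [smul_sub]
  have l2 : Tendsto (fun m => moll k (grad (φ m)) x) atTop (𝓝 (moll k G x)) := by
    rw [tendsto_iff_norm_sub_tendsto_zero]
    refine squeeze_zero (fun _ => norm_nonneg _) (fun m => ?_) (by simpa using t2.const_mul C₂)
    refine le_trans (le_of_eq ?_)
      (norm_moll_le hC₂ ((integrable_grad_testMap (φ m)).sub h.integrable_grad) x)
    rw [moll, moll, moll, ← integral_sub]
    · simp [smul_sub]
    · exact integrable_smul_translate hk.contDiff.continuous hk.compact
        (integrable_grad_testMap (φ m)).locallyIntegrable x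
    · exact integrable_smul_translate hk.contDiff.continuous hk.compact
        h.integrable_grad.locallyIntegrable x
  have l3 := l1.congr fun m => grad_moll_of_smooth hk (φ m).contDiff (φ m).hasCompactSupport x
  exact tendsto_nhds_unique l3 l2

/-- The derivative of a mollification is controlled by the oscillation of the map. -/
lemma norm_fderiv_moll_le {k : Euc n → ℝ} (hk : IsKernel k) {v : Euc n → Euc d}
    (hv : LocallyIntegrable v) {x : Euc n} {A : ℝ}
    (hA : ∀ y ∈ tsupport k, ‖v (x - y) - v x‖ ≤ A) :
    ‖fderiv ℝ (moll k v) x‖ ≤ (∫ y, ‖fderiv ℝ k y‖) * A := by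
  -- Mollification reproduces constants, so subtracting `v x` leaves the derivative unchanged and
  -- brings in the oscillation.
  have hw : LocallyIntegrable fun y => v y - v x := hv.sub (locallyIntegrable_const _)
  have h1 : moll k (fun y => v y - v x) = fun z => moll k v z - v x := by
    ext1 z
    simp only [moll, smul_sub]
    rw [integral_sub (integrable_smul_translate hk.contDiff.continuous hk.compact hv z)
      (hk.integrable.smul_const _), integral_smul_const, hk.integral, one_smul]
  have h2 : fderiv ℝ (moll k v) x = ∫ y, ((fderiv ℝ k y).smulRight (v (x - y) - v x) : Euc n →L[ℝ] Euc d) := by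
    rw [← (hasFDerivAt_moll hk hw x).fderiv, h1, fderiv_sub_const]
  rw [h2, ← integral_mul_const]
  refine norm_integral_le_of_norm_le ((integrable_norm_fderiv hk).mul_const A)
    (ae_of_all _ fun y => ?_)
  rw [ContinuousLinearMap.norm_smulRight_apply]
  by_cases hy : y ∈ tsupport k
  · exact mul_le_mul_of_nonneg_left (hA y hy) (norm_nonneg _)
  · have : fderiv ℝ k y = 0 := by
      by_contra h
      exact hy (support_fderiv_subset ℝ h)
    simp [this]

end Gradient

/-! ### A Jensen inequality with a threshold. -/

section Convex

lemma convex_smul_le {H : Type*} [AddCommGroup H] [Module ℝ H] {f : H → ℝ}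
    (hf : ConvexOn ℝ univ f) (h0 : f 0 = 0) {s : ℝ} (hs : 0 ≤ s) (hs1 : s ≤ 1) (ξ : H) :
    f (s • ξ) ≤ s * f ξ := by
  have := hf.2 (mem_univ ξ) (mem_univ 0) hs (sub_nonneg.2 hs1) (by ring)
  simpa [h0] using this

/-- A Jensen-type inequality: the upper bound on `f` is only assumed at arguments where the
majorant `g` does not exceed `K`. -/
lemma convex_average_le {α : Type*} [MeasurableSpace α] {μ : Measure α} {H : Type*}
    [NormedAddCommGroup H] [NormedSpace ℝ H] [CompleteSpace H] {f : H → ℝ}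
    (hf : ConvexOn ℝ univ f) (hfc : Continuous f) (h0 : f 0 = 0) (hnn : ∀ ξ, 0 ≤ f ξ)
    {w : α → ℝ} (hw : ∀ y, 0 ≤ w y) (hwi : Integrable w μ) (hw1 : ∫ y, w y ∂μ = 1)
    {ξ : α → H} (hξ : Integrable (fun y => w y • ξ y) μ) {g : α → ℝ} (hg0 : ∀ y, 0 ≤ g y)
    (hgi : Integrable (fun y => w y * g y) μ) {K C : ℝ} (hC : 2 ≤ C)
    (H1 : ∀ᵐ y ∂μ, w y ≠ 0 → ∀ s, 0 ≤ s → s ≤ 1 → s * g y < K → f (s • ξ y) ≤ s * g y + 1)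
    (H2 : f (C⁻¹ • ∫ y, w y • ξ y ∂μ) ≤ K + 1) :
    f (C⁻¹ • ∫ y, w y • ξ y ∂μ) ≤ ∫ y, w y * g y ∂μ + 1 := by
  set I := ∫ y, w y * g y ∂μ with hI
  set z := ∫ y, w y • ξ y ∂μ with hz
  have hI0 : 0 ≤ I := integral_nonneg fun y => mul_nonneg (hw y) (hg0 y)
  rcases le_or_gt K I with hKI | hKI
  · linarith
  -- When the mean `I` is at least `K`, `H2` already suffices. Otherwise `T` serves as truncation
  -- level, strictly below the threshold.
  obtain ⟨T, hT1, hT2⟩ := exists_between hKI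
  have hT0 : 0 < T := hI0.trans_lt hT1
  -- Where `g > T`, the vector `ξ y` is to be replaced by `(T / g y) • ξ y` and its weight
  -- multiplied by `g y / T`. The product stays `w y • ξ y`, and the total mass grows to at most `1
  -- + I / T ≤ 2`.
  let t : α → ℝ := fun y => max (w y) (w y * g y / T)
  have hti : Integrable t μ := hwi.sup (hgi.div_const T)
  set W := ∫ y, t y ∂μ with hW
  have hW1 : 1 ≤ W := by
    rw [← hw1]
    exact integral_mono hwi hti fun y => le_max_left _ _
  have hW2 : W ≤ 2 := by
    have h1 : W ≤ ∫ y, (w y + w y * g y / T) ∂μ := by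
      refine integral_mono hti (hwi.add (hgi.div_const T)) fun y => ?_
      have : 0 ≤ w y * g y / T := div_nonneg (mul_nonneg (hw y) (hg0 y)) hT0.le
      exact max_le (by linarith) (by linarith [hw y])
    rw [integral_add hwi (hgi.div_const T), integral_div, hw1] at h1
    have : I / T ≤ 1 := (div_le_one hT0).2 hT1.le
    linarith
  have hWpos : 0 < W := by linarith
  have main : f (W⁻¹ • z) ≤ I + 1 := by
    refine le_of_forall_lt fun a ha => ?_
    obtain ⟨b, hab, hb⟩ := exists_between ha
    -- Jensen by hand: an affine minorant of `f` taking the value `b < f (W⁻¹ • z)` at the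
    -- barycentre is integrated against `t`.
    obtain ⟨l, c, hlc, hl⟩ := hf.exists_affine_le_of_lt (𝕜 := ℝ) (mem_univ (W⁻¹ • z)) hb
      isClosed_univ (hfc.lowerSemicontinuous.lowerSemicontinuousOn _)
    have hmin : ∀ η, l η + c ≤ f η := fun η => by simpa using hlc ⟨η, mem_univ η⟩
    have hpt : ∀ᵐ y ∂μ, l (w y • ξ y) + c * t y ≤ w y * g y + t y := by
      filter_upwards [H1] with y hy
      by_cases hwy : w y = 0
      · simp [t, hwy]
      have hwp : 0 < w y := lt_of_le_of_ne (hw y) (Ne.symm hwy)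
      set σ := max 1 (g y / T) with hσ
      have hσ1 : 1 ≤ σ := le_max_left _ _
      have hσ0 : 0 < σ := by linarith
      have ht : t y = w y * σ := by
        rw [hσ, mul_max_of_nonneg _ _ (hw y), mul_one, ← mul_div_assoc]
      have hsg : σ⁻¹ * g y < K := by
        refine lt_of_le_of_lt ?_ hT2
        rw [inv_mul_le_iff₀ hσ0]
        have : g y / T ≤ σ := le_max_right _ _
        rwa [div_le_iff₀ hT0] at this
      have h1 := (hmin _).trans (hy hwy σ⁻¹ (by positivity) (inv_le_one_of_one_le₀ hσ1) hsg)
      have h2 := mul_le_mul_of_nonneg_left h1 (mul_pos hwp hσ0).le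
      rw [map_smul, smul_eq_mul] at h2
      rw [map_smul, smul_eq_mul, ht]
      have e1 : w y * σ * (σ⁻¹ * l (ξ y) + c) = w y * l (ξ y) + c * (w y * σ) := by
        field_simp
      have e2 : w y * σ * (σ⁻¹ * g y + 1) = w y * g y + w y * σ := by
        field_simp
      linarith
    have hint := integral_mono_ae ((l.integrable_comp hξ).add (hti.const_mul c))
      (hgi.add hti) hpt
    simp only [Pi.add_apply] at hint
    rw [integral_add (l.integrable_comp hξ) (hti.const_mul c), integral_add hgi hti,
      integral_const_mul, l.integral_comp_comm hξ, ← hz, ← hI, ← hW] at hint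
    have hlb : W⁻¹ * l z + c = b := by simpa using hl
    have hb2 : W * b = l z + c * W := by
      rw [← hlb]; field_simp
    have : W * b ≤ W * (I + 1) := by nlinarith
    exact hab.trans_le (le_of_mul_le_mul_left this hWpos)
  have hCpos : 0 < C := by linarith
  -- Since `W ≤ 2 ≤ C`, passing from `W⁻¹ • z` to `C⁻¹ • z` contracts towards the origin, where `f`
  -- vanishes.
  have hθ : C⁻¹ • z = (W / C) • (W⁻¹ • z) := by
    rw [smul_smul]; congr 1; field_simp
  have hθ1 : W / C ≤ 1 := (div_le_one hCpos).2 (hW2.trans hC)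
  rw [hθ]
  calc f ((W / C) • (W⁻¹ • z)) ≤ W / C * f (W⁻¹ • z) :=
        convex_smul_le hf h0 (by positivity) hθ1 _
    _ ≤ 1 * f (W⁻¹ • z) := mul_le_mul_of_nonneg_right hθ1 (hnn _)
    _ ≤ I + 1 := by rw [one_mul]; exact main

end Convex

/-! ### Consequences of the balance condition. -/

section Balance

variable {n : ℕ} {Ω : Opens (Euc n)}

/-- The consequence of the balance condition on one ball, in terms of almost every pair of
points. -/
lemma exists_balance_of_envelopes {E : Type} [NormedAddCommGroup E] [NormedSpace ℝ E]
    [SeparableSpace E] {N : Euc n → E → ℝ}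
    (hN : IsWeakNFunction Ω N) {B : Set (Euc n)} (hBm : MeasurableSet B) {C R : ℝ} (hR : 0 < R)
    (hB : ∀ ξ, lowerEnv Ω N B (C • ξ) ≤
        ⨆ (η : E) (_ : ‖η‖ = 1), lowerEnv Ω N B (R • η) →
      upperEnv Ω N B ξ ≤ lowerEnv Ω N B (C • ξ) + 1) :
    ∃ K : ℝ, ∀ᵐ x ∂(volume.restrict (B ∩ Ω)), (∀ ξ, ‖C • ξ‖ < R → N x ξ ≤ K + 1) ∧
      ∀ᵐ y ∂(volume.restrict (B ∩ Ω)), ∀ ξ, N y (C • ξ) < K → N x ξ ≤ N y (C • ξ) + 1 := by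
  -- On a null set the essential infimum is `⊤`, so this case is separated; every assertion is then
  -- vacuous.
  by_cases hzero : volume.restrict (B ∩ Ω) = 0
  · exact ⟨0, by simp [hzero]⟩
  have hmeas : MeasurableSet (B ∩ (Ω : Set (Euc n))) := hBm.inter Ω.isOpen.measurableSet
  have hle : volume.restrict (B ∩ Ω) ≤ volume.restrict (Ω : Set (Euc n)) :=
    Measure.restrict_mono inter_subset_right le_rfl
  have hmem : ∀ᵐ x ∂(volume.restrict (B ∩ Ω)), x ∈ B ∩ (Ω : Set (Euc n)) := ae_restrict_mem hmeas
  have hz := ae_mono hle hN.zero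
  have hconv := ae_mono hle hN.convex
  obtain ⟨m₁, m₂, -, -, -, -, -, hb⟩ := hN.bounds
  have hb := ae_mono hle hb
  set S : ℝ≥0∞ := ⨆ (η : E) (_ : ‖η‖ = 1), lowerEnv Ω N B (R • η) with hS
  have hStop : S ≠ ⊤ := by
    refine ne_top_of_le_ne_top (ENNReal.ofReal_ne_top (r := m₂ R)) (iSup₂_le fun η hη => ?_)
    calc lowerEnv Ω N B (R • η)
        ≤ essInf (fun _ => ENNReal.ofReal (m₂ R)) (volume.restrict (B ∩ Ω)) := by
          refine essInf_mono_ae ?_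
          filter_upwards [hb] with y hy
          have := (hy (R • η)).2
          rw [norm_smul, hη, mul_one, Real.norm_of_nonneg hR.le] at this
          exact ENNReal.ofReal_le_ofReal this
      _ = _ := essInf_const _ hzero
  -- Convexity and the zero at the origin make each `N y` nondecreasing along rays, so the supremum
  -- over the sphere of radius `R` controls the whole ball.
  have hlow : ∀ ξ : E, ‖ξ‖ ≤ R → lowerEnv Ω N B ξ ≤ S := by
    intro ξ hξ
    by_cases h : ξ = 0
    · have : lowerEnv Ω N B ξ ≤ 0 := by
        calc lowerEnv Ω N B ξ ≤ essInf (fun _ => (0 : ℝ≥0∞)) (volume.restrict (B ∩ Ω)) := by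
              refine essInf_mono_ae ?_
              filter_upwards [hz] with y hy
              simp [h, hy]
          _ = 0 := essInf_const _ hzero
      exact this.trans zero_le
    · have hn : 0 < ‖ξ‖ := norm_pos_iff.2 h
      refine le_trans ?_ (le_iSup₂_of_le (‖ξ‖⁻¹ • ξ) (by
        rw [norm_smul, norm_inv, norm_norm, inv_mul_cancel₀ hn.ne']) le_rfl)
      refine essInf_mono_ae ?_
      filter_upwards [hz, hconv, hmem] with y hy1 hy2 hy3
      refine ENNReal.ofReal_le_ofReal ?_
      have e : ξ = (‖ξ‖ / R) • (R • ‖ξ‖⁻¹ • ξ) := by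
        rw [smul_smul, smul_smul]
        have : ‖ξ‖ / R * (R * ‖ξ‖⁻¹) = 1 := by field_simp
        rw [← mul_assoc] at this
        rw [this, one_smul]
      have h1 : ‖ξ‖ / R ≤ 1 := (div_le_one hR).2 hξ
      conv_lhs => rw [e]
      exact (convex_smul_le hy2 hy1 (by positivity) h1 _).trans
        (mul_le_of_le_one_left (hN.nonneg y hy3.2 _) h1)
  refine ⟨S.toReal, ?_⟩
  -- The exceptional null sets depend on the vector; a countable dense set gives a single one.
  -- Continuity then reaches all vectors, because the conditions imposed on `ξ` are open and the
  -- conclusions closed.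
  have hup : ∀ᵐ x ∂(volume.restrict (B ∩ Ω)), ∀ i, ENNReal.ofReal (N x (denseSeq E i)) ≤
      upperEnv Ω N B (denseSeq E i) :=
    ae_all_iff.2 fun i => ae_le_essSup
  have hdown : ∀ᵐ y ∂(volume.restrict (B ∩ Ω)), ∀ i, lowerEnv Ω N B (C • denseSeq E i) ≤
      ENNReal.ofReal (N y (C • denseSeq E i)) :=
    ae_all_iff.2 fun i => ae_essInf_le
  have hdense : Dense (range (denseSeq E)) := denseRange_denseSeq E
  filter_upwards [hup, hmem] with x hx hxm
  have hcx : Continuous (N x) := hN.continuous x hxm.2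
  constructor
  · intro ξ hξ
    have hopen : IsOpen {ξ : E | ‖C • ξ‖ < R} :=
      isOpen_lt (by fun_prop) continuous_const
    have hcl : IsClosed {ξ : E | N x ξ ≤ S.toReal + 1} := isClosed_le hcx continuous_const
    refine closure_minimal ?_ hcl (hdense.open_subset_closure_inter hopen hξ)
    rintro _ ⟨hq, i, rfl⟩
    have h1 := hlow _ (le_of_lt hq)
    have h2 := (hx i).trans ((hB _ h1).trans (add_le_add h1 le_rfl))
    rw [← ENNReal.ofReal_toReal hStop, ← ENNReal.ofReal_one,
      ← ENNReal.ofReal_add ENNReal.toReal_nonneg zero_le_one] at h2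
    exact (ENNReal.ofReal_le_ofReal_iff (by positivity)).1 h2
  · filter_upwards [hdown, hmem] with y hy hym ξ hξ
    have hcy : Continuous fun ξ => N y (C • ξ) :=
      (hN.continuous y hym.2).comp (continuous_const_smul C)
    have hopen : IsOpen {ξ : E | N y (C • ξ) < S.toReal} := isOpen_lt hcy continuous_const
    have hcl : IsClosed {ξ : E | N x ξ ≤ N y (C • ξ) + 1} :=
      isClosed_le hcx (hcy.add continuous_const)
    refine closure_minimal ?_ hcl (hdense.open_subset_closure_inter hopen hξ)
    rintro _ ⟨hq, i, rfl⟩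
    have h1 : lowerEnv Ω N B (C • denseSeq E i) ≤ S := by
      refine (hy i).trans ?_
      rw [← ENNReal.ofReal_toReal hStop]
      exact ENNReal.ofReal_le_ofReal (le_of_lt hq)
    have h2 := (hx i).trans ((hB _ h1).trans (add_le_add (hy i) le_rfl))
    rw [← ENNReal.ofReal_one, ← ENNReal.ofReal_add (hN.nonneg y hym.2 _) zero_le_one] at h2
    exact (ENNReal.ofReal_le_ofReal_iff
      (add_nonneg (hN.nonneg y hym.2 _) zero_le_one)).1 h2

/-- The pointwise modular estimate for averages that follows from the balance condition. -/
lemma exists_average_bound {E : Type} [NormedAddCommGroup E] [NormedSpace ℝ E]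
    [FiniteDimensional ℝ E] {M : Euc n → E → ℝ} {γ : ℝ} (hB : BGen γ Ω M) :
    ∃ C C' τ A : ℝ, 0 ≤ C ∧ 0 < C' ∧ 0 < τ ∧ 0 ≤ A ∧ ∀ r, 0 < r → r ≤ 1 →
      ∀ᵐ x ∂(volume.restrict (Ω : Set (Euc n))), ∀ (w : Euc n → ℝ) (ξ : Euc n → E)
        (g : Euc n → ℝ), (∀ y, 0 ≤ w y) → Integrable w → ∫ y, w y = 1 →
        (∀ y, w y ≠ 0 → dist y x < r / 2) →
        Integrable (fun y => w y • ξ y) → (∀ y, y ∉ Ω → ξ y = 0) → (∀ y, 0 ≤ g y) →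
        Integrable (fun y => w y * g y) →
        (∀ᵐ y ∂(volume.restrict (Ω : Set (Euc n))), M y (C • ξ y) ≤ g y) →
        ‖∫ y, w y • ξ y‖ ≤ τ * r ^ (γ - 1) →
        M x (C'⁻¹ • ∫ y, w y • ξ y) ≤ A * ((∫ y, w y * g y) + 1) := by
  have : CompleteSpace E := FiniteDimensional.complete ℝ E
  obtain ⟨L, ℓ, P, N, -, -, hN, hMN, c, C, hc, hC, hbal⟩ := hB
  let Q : ∀ j, E →L[ℝ] Euc (ℓ j) := fun j => LinearMap.toContinuousLinearMap (P j)
  have hQ : ∀ j ξ, Q j ξ = P j ξ := fun _ _ => rfl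
  have hsum : ∀ j, ‖Q j‖ ≤ ∑ j, ‖Q j‖ := fun j =>
    Finset.single_le_sum (f := fun j => ‖Q j‖) (fun _ _ => norm_nonneg _) (Finset.mem_univ j)
  have hsum0 : 0 ≤ ∑ j, ‖Q j‖ := Finset.sum_nonneg fun _ _ => norm_nonneg _
  -- `max 2 C` serves both `convex_average_le`, which needs 2, and the dilation `C` of the balance
  -- condition. The third constant compensates for the norms of the projections, and `L` counts the
  -- summands.
  refine ⟨C, max 2 C, (1 + ∑ j, ‖Q j‖)⁻¹, L, by positivity, by positivity, by positivity, by positivity,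
    fun r hr hr1 => ?_⟩
  have hRpos : 0 < c * r ^ (γ - 1) := mul_pos (by linarith) (Real.rpow_pos_of_pos hr _)
  -- Only countably many balls can be treated outside one null set. A ball of radius `r` about a
  -- dense point within `r / 2` of `x` contains the support of every weight that lives within `r /
  -- 2` of `x`.
  have hex := fun (i : ℕ) (j : Fin L) => exists_balance_of_envelopes (hN j)
    (B := Metric.ball (denseSeq (Euc n) i) r) Metric.isOpen_ball.measurableSet (C := C) hRpos
    (hbal (denseSeq (Euc n) i) r hr hr1 j)
  choose K hK using hex
  have hgood : ∀ᵐ x ∂(volume.restrict (Ω : Set (Euc n))), ∀ i j,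
      x ∈ Metric.ball (denseSeq (Euc n) i) r →
      (∀ ξ, ‖C • ξ‖ < c * r ^ (γ - 1) → N j x ξ ≤ K i j + 1) ∧
      ∀ᵐ y ∂(volume.restrict (Ω : Set (Euc n))), y ∈ Metric.ball (denseSeq (Euc n) i) r →
        ∀ ξ, N j y (C • ξ) < K i j → N j x ξ ≤ N j y (C • ξ) + 1 := by
    refine ae_all_iff.2 fun i => ae_all_iff.2 fun j => ?_
    have h := hK i j
    rw [← Measure.restrict_restrict Metric.isOpen_ball.measurableSet,
      ae_restrict_iff' Metric.isOpen_ball.measurableSet] at h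
    filter_upwards [h] with x hx hxb
    obtain ⟨h1, h2⟩ := hx hxb
    rw [ae_restrict_iff' Metric.isOpen_ball.measurableSet] at h2
    exact ⟨h1, h2⟩
  have hall : ∀ᵐ x ∂(volume.restrict (Ω : Set (Euc n))), ∀ j, N j x 0 = 0 ∧
      ConvexOn ℝ univ (N j x) :=
    ae_all_iff.2 fun j => (hN j).zero.and (hN j).convex
  filter_upwards [hgood, hall, ae_restrict_mem Ω.isOpen.measurableSet]
    with x hx hxN hxΩ w ξ g hw hwi hw1 hsupp hξ hξ0 hg0 hgi hMg hnorm
  obtain ⟨i, hi⟩ : ∃ i, dist x (denseSeq (Euc n) i) < r / 2 := by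
    obtain ⟨i, hi⟩ := (denseRange_denseSeq (Euc n)).exists_dist_lt x (half_pos hr)
    exact ⟨i, hi⟩
  have key : ∀ j, N j x (P j ((max 2 C)⁻¹ • ∫ y, w y • ξ y)) ≤ (∫ y, w y * g y) + 1 := by
    intro j
    obtain ⟨h1, h2⟩ := hx i j (by rw [Metric.mem_ball]; linarith)
    have hint : Integrable fun y => w y • Q j (ξ y) := by
      simpa using (Q j).integrable_comp hξ
    have hQint : Q j (∫ y, w y • ξ y) = ∫ y, w y • Q j (ξ y) := by
      rw [← (Q j).integral_comp_comm hξ]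
      simp
    rw [← hQ, map_smul, hQint]
    refine convex_average_le (hxN j).2 ((hN j).continuous x hxΩ) (hxN j).1
      ((hN j).nonneg x hxΩ) hw hwi hw1 hint hg0 hgi (K := K i j) (le_max_left _ _) ?_ ?_
    · have h2' := (ae_restrict_iff' Ω.isOpen.measurableSet).1 h2
      have hMg' := (ae_restrict_iff' Ω.isOpen.measurableSet).1 hMg
      have hall' := (ae_restrict_iff' Ω.isOpen.measurableSet).1 hall
      filter_upwards [h2', hMg', hall'] with y hy1 hy2 hy3 hwy s hs0 hs1 hsg
      by_cases hyΩ : y ∈ Ω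
      · have hyb : y ∈ Metric.ball (denseSeq (Euc n) i) r := by
          rw [Metric.mem_ball]
          linarith [dist_triangle y x (denseSeq (Euc n) i), hsupp y hwy]
        -- Convexity turns the bound on the full vector into one on its shrunken multiple; this is
        -- what brings the argument below the threshold `K i j`.
        have hNy : N j y (C • s • Q j (ξ y)) ≤ s * g y := by
          rw [smul_comm]
          refine (convex_smul_le (hy3 hyΩ j).2 (hy3 hyΩ j).1 hs0 hs1 _).trans ?_
          refine mul_le_mul_of_nonneg_left (le_trans ?_ (hy2 hyΩ)) hs0
          rw [hMN y hyΩ, ← map_smul, hQ]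
          exact Finset.single_le_sum (f := fun j => N j y (P j (C • ξ y)))
            (fun j _ => (hN j).nonneg y hyΩ _) (Finset.mem_univ j)
        exact (hy1 hyΩ hyb _ (hNy.trans_lt hsg)).trans (by linarith)
      · rw [hξ0 y hyΩ, map_zero, smul_zero, (hxN j).1]
        have := mul_nonneg hs0 (hg0 y)
        linarith
    · refine h1 _ ?_
      rw [← hQint, smul_smul, norm_smul, Real.norm_of_nonneg (by positivity)]
      have e1 : C * (max 2 C)⁻¹ ≤ 1 := by
        rw [← div_eq_mul_inv]
        exact (div_le_one (by positivity)).2 (le_max_right _ _)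
      have hrp := Real.rpow_pos_of_pos hr (γ - 1)
      calc C * (max 2 C)⁻¹ * ‖Q j (∫ y, w y • ξ y)‖
          ≤ 1 * (‖Q j‖ * ((1 + ∑ j, ‖Q j‖)⁻¹ * r ^ (γ - 1))) :=
            mul_le_mul e1 (((Q j).le_opNorm _).trans
              (mul_le_mul_of_nonneg_left hnorm (norm_nonneg _))) (norm_nonneg _) zero_le_one
        _ = (‖Q j‖ * (1 + ∑ j, ‖Q j‖)⁻¹) * r ^ (γ - 1) := by ring
        _ ≤ 1 * r ^ (γ - 1) := by
            refine mul_le_mul_of_nonneg_right ?_ hrp.le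
            rw [← div_eq_mul_inv]
            exact (div_le_one (by positivity)).2 (by linarith [hsum j])
        _ < c * r ^ (γ - 1) := mul_lt_mul_of_pos_right hc hrp
  rw [hMN x hxΩ]
  calc ∑ j, N j x (P j ((max 2 C)⁻¹ • ∫ y, w y • ξ y))
      ≤ ∑ _j : Fin L, ((∫ y, w y * g y) + 1) := Finset.sum_le_sum fun j _ => key j
    _ = L * ((∫ y, w y * g y) + 1) := by simp; ring

end Balance

/-! ### Scaling properties of the modular. -/

section Modular

variable {n : ℕ} {Ω : Opens (Euc n)} {E : Type} [NormedAddCommGroup E] [NormedSpace ℝ E]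
  {M : Euc n → E → ℝ}

lemma IsWeakNFunction.aemeasurable_comp (hM : IsWeakNFunction Ω M) {ξ : Euc n → E}
    (hξ : AEStronglyMeasurable ξ (volume.restrict Ω)) :
    AEMeasurable (fun x => M x (ξ x)) (volume.restrict Ω) := by
  refine aemeasurable_caratheodory hM.measurable ?_ hξ
  filter_upwards [ae_restrict_mem Ω.isOpen.measurableSet] with x hx
  exact hM.continuous x hx

lemma IsWeakNFunction.exists_bound (hM : IsWeakNFunction Ω M) {R : ℝ} (hR : 0 ≤ R) :
    ∃ B : ℝ, 0 ≤ B ∧ ∀ᵐ x ∂(volume.restrict (Ω : Set (Euc n))), ∀ ξ, ‖ξ‖ ≤ R → M x ξ ≤ B := by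
  obtain ⟨m₁, m₂, -, h2, -, -, h3, hb⟩ := hM.bounds
  refine ⟨max (m₂ 0) (m₂ R), le_max_of_le_left (h3 0 le_rfl), ?_⟩
  filter_upwards [hb] with x hx ξ hξ
  exact (hx ξ).2.trans (h2.le_max_of_mem_Icc (by simp) (by simpa using hR) ⟨norm_nonneg _, hξ⟩)

lemma IsWeakNFunction.ae_smul_le (hM : IsWeakNFunction Ω M) :
    ∀ᵐ x ∂(volume.restrict (Ω : Set (Euc n))), ∀ (s : ℝ) (ξ : E), 0 ≤ s → s ≤ 1 →
      M x (s • ξ) ≤ M x ξ := by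
  filter_upwards [hM.zero, hM.convex, ae_restrict_mem Ω.isOpen.measurableSet]
    with x h0 hc hx s ξ hs hs1
  exact (convex_smul_le hc h0 hs hs1 ξ).trans (mul_le_of_le_one_left (hM.nonneg x hx ξ) hs1)

/-- Convexity at the midpoint. Splitting a sum costs a factor 2 in the scale, which is why
approximation is required at every scale. -/
lemma IsWeakNFunction.ae_smul_add_le (hM : IsWeakNFunction Ω M) :
    ∀ᵐ x ∂(volume.restrict (Ω : Set (Euc n))), ∀ (Λ : ℝ) (ξ η : E),
      ENNReal.ofReal (M x (Λ • (ξ + η))) ≤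
        ENNReal.ofReal (M x ((2 * Λ) • ξ)) + ENNReal.ofReal (M x ((2 * Λ) • η)) := by
  filter_upwards [hM.convex, ae_restrict_mem Ω.isOpen.measurableSet] with x hc hx Λ ξ η
  have h := hc.2 (mem_univ ((2 * Λ) • ξ)) (mem_univ ((2 * Λ) • η))
    (by norm_num : (0 : ℝ) ≤ 1 / 2) (by norm_num : (0 : ℝ) ≤ 1 / 2) (by norm_num)
  have e : (1 / 2 : ℝ) • ((2 * Λ) • ξ) + (1 / 2 : ℝ) • ((2 * Λ) • η) = Λ • (ξ + η) := by
    rw [smul_smul, smul_smul, smul_add]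
    congr 2 <;> ring
  rw [e] at h
  have h1 := hM.nonneg x hx ((2 * Λ) • ξ)
  have h2 := hM.nonneg x hx ((2 * Λ) • η)
  rw [← ENNReal.ofReal_add h1 h2]
  refine ENNReal.ofReal_le_ofReal ?_
  simp only [smul_eq_mul] at h
  linarith

/-- For `‖ξ‖ ≤ C₀` the value at `2 • ξ` is bounded, and this bound is absorbed into `h`. Iteration
then reaches `2 ^ m`, and monotonicity along rays any `Λ < 2 ^ m`. -/
lemma DeltaTwo.exists_scale (hM : IsWeakNFunction Ω M) (hΔ : DeltaTwo Ω M)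
    (hfin : volume (Ω : Set (Euc n)) ≠ ⊤) {Λ : ℝ} (hΛ : 0 ≤ Λ) :
    ∃ (c : ℝ≥0∞) (h : Euc n → ℝ≥0∞), c ≠ ⊤ ∧ AEMeasurable h (volume.restrict Ω) ∧
      ∫⁻ x in Ω, h x ≠ ⊤ ∧ ∀ᵐ x ∂(volume.restrict (Ω : Set (Euc n))), ∀ ξ : E,
        ENNReal.ofReal (M x (Λ • ξ)) ≤ c * ENNReal.ofReal (M x ξ) + h x := by
  obtain ⟨c₀, C₀, h₀, hc₀, hC₀, hh₀, hint, hle⟩ := hΔ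
  obtain ⟨B, hB0, hB⟩ := hM.exists_bound (R := 2 * C₀) (by positivity)
  have hconst : ∫⁻ _x in (Ω : Set (Euc n)), ENNReal.ofReal B ≠ ⊤ := by
    rw [setLIntegral_const]
    exact ENNReal.mul_ne_top ENNReal.ofReal_ne_top hfin
  have hh₁ : ∫⁻ x in Ω, ENNReal.ofReal (h₀ x) ≠ ⊤ := by
    have := hint.hasFiniteIntegral
    refine ne_top_of_le_ne_top this.ne (lintegral_mono fun x => ?_)
    exact Real.ofReal_le_enorm _
  have hmeas₀ : AEMeasurable (fun x => ENNReal.ofReal (h₀ x) + ENNReal.ofReal B)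
      (volume.restrict Ω) := hint.aestronglyMeasurable.aemeasurable.ennreal_ofReal.add_const _
  have hfin₀ : ∫⁻ x in Ω, (ENNReal.ofReal (h₀ x) + ENNReal.ofReal B) ≠ ⊤ := by
    rw [lintegral_add_right _ measurable_const]
    exact ENNReal.add_ne_top.2 ⟨hh₁, hconst⟩
  have hstep : ∀ᵐ x ∂(volume.restrict (Ω : Set (Euc n))), ∀ ξ : E,
      ENNReal.ofReal (M x ((2 : ℝ) • ξ)) ≤ ENNReal.ofReal c₀ * ENNReal.ofReal (M x ξ) +
        (ENNReal.ofReal (h₀ x) + ENNReal.ofReal B) := by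
    filter_upwards [hle, hB, ae_restrict_mem Ω.isOpen.measurableSet] with x hx1 hx2 hx ξ
    have hn := hM.nonneg x hx ξ
    have hcn := mul_nonneg hc₀.le hn
    rw [← ENNReal.ofReal_mul hc₀.le, ← ENNReal.ofReal_add (hh₀ x hx) hB0,
      ← ENNReal.ofReal_add hcn (add_nonneg (hh₀ x hx) hB0)]
    refine ENNReal.ofReal_le_ofReal ?_
    rcases lt_or_ge C₀ ‖ξ‖ with h | h
    · linarith [hx1 ξ h]
    · have := hx2 ((2 : ℝ) • ξ) (by rw [norm_smul]; norm_num; linarith)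
      linarith [hh₀ x hx]
  have hpow : ∀ m : ℕ, ∃ (c : ℝ≥0∞) (h : Euc n → ℝ≥0∞), c ≠ ⊤ ∧
      AEMeasurable h (volume.restrict Ω) ∧
      ∫⁻ x in Ω, h x ≠ ⊤ ∧ ∀ᵐ x ∂(volume.restrict (Ω : Set (Euc n))), ∀ ξ : E,
        ENNReal.ofReal (M x ((2 ^ m : ℝ) • ξ)) ≤ c * ENNReal.ofReal (M x ξ) + h x := by
    intro m
    induction m with
    | zero => exact ⟨1, 0, by simp, aemeasurable_const, by simp, by simp⟩
    | succ m ih =>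
      obtain ⟨c, h, hc, hm, hf, hb⟩ := ih
      refine ⟨c * ENNReal.ofReal c₀,
        fun x => c * (ENNReal.ofReal (h₀ x) + ENNReal.ofReal B) + h x,
        ENNReal.mul_ne_top hc ENNReal.ofReal_ne_top, (hmeas₀.const_mul c).add hm, ?_, ?_⟩
      · rw [lintegral_add_right' _ hm, lintegral_const_mul' _ _ hc]
        exact ENNReal.add_ne_top.2 ⟨ENNReal.mul_ne_top hc hfin₀, hf⟩
      · filter_upwards [hb, hstep] with x hx1 hx2 ξ
        rw [pow_succ, mul_smul]
        refine (hx1 _).trans ?_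
        calc c * ENNReal.ofReal (M x ((2 : ℝ) • ξ)) + h x
            ≤ c * (ENNReal.ofReal c₀ * ENNReal.ofReal (M x ξ) +
              (ENNReal.ofReal (h₀ x) + ENNReal.ofReal B)) + h x := by
              gcongr; exact hx2 ξ
          _ = _ := by ring
  obtain ⟨m, hm⟩ := pow_unbounded_of_one_lt Λ (by norm_num : (1 : ℝ) < 2)
  obtain ⟨c, h, hc, hmm, hf, hb⟩ := hpow m
  refine ⟨c, h, hc, hmm, hf, ?_⟩
  filter_upwards [hb, hM.ae_smul_le] with x hx1 hx2 ξ
  refine le_trans (ENNReal.ofReal_le_ofReal ?_) (hx1 ξ)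
  have h2 : (0 : ℝ) < 2 ^ m := by positivity
  have := hx2 (Λ / 2 ^ m) ((2 ^ m : ℝ) • ξ) (by positivity) ((div_le_one h2).2 hm.le)
  rwa [smul_smul, div_mul_cancel₀ _ h2.ne'] at this

end Modular

/-! ### Modular approximability by test maps. -/

section Size

variable {n d : ℕ} {Ω : Opens (Euc n)} {M : Euc n → Grad n d → ℝ}

/-- The size of a pair (map, gradient) with respect to `L¹` and the modular with scale `Λ`. -/
noncomputable def size (Ω : Opens (Euc n)) (M : Euc n → Grad n d → ℝ) (Λ : ℝ)
    (v : Euc n → Euc d) (G : Euc n → Grad n d) : ℝ≥0∞ :=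
  (∫⁻ x, ‖v x‖ₑ) + (∫⁻ x, ‖G x‖ₑ) + ∫⁻ x in Ω, ENNReal.ofReal (M x (Λ • G x))

lemma size_add_le (hM : IsWeakNFunction Ω M) (Λ : ℝ) {v w : Euc n → Euc d}
    {G H : Euc n → Grad n d} (hv : AEStronglyMeasurable v) (hG : AEStronglyMeasurable G) :
    size Ω M Λ (v + w) (G + H) ≤ size Ω M (2 * Λ) v G + size Ω M (2 * Λ) w H := by
  have h1 : ∫⁻ x, ‖(v + w) x‖ₑ ≤ (∫⁻ x, ‖v x‖ₑ) + ∫⁻ x, ‖w x‖ₑ := by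
    rw [← lintegral_add_left' hv.enorm]
    exact lintegral_mono fun x => enorm_add_le _ _
  have h2 : ∫⁻ x, ‖(G + H) x‖ₑ ≤ (∫⁻ x, ‖G x‖ₑ) + ∫⁻ x, ‖H x‖ₑ := by
    rw [← lintegral_add_left' hG.enorm]
    exact lintegral_mono fun x => enorm_add_le _ _
  have h3 : ∫⁻ x in Ω, ENNReal.ofReal (M x (Λ • (G + H) x)) ≤
      (∫⁻ x in Ω, ENNReal.ofReal (M x ((2 * Λ) • G x))) +
        ∫⁻ x in Ω, ENNReal.ofReal (M x ((2 * Λ) • H x)) := by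
    have hm : AEMeasurable (fun x => ENNReal.ofReal (M x ((2 * Λ) • G x))) (volume.restrict Ω) :=
      (hM.aemeasurable_comp (hG.restrict.const_smul (2 * Λ))).ennreal_ofReal
    rw [← lintegral_add_left' hm]
    refine lintegral_mono_ae ?_
    filter_upwards [hM.ae_smul_add_le] with x hx
    exact hx Λ (G x) (H x)
  refine (add_le_add (add_le_add h1 h2) h3).trans (le_of_eq ?_)
  simp only [size]
  ring

/-- Modular approximability by test maps, at every scale. -/
def Approximable (Ω : Opens (Euc n)) (M : Euc n → Grad n d → ℝ) (v : Euc n → Euc d)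
    (G : Euc n → Grad n d) : Prop :=
  ∀ Λ : ℝ, 0 ≤ Λ → ∀ η : ℝ≥0∞, 0 < η → ∃ φ : 𝓓(Ω, Euc d), size Ω M Λ (φ - v) (grad φ - G) < η

lemma grad_add {u v : Euc n → Euc d} (hu : ContDiff ℝ ∞ u) (hv : ContDiff ℝ ∞ v) :
    grad (u + v) = grad u + grad v := by
  ext1 x
  simp only [grad, Pi.add_apply]
  rw [fderiv_add (hu.differentiable (by simp) x) (hv.differentiable (by simp) x), map_add]

lemma Approximable.add (hM : IsWeakNFunction Ω M) {v w : Euc n → Euc d}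
    {G H : Euc n → Grad n d} (hv : AEStronglyMeasurable v) (hG : AEStronglyMeasurable G)
    (h1 : Approximable Ω M v G) (h2 : Approximable Ω M w H) :
    Approximable Ω M (v + w) (G + H) := by
  intro Λ hΛ η hη
  have hη2 : 0 < η / 2 := ENNReal.half_pos hη.ne'
  obtain ⟨φ, hφ⟩ := h1 (2 * Λ) (by positivity) _ hη2
  obtain ⟨ψ, hψ⟩ := h2 (2 * Λ) (by positivity) _ hη2
  refine ⟨φ + ψ, ?_⟩
  have e1 : (⇑(φ + ψ) - (v + w) : Euc n → Euc d) = (⇑φ - v) + (⇑ψ - w) := by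
    ext1 x; simp; abel
  have e2 : grad ⇑(φ + ψ) - (G + H) = (grad φ - G) + (grad ψ - H) := by
    have : (⇑(φ + ψ) : Euc n → Euc d) = ⇑φ + ⇑ψ := rfl
    rw [this, grad_add φ.contDiff ψ.contDiff]
    abel
  rw [e1, e2]
  refine (size_add_le hM Λ ?_ ?_).trans_lt ((ENNReal.add_lt_add hφ hψ).trans_eq
    (ENNReal.add_halves η))
  · exact φ.continuous.aestronglyMeasurable.sub hv
  · exact (continuous_grad φ.contDiff).aestronglyMeasurable.sub hG

/-- Closedness of the approximable pairs; it reduces an unbounded map to its truncations. -/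
lemma Approximable.of_limit (hM : IsWeakNFunction Ω M) {w : Euc n → Euc d}
    {H : Euc n → Grad n d}
    (h : ∀ Λ : ℝ, 0 ≤ Λ → ∀ η : ℝ≥0∞, 0 < η → ∃ (v : Euc n → Euc d) (G : Euc n → Grad n d),
      AEStronglyMeasurable v ∧ AEStronglyMeasurable G ∧ Approximable Ω M v G ∧
      size Ω M Λ (v - w) (G - H) < η) :
    Approximable Ω M w H := by
  intro Λ hΛ η hη
  have hη2 : 0 < η / 2 := ENNReal.half_pos hη.ne'
  obtain ⟨v, G, hv, hG, hap, hs⟩ := h (2 * Λ) (by positivity) _ hη2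
  obtain ⟨φ, hφ⟩ := hap (2 * Λ) (by positivity) _ hη2
  refine ⟨φ, ?_⟩
  have e1 : (⇑φ - w : Euc n → Euc d) = (⇑φ - v) + (v - w) := by abel
  have e2 : grad ⇑φ - H = (grad φ - G) + (G - H) := by abel
  rw [e1, e2]
  refine (size_add_le hM Λ ?_ ?_).trans_lt ((ENNReal.add_lt_add hφ hs).trans_eq
    (ENNReal.add_halves η))
  · exact φ.continuous.aestronglyMeasurable.sub hv
  · exact (continuous_grad φ.contDiff).aestronglyMeasurable.sub hG

/-- Convergence of test maps in `W^{1,1}` together with a majorant of the modular at some scale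
gives modular convergence at every scale. -/
lemma Approximable.of_dominated (hM : IsWeakNFunction Ω M) (hΔ : DeltaTwo Ω M)
    (hfin : volume (Ω : Set (Euc n)) ≠ ⊤) {v : Euc n → Euc d} {G : Euc n → Grad n d}
    (hG : AEStronglyMeasurable G)
    (hGM : ∀ Λ : ℝ, 0 ≤ Λ → ∫⁻ x in Ω, ENNReal.ofReal (M x (Λ • G x)) ≠ ⊤)
    (φ : ℕ → 𝓓(Ω, Euc d)) (h1 : Tendsto (fun m => ∫⁻ x, ‖φ m x - v x‖ₑ) atTop (𝓝 0))
    (h2 : Tendsto (fun m => ∫⁻ x, ‖grad (φ m) x - G x‖ₑ) atTop (𝓝 0))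
    {l : ℝ} (hl : 0 < l) {a : Euc n → ℝ≥0∞} {b : ℕ → Euc n → ℝ≥0∞}
    (ham : AEMeasurable a (volume.restrict Ω)) (ha : ∫⁻ x in Ω, a x ≠ ⊤)
    (hb : Tendsto (fun m => ∫⁻ x in Ω, b m x) atTop (𝓝 0))
    (hab : ∀ m, ∀ᵐ x ∂(volume.restrict (Ω : Set (Euc n))),
      ENNReal.ofReal (M x (l • grad (φ m) x)) ≤ a x + b m x) :
    Approximable Ω M v G := by
  intro Λ hΛ η hη
  have hgm : ∀ m, AEStronglyMeasurable (grad (φ m)) :=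
    fun m => (continuous_grad (φ m).contDiff).aestronglyMeasurable
  obtain ⟨ns, hns, hae⟩ := exists_subseq_tendsto_ae hgm hG h2
  -- The majorant is given at scale `l`, whereas splitting off `G` requires scale `2 * Λ`.
  obtain ⟨c, h, hc, hhm, hhf, hscale⟩ :=
    hΔ.exists_scale hM hfin (Λ := 2 * Λ / l) (by positivity)
  have h3 : Tendsto (fun m => ∫⁻ x in Ω,
      ENNReal.ofReal (M x (Λ • (grad (φ (ns m)) - G) x))) atTop (𝓝 0) := by
    refine tendsto_lintegral_zero_of_le_add
      (a := fun x => c * a x + h x + ENNReal.ofReal (M x ((2 * Λ) • G x)))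
      (b := fun m x => c * b (ns m) x) (fun m => ?_) ?_ (fun m => ?_) ?_ ?_ ?_
    · exact (hM.aemeasurable_comp
        (((hgm (ns m)).sub hG).restrict.const_smul Λ)).ennreal_ofReal
    · exact ((ham.const_mul c).add hhm).add
        (hM.aemeasurable_comp (hG.restrict.const_smul (2 * Λ))).ennreal_ofReal
    · filter_upwards [hM.ae_smul_add_le, hscale, hab (ns m), hM.even] with x hx1 hx2 hx3 hx4
      have e : Λ • (grad (φ (ns m)) - G) x = Λ • (grad (φ (ns m)) x + -G x) := by
        simp [sub_eq_add_neg]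
      rw [e]
      refine (hx1 Λ (grad (φ (ns m)) x) (-G x)).trans ?_
      rw [smul_neg, hx4]
      have e2 : (2 * Λ) • grad (φ (ns m)) x = (2 * Λ / l) • (l • grad (φ (ns m)) x) := by
        rw [smul_smul, div_mul_cancel₀ _ hl.ne']
      rw [e2]
      calc ENNReal.ofReal (M x ((2 * Λ / l) • (l • grad (φ (ns m)) x))) +
              ENNReal.ofReal (M x ((2 * Λ) • G x))
          ≤ (c * (a x + b (ns m) x) + h x) + ENNReal.ofReal (M x ((2 * Λ) • G x)) := by
            gcongr
            exact (hx2 _).trans (by gcongr)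
        _ = _ := by ring
    · have hm : AEMeasurable (fun x => c * a x + h x) (volume.restrict Ω) :=
        (ham.const_mul c).add hhm
      rw [lintegral_add_left' hm, lintegral_add_left' (ham.const_mul c), lintegral_const_mul' _ _ hc]
      exact ENNReal.add_ne_top.2 ⟨ENNReal.add_ne_top.2 ⟨ENNReal.mul_ne_top hc ha, hhf⟩,
        hGM _ (by positivity)⟩
    · have := ENNReal.Tendsto.const_mul (hb.comp hns.tendsto_atTop) (Or.inr hc)
      simp only [mul_zero] at this
      refine this.congr fun m => ?_
      rw [lintegral_const_mul' _ _ hc]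
      rfl
    · filter_upwards [ae_restrict_of_ae hae, hM.zero, ae_restrict_mem Ω.isOpen.measurableSet]
        with x hx1 hx2 hx3
      have t1 : Tendsto (fun m => Λ • (grad (φ (ns m)) - G) x) atTop (𝓝 0) := by
        have := (hx1.sub_const (G x)).const_smul Λ
        simpa using this
      have t2 := ((hM.continuous x hx3).tendsto 0).comp t1
      rw [hx2] at t2
      simpa using ENNReal.tendsto_ofReal t2
  have hall := ((h1.comp hns.tendsto_atTop).add (h2.comp hns.tendsto_atTop)).add h3
  simp only [add_zero] at hall
  obtain ⟨m, hm⟩ := (hall.eventually (gt_mem_nhds hη)).exists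
  exact ⟨φ (ns m), hm⟩

end Size

/-! ### Approximation near a point with an inward direction. -/

section Local

variable {n d : ℕ} {Ω : Opens (Euc n)} {M : Euc n → Grad n d → ℝ}

/-- Pairs `(v, G)` in the zero-boundary class with `v` bounded and `γ`-Hölder on the whole space and
`G` of finite modular at every scale. -/
structure Admissible (Ω : Opens (Euc n)) (M : Euc n → Grad n d → ℝ) (γ : ℝ) (v : Euc n → Euc d)
    (G : Euc n → Grad n d) : Prop where
  zeroPair : ZeroPair Ω v G
  bounded : ∃ A : ℝ, ∀ x, ‖v x‖ ≤ A
  holder : ∃ A : ℝ, 0 ≤ A ∧ ∀ x y, ‖v x - v y‖ ≤ A * ‖x - y‖ ^ γ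
  modular : ∀ Λ : ℝ, 0 ≤ Λ → ∫⁻ x in Ω, ENNReal.ofReal (M x (Λ • G x)) ≠ ⊤

/-- Near `x₀`, the direction `a` points into `Ω`, in the sense of a uniform cone condition. -/
def InwardAt (Ω : Opens (Euc n)) (x₀ a : Euc n) (κ r : ℝ) : Prop :=
  0 < κ ∧ 0 < r ∧ ∃ δ₀ : ℝ, 0 < δ₀ ∧ ∀ y ∈ Ω, dist y x₀ < r → ∀ δ, 0 < δ → δ < δ₀ →
    Metric.ball (y + δ • a) (κ * δ) ⊆ Ω

lemma exists_kernel (a : Euc n) {κ : ℝ} (hκ : 0 < κ) :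
    ∃ ρ : Euc n → ℝ, IsKernel ρ ∧ ∀ y, ρ y ≠ 0 → ‖y - a‖ < κ / 2 := by
  let b : ContDiffBump a := ⟨κ / 4, κ / 2, by positivity, by linarith⟩
  refine ⟨b.normed volume, ⟨b.contDiff_normed, b.nonneg_normed, b.hasCompactSupport_normed,
    b.integral_normed⟩, fun y hy => ?_⟩
  have : y ∈ Function.support (b.normed volume) := hy
  rw [b.support_normed_eq, Metric.mem_ball, dist_eq_norm] at this
  exact this

lemma scaleKernel_ne_zero {ρ : Euc n → ℝ} {a : Euc n} {s : ℝ}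
    (hρ : ∀ y, ρ y ≠ 0 → ‖y - a‖ < s) {ε : ℝ} (hε : 0 < ε) {y : Euc n}
    (hy : scaleKernel ρ ε y ≠ 0) : ‖y - ε • a‖ < s * ε := by
  have h1 := hρ (ε⁻¹ • y) (right_ne_zero_of_mul hy)
  have h2 : y - ε • a = ε • (ε⁻¹ • y - a) := by
    rw [smul_sub, smul_smul, mul_inv_cancel₀ hε.ne', one_smul]
  rw [h2, norm_smul, Real.norm_of_nonneg hε.le, mul_comm]
  exact mul_lt_mul_of_pos_right h1 hε

/-- The support of `v` is displaced by `ε • a` with an error below `κ / 2 * ε`. The other half of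
the cone opening `κ * ε` absorbs the closure in the topological support. -/
lemma exists_testMap_eq_moll (hbd : Bornology.IsBounded (Ω : Set (Euc n))) {x₀ a : Euc n}
    {κ r δ₀ : ℝ} (hin : ∀ y ∈ Ω, dist y x₀ < r → ∀ δ, 0 < δ → δ < δ₀ →
      Metric.ball (y + δ • a) (κ * δ) ⊆ Ω) {k : Euc n → ℝ} (hk : IsKernel k) {ε : ℝ} (hε : 0 < ε)
    (hε₀ : ε < δ₀) (hκ : 0 < κ) (hsupp : ∀ y, k y ≠ 0 → ‖y - ε • a‖ < κ / 2 * ε)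
    {v : Euc n → Euc d} (hv : Integrable v) (hv0 : ∀ x, x ∉ Ω → v x = 0)
    (hvr : ∀ x, r ≤ dist x x₀ → v x = 0) : ∃ φ : 𝓓(Ω, Euc d), ⇑φ = moll k v := by
  have hsub : tsupport (moll k v) ⊆ Ω := by
    intro x hx
    obtain ⟨x', hx', hdist⟩ := Metric.mem_closure_iff.1 hx (κ / 2 * ε) (by positivity)
    obtain ⟨y, hy⟩ : ∃ y, k y • v (x' - y) ≠ 0 := by
      by_contra! h
      refine hx' ?_
      simp [moll, h]
    have hky : k y ≠ 0 := fun h => hy (by simp [h])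
    have hvy : v (x' - y) ≠ 0 := fun h => hy (by simp [h])
    have hyΩ : x' - y ∈ Ω := by
      by_contra h
      exact hvy (hv0 _ h)
    have hyr : dist (x' - y) x₀ < r := by
      by_contra h
      exact hvy (hvr _ (not_lt.1 h))
    refine hin _ hyΩ hyr ε hε hε₀ ?_
    rw [Metric.mem_ball]
    have h1 : dist x' (x' - y + ε • a) < κ / 2 * ε := by
      have e : x' - (x' - y + ε • a) = y - ε • a := by abel
      rw [dist_eq_norm, e]
      exact hsupp y hky
    linarith [dist_triangle x x' (x' - y + ε • a)]
  exact ⟨⟨moll k v, contDiff_moll hk hv.locallyIntegrable,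
    Metric.isCompact_of_isClosed_isBounded (isClosed_tsupport _) (hbd.subset hsub), hsub⟩, rfl⟩

lemma moll_eq_integral {V : Type*} [NormedAddCommGroup V] [NormedSpace ℝ V] (k : Euc n → ℝ)
    (f : Euc n → V) (x : Euc n) : moll k f x = ∫ y, k (x - y) • f y := by
  rw [moll, ← integral_sub_left_eq_self _ volume x]
  simp

/-- Majorants for the modular of mollifications of a `γ`-Hölder map. -/
lemma exists_dominated (hM : IsWeakNFunction Ω M)
    (hfin : volume (Ω : Set (Euc n)) ≠ ⊤) {γ : ℝ} (hB : γ = 1 ∨ BGen γ Ω M)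
    {v : Euc n → Euc d} {G : Euc n → Grad n d} (hvG : Admissible Ω M γ v G) {D : ℝ} (hD : 0 ≤ D)
    {k : ℕ → Euc n → ℝ} (hk : ∀ m, IsKernel (k m)) {r : ℕ → ℝ} (hr : ∀ m, 0 < r m)
    (hr1 : ∀ m, r m ≤ 1) (hr0 : Tendsto r atTop (𝓝 0))
    (hkr : ∀ m y, k m y ≠ 0 → ‖y‖ < r m / 2)
    (hgrad : ∀ m x, ‖grad (moll (k m) v) x‖ ≤ D * r m ^ (γ - 1)) :
    ∃ (l : ℝ) (a : Euc n → ℝ≥0∞) (b : ℕ → Euc n → ℝ≥0∞), 0 < l ∧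
      AEMeasurable a (volume.restrict Ω) ∧ ∫⁻ x in Ω, a x ≠ ⊤ ∧
      Tendsto (fun m => ∫⁻ x in Ω, b m x) atTop (𝓝 0) ∧
      ∀ m, ∀ᵐ x ∂(volume.restrict (Ω : Set (Euc n))),
        ENNReal.ofReal (M x (l • grad (moll (k m) v) x)) ≤ a x + b m x := by
  have hconst : ∀ B : ℝ, ∫⁻ _x in (Ω : Set (Euc n)), ENNReal.ofReal B ≠ ⊤ := fun B => by
    rw [setLIntegral_const]
    exact ENNReal.mul_ne_top ENNReal.ofReal_ne_top hfin
  rcases hB with rfl | hB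
  -- For `γ = 1` the power of `r m` is 1: the gradients are uniformly bounded and a constant is a
  -- majorant.
  · obtain ⟨B, hB0, hBle⟩ := hM.exists_bound hD
    refine ⟨1, fun _ => ENNReal.ofReal B, fun _ _ => 0, one_pos, aemeasurable_const, hconst B,
      by simp, fun m => ?_⟩
    filter_upwards [hBle] with x hx
    rw [one_smul, add_zero]
    exact ENNReal.ofReal_le_ofReal (hx _ (by simpa using hgrad m x))
  · obtain ⟨C, C', τ, A, hC, hC', hτ, hA, hav⟩ := exists_average_bound hB
    -- With this scale the averaged gradient satisfies the bound `τ * r m ^ (γ - 1)` that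
    -- `exists_average_bound` demands.
    set l₀ := τ / (D + 1) with hl₀
    have hl₀pos : 0 < l₀ := by positivity
    set f : Euc n → ℝ := (Ω : Set (Euc n)).indicator fun x => M x (C • (l₀ • G x)) with hf
    have hf0 : ∀ x, 0 ≤ f x := indicator_nonneg fun x hx => hM.nonneg x hx _
    have hfi : Integrable f := by
      rw [hf, integrable_indicator_iff Ω.isOpen.measurableSet]
      refine ⟨(hM.aemeasurable_comp ((hvG.zeroPair.integrable_grad.aestronglyMeasurable.restrict
        |>.const_smul l₀).const_smul C)).aestronglyMeasurable, ?_⟩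
      have h1 := hvG.modular (C * l₀) (by positivity)
      refine lt_of_le_of_lt (le_of_eq ?_) (lt_top_iff_ne_top.2 h1)
      refine setLIntegral_congr_fun Ω.isOpen.measurableSet fun x hx => ?_
      dsimp only
      rw [smul_smul]
      exact Real.enorm_of_nonneg (hM.nonneg x hx _)
    refine ⟨C'⁻¹ * l₀, fun x => ENNReal.ofReal A * ‖f x‖ₑ + ENNReal.ofReal A,
      fun m x => ENNReal.ofReal A * ‖moll (k m) f x - f x‖ₑ, by positivity, ?_, ?_, ?_,
      fun m => ?_⟩
    · exact (hfi.aestronglyMeasurable.restrict.enorm.const_mul _).add_const _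
    · rw [lintegral_add_right _ measurable_const, lintegral_const_mul' _ _ ENNReal.ofReal_ne_top]
      exact ENNReal.add_ne_top.2 ⟨ENNReal.mul_ne_top ENNReal.ofReal_ne_top
        hfi.integrableOn.hasFiniteIntegral.ne, hconst A⟩
    · have h1 := tendsto_lintegral_moll_sub hk hr0 (fun m y hy => by
        linarith [hkr m y hy, hr m]) hfi
      have h2 := ENNReal.Tendsto.const_mul h1 (Or.inr (ENNReal.ofReal_ne_top (r := A)))
      rw [mul_zero] at h2
      refine tendsto_of_tendsto_of_tendsto_of_le_of_le tendsto_const_nhds h2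
        (fun _ => zero_le) fun m => ?_
      dsimp only
      rw [lintegral_const_mul' _ _ ENNReal.ofReal_ne_top]
      gcongr
      exact Measure.restrict_le_self
    · filter_upwards [hav (r m) (hr m) (hr1 m)] with x hx
      have hGint : Integrable fun y => k m (x - y) • G y := by
        simpa using (integrable_smul_translate (hk m).contDiff.continuous (hk m).compact
          hvG.zeroPair.integrable_grad.locallyIntegrable x).comp_sub_left x
      have hfint : Integrable fun y => k m (x - y) * f y := by
        simpa using (integrable_smul_translate (hk m).contDiff.continuous (hk m).compact
          hfi.locallyIntegrable x).comp_sub_left x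
      have hcomm : ∀ y, k m (x - y) • (l₀ • G y) = l₀ • (k m (x - y) • G y) :=
        fun y => smul_comm _ _ _
      have hval : ∫ y, k m (x - y) • (l₀ • G y) = l₀ • grad (moll (k m) v) x := by
        simp only [hcomm]
        rw [integral_smul, hvG.zeroPair.grad_moll (hk m), moll_eq_integral]
      have h := hx (fun y => k m (x - y)) (fun y => l₀ • G y) f (fun y => (hk m).nonneg _)
        ((hk m).integrable.comp_sub_left x)
        (by rw [integral_sub_left_eq_self (k m) volume x, (hk m).integral])
        (fun y hy => by rw [dist_comm, dist_eq_norm]; exact hkr m _ hy)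
        (by simp only [hcomm]; exact hGint.smul l₀)
        (fun y hy => by simp [hvG.zeroPair.support_grad y hy]) hf0 hfint
        (by
          filter_upwards [ae_restrict_mem Ω.isOpen.measurableSet] with y hy
          rw [hf, indicator_of_mem hy])
        (by
          rw [hval, norm_smul, Real.norm_of_nonneg hl₀pos.le]
          have hrp := Real.rpow_pos_of_pos (hr m) (γ - 1)
          calc l₀ * ‖grad (moll (k m) v) x‖ ≤ l₀ * (D * r m ^ (γ - 1)) :=
                mul_le_mul_of_nonneg_left (hgrad m x) hl₀pos.le
            _ = τ * (D / (D + 1)) * r m ^ (γ - 1) := by rw [hl₀]; ring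
            _ ≤ τ * 1 * r m ^ (γ - 1) := by
                gcongr
                exact (div_le_one (by positivity)).2 (by linarith)
            _ = _ := by ring)
      rw [hval, smul_smul] at h
      have hmf : ∫ y, k m (x - y) * f y = moll (k m) f x := by
        rw [moll_eq_integral]; simp
      rw [hmf] at h
      -- The estimate gives `A * (moll (k m) f x + 1)`. Comparing the mollification with `f` leaves
      -- a fixed integrable majorant and an error vanishing in `L¹`.
      have h2 : M x ((C'⁻¹ * l₀) • grad (moll (k m) v) x) ≤
          A * ‖f x‖ + A + A * ‖moll (k m) f x - f x‖ := by
        refine h.trans ?_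
        have h3 : moll (k m) f x ≤ ‖f x‖ + ‖moll (k m) f x - f x‖ := by
          have := norm_sub_norm_le (moll (k m) f x) (f x)
          linarith [Real.le_norm_self (moll (k m) f x)]
        nlinarith
      refine (ENNReal.ofReal_le_ofReal h2).trans (le_of_eq ?_)
      rw [ENNReal.ofReal_add (by positivity) (by positivity),
        ENNReal.ofReal_add (by positivity) hA, ENNReal.ofReal_mul hA, ENNReal.ofReal_mul hA,
        ofReal_norm, ofReal_norm]

/-- Modular approximation of maps supported near a point with an inward direction. -/
lemma Admissible.approximable_of_inward (hM : IsWeakNFunction Ω M) (hΔ : DeltaTwo Ω M)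
    (hbd : Bornology.IsBounded (Ω : Set (Euc n))) {γ : ℝ} (hγ0 : 0 ≤ γ)
    (hB : γ = 1 ∨ BGen γ Ω M) {v : Euc n → Euc d} {G : Euc n → Grad n d}
    (hvG : Admissible Ω M γ v G) {x₀ a : Euc n} {κ r : ℝ} (hin : InwardAt Ω x₀ a κ r)
    (hvr : ∀ x, r ≤ dist x x₀ → v x = 0) : Approximable Ω M v G := by
  have hfin : volume (Ω : Set (Euc n)) ≠ ⊤ := hbd.measure_lt_top.ne
  obtain ⟨hκ, -, δ₀, hδ₀, hin⟩ := hin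
  obtain ⟨ρ, hρ, hρs⟩ := exists_kernel a hκ
  obtain ⟨A, hA0, hA⟩ := hvG.holder
  set R : ℝ := ‖a‖ + κ with hR
  have hRpos : 0 < R := by positivity
  -- The first bound keeps `ε m` within the range of the cone condition, the second keeps the radii
  -- `r' m` at most 1.
  set ε₀ : ℝ := min (δ₀ / 2) (1 / (2 * R)) with hε₀
  have hε₀pos : 0 < ε₀ := by positivity
  let ε : ℕ → ℝ := fun m => ε₀ / (m + 1)
  have hε : ∀ m, 0 < ε m := fun m => by positivity
  have hεle : ∀ m, ε m ≤ ε₀ := fun m => div_le_self hε₀pos.le (by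
    have : (0 : ℝ) ≤ m := Nat.cast_nonneg m
    linarith)
  have hεδ : ∀ m, ε m < δ₀ := fun m => by
    linarith [hεle m, min_le_left (δ₀ / 2) (1 / (2 * R))]
  have hε0 : Tendsto ε atTop (𝓝 0) := by
    have := tendsto_one_div_add_atTop_nhds_zero_nat (𝕜 := ℝ) |>.const_mul ε₀
    simpa [ε, div_eq_mul_inv] using this
  -- The kernel lives where `‖y‖ < (‖a‖ + κ / 2) * ε m`, which is inside radius `r' m / 2 = R * ε
  -- m`.
  let r' : ℕ → ℝ := fun m => 2 * R * ε m
  have hr' : ∀ m, 0 < r' m := fun m => by have := hε m; positivity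
  have hr'1 : ∀ m, r' m ≤ 1 := fun m => by
    have h1 : ε m ≤ 1 / (2 * R) := (hεle m).trans (min_le_right _ _)
    calc 2 * R * ε m ≤ 2 * R * (1 / (2 * R)) := by gcongr
      _ = 1 := by field_simp
  have hr'0 : Tendsto r' atTop (𝓝 0) := by simpa using hε0.const_mul (2 * R)
  let k : ℕ → Euc n → ℝ := fun m => scaleKernel ρ (ε m)
  have hk : ∀ m, IsKernel (k m) := fun m => isKernel_scaleKernel hρ (hε m)
  have hks : ∀ m y, k m y ≠ 0 → ‖y - ε m • a‖ < κ / 2 * ε m :=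
    fun m y hy => scaleKernel_ne_zero hρs (hε m) hy
  have hkr : ∀ m y, k m y ≠ 0 → ‖y‖ < r' m / 2 := fun m y hy => by
    have h1 := hks m y hy
    have h2 : ‖y‖ ≤ ‖y - ε m • a‖ + ‖ε m • a‖ := by
      simpa using norm_add_le (y - ε m • a) (ε m • a)
    rw [norm_smul, Real.norm_of_nonneg (hε m).le] at h2
    have h3 : κ / 2 * ε m < κ * ε m := by nlinarith [hε m]
    have h4 : r' m / 2 = ε m * ‖a‖ + κ * ε m := by
      simp only [r', hR]; ring
    linarith
  have hvi := hvG.zeroPair.integrable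
  set J : ℝ := ∫ y, ‖fderiv ℝ ρ y‖ with hJ
  have hJ0 : 0 ≤ J := integral_nonneg fun _ => norm_nonneg _
  set g₀ : ℝ := ‖(gradL : (Euc n →L[ℝ] Euc d) →L[ℝ] Grad n d)‖ with hg₀
  have hg₀0 : 0 ≤ g₀ := ContinuousLinearMap.opNorm_nonneg _
  have hgrad : ∀ m x, ‖grad (moll (k m) v) x‖ ≤ (g₀ * (J * A * (2 * R))) * r' m ^ (γ - 1) := by
    intro m x
    have hosc : ∀ y ∈ tsupport (k m), ‖v (x - y) - v x‖ ≤ A * r' m ^ γ := by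
      intro y hy
      have hyr : ‖y‖ ≤ r' m := by
        have : tsupport (k m) ⊆ Metric.closedBall 0 (r' m) := by
          refine closure_minimal (fun z hz => ?_) Metric.isClosed_closedBall
          rw [mem_closedBall_zero_iff]
          linarith [hkr m z hz, hr' m]
        simpa using this hy
      refine (hA _ _).trans (mul_le_mul_of_nonneg_left ?_ hA0)
      refine Real.rpow_le_rpow (norm_nonneg _) ?_ hγ0
      simpa using hyr
    have h1 := norm_fderiv_moll_le (hk m) hvi.locallyIntegrable hosc
    rw [integral_norm_fderiv_scaleKernel hρ (hε m)] at h1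
    have h2 : ‖grad (moll (k m) v) x‖ ≤ g₀ * ‖fderiv ℝ (moll (k m) v) x‖ :=
      gradL.le_opNorm _
    refine h2.trans ?_
    rw [mul_assoc]
    refine mul_le_mul_of_nonneg_left (h1.trans (le_of_eq ?_)) hg₀0
    rw [Real.rpow_sub_one (hr' m).ne']
    have e : (ε m)⁻¹ = 2 * R / r' m := by
      have := (hε m).ne'
      simp only [r']
      field_simp
    rw [e]
    ring
  obtain ⟨l, a', b, hl, ham, ha, hb, hab⟩ := exists_dominated hM hfin hB hvG
    (D := g₀ * (J * A * (2 * R))) (by positivity) hk hr' hr'1 hr'0 hkr hgrad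
  have hφ := fun m => exists_testMap_eq_moll hbd hin (hk m) (hε m) (hεδ m) hκ (hks m) hvi
    hvG.zeroPair.support hvr
  choose φ hφ using hφ
  have hG := hvG.zeroPair.integrable_grad
  refine Approximable.of_dominated hM hΔ hfin hG.aestronglyMeasurable hvG.modular φ ?_ ?_ hl
    ham ha hb ?_
  · simp only [hφ]
    exact tendsto_lintegral_moll_sub hk hr'0 (fun m y hy => by
      linarith [hkr m y hy, hr' m]) hvi
  · simp only [hφ, hvG.zeroPair.grad_moll (hk _)]
    exact tendsto_lintegral_moll_sub hk hr'0 (fun m y hy => by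
      linarith [hkr m y hy, hr' m]) hG
  · simpa only [hφ] using hab

end Local

/-! ### Localization by cut-off functions. -/

section Cutoff

variable {n d : ℕ} {Ω : Opens (Euc n)} {M : Euc n → Grad n d → ℝ}

/-- The term `v ⊗ ∇θ` in the product rule for `∇(θ v)`. -/
noncomputable def gradTensor (θ : Euc n → ℝ) (v : Euc n → Euc d) (x : Euc n) : Grad n d :=
  gradL ((fderiv ℝ θ x).smulRight (v x) : Euc n →L[ℝ] Euc d)

lemma gradTensor_sub (θ : Euc n → ℝ) (u v : Euc n → Euc d) (x : Euc n) :
    gradTensor θ u x - gradTensor θ v x = gradTensor θ (u - v) x := by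
  rw [gradTensor, gradTensor, ← map_sub]
  congr 1
  ext w i
  simp [mul_sub]

lemma norm_gradTensor_le {θ : Euc n → ℝ} {L : ℝ} (hL : ∀ x, ‖fderiv ℝ θ x‖ ≤ L)
    (v : Euc n → Euc d) (x : Euc n) :
    ‖gradTensor θ v x‖ ≤ ‖(gradL : (Euc n →L[ℝ] Euc d) →L[ℝ] Grad n d)‖ * L * ‖v x‖ := by
  refine (gradL.le_opNorm _).trans ?_
  rw [ContinuousLinearMap.norm_smulRight_apply, mul_assoc]
  exact mul_le_mul_of_nonneg_left (mul_le_mul_of_nonneg_right (hL x) (norm_nonneg _))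
    (ContinuousLinearMap.opNorm_nonneg _)

lemma aestronglyMeasurable_gradTensor {θ : Euc n → ℝ} (hθ : ContDiff ℝ ∞ θ)
    {v : Euc n → Euc d} (hv : AEStronglyMeasurable v) :
    AEStronglyMeasurable (gradTensor θ v) := by
  have h1 : AEStronglyMeasurable fun x =>
      ContinuousLinearMap.smulRightL ℝ (Euc n) (Euc d) (fderiv ℝ θ x) (v x) :=
    (ContinuousLinearMap.smulRightL ℝ (Euc n) (Euc d)).aestronglyMeasurable_comp₂
      (hθ.continuous_fderiv (by simp)).aestronglyMeasurable hv
  exact gradL.continuous.comp_aestronglyMeasurable h1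

lemma grad_smul {θ : Euc n → ℝ} (hθ : ContDiff ℝ ∞ θ) {u : Euc n → Euc d} (hu : ContDiff ℝ ∞ u)
    (x : Euc n) : grad (fun x => θ x • u x) x = θ x • grad u x + gradTensor θ u x := by
  simp only [grad, gradTensor]
  rw [fderiv_fun_smul (hθ.differentiable (by simp) x) (hu.differentiable (by simp) x), map_add,
    map_smul]

lemma exists_testMap_smul {θ : Euc n → ℝ} (hθ : ContDiff ℝ ∞ θ) (φ : 𝓓(Ω, Euc d)) :
    ∃ ψ : 𝓓(Ω, Euc d), ⇑ψ = fun x => θ x • φ x :=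
  ⟨⟨fun x => θ x • φ x, hθ.smul φ.contDiff, φ.hasCompactSupport.smul_left (f := θ),
    (tsupport_smul_subset_right θ φ).trans φ.tsupport_subset⟩, rfl⟩

/-- The Lipschitz bound serves for short distances and the trivial bound 1 for long ones. -/
lemma abs_sub_le_rpow {θ : Euc n → ℝ} (hθ : ContDiff ℝ ∞ θ) (h0 : ∀ x, 0 ≤ θ x)
    (h1 : ∀ x, θ x ≤ 1) {L : ℝ} (hL0 : 0 ≤ L) (hL : ∀ x, ‖fderiv ℝ θ x‖ ≤ L) {γ : ℝ}
    (hγ0 : 0 ≤ γ) (hγ1 : γ ≤ 1) (x y : Euc n) : |θ x - θ y| ≤ (L + 1) * ‖x - y‖ ^ γ := by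
  have hlip : |θ x - θ y| ≤ L * ‖x - y‖ := by
    rw [← Real.norm_eq_abs]
    exact convex_univ.norm_image_sub_le_of_norm_fderiv_le
      (fun z _ => hθ.differentiable (by simp) z) (fun z _ => hL z) (mem_univ y) (mem_univ x)
  have habs : |θ x - θ y| ≤ 1 := by
    rw [abs_le]
    constructor <;> linarith [h0 x, h1 x, h0 y, h1 y]
  rcases (norm_nonneg (x - y)).eq_or_lt with h | h
  · rw [← h, mul_zero] at hlip
    exact hlip.trans (by positivity)
  have hp := Real.rpow_pos_of_pos h γ
  rcases le_or_gt ‖x - y‖ 1 with h2 | h2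
  · have h3 : ‖x - y‖ ≤ ‖x - y‖ ^ γ := by
      simpa using Real.rpow_le_rpow_of_exponent_ge h h2 hγ1
    nlinarith
  · have h3 : 1 ≤ ‖x - y‖ ^ γ := Real.one_le_rpow h2.le hγ0
    nlinarith

lemma ZeroPair.smul {v : Euc n → Euc d} {G : Euc n → Grad n d} (h : ZeroPair Ω v G)
    {θ : Euc n → ℝ} (hθ : ContDiff ℝ ∞ θ) (h0 : ∀ x, 0 ≤ θ x) (h1 : ∀ x, θ x ≤ 1) {L : ℝ}
    (hL : ∀ x, ‖fderiv ℝ θ x‖ ≤ L) :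
    ZeroPair Ω (fun x => θ x • v x) (fun x => θ x • G x + gradTensor θ v x) := by
  set g₀ := ‖(gradL : (Euc n →L[ℝ] Euc d) →L[ℝ] Grad n d)‖ with hg₀
  have hθm : AEStronglyMeasurable θ := hθ.continuous.aestronglyMeasurable
  have hθn : ∀ x, ‖θ x‖ ≤ 1 := fun x => by rw [Real.norm_of_nonneg (h0 x)]; exact h1 x
  have hsm : ∀ {V : Type} [NormedAddCommGroup V] [NormedSpace ℝ V] (w : V) (x : Euc n),
      ‖θ x • w‖ ≤ ‖w‖ := fun w x => by
    rw [norm_smul]; exact mul_le_of_le_one_left (norm_nonneg _) (hθn x)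
  obtain ⟨φ, t1, t2⟩ := h.approx
  refine ⟨?_, ?_, fun x hx => by simp [h.support x hx],
    fun x hx => by simp [h.support x hx, h.support_grad x hx, gradTensor], ?_⟩
  · exact h.integrable.mono (hθm.smul h.integrable.aestronglyMeasurable)
      (ae_of_all _ fun x => hsm _ x)
  · refine Integrable.add ?_ ?_
    · exact h.integrable_grad.mono (hθm.smul h.integrable_grad.aestronglyMeasurable)
        (ae_of_all _ fun x => hsm _ x)
    · exact (h.integrable.norm.const_mul (g₀ * L)).mono'
        (aestronglyMeasurable_gradTensor hθ h.integrable.aestronglyMeasurable)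
        (ae_of_all _ fun x => norm_gradTensor_le hL v x)
  · choose ψ hψ using fun m => exists_testMap_smul hθ (φ m)
    refine ⟨ψ, ?_, ?_⟩
    · refine tendsto_of_tendsto_of_tendsto_of_le_of_le tendsto_const_nhds t1
        (fun _ => zero_le) fun m => lintegral_mono fun x => ?_
      rw [hψ]
      simp only [← smul_sub]
      exact enorm_le_iff_norm_le.2 (hsm _ x)
    · have t3 := t2.add (ENNReal.Tendsto.const_mul t1
        (Or.inr (ENNReal.ofReal_ne_top (r := g₀ * L))))
      rw [mul_zero, add_zero] at t3
      refine tendsto_of_tendsto_of_tendsto_of_le_of_le tendsto_const_nhds t3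
        (fun _ => zero_le) fun m => ?_
      dsimp only
      have hm : AEMeasurable fun x => ‖grad (φ m) x - G x‖ₑ :=
        ((integrable_grad_testMap (φ m)).sub h.integrable_grad).aestronglyMeasurable.enorm
      rw [← lintegral_const_mul' _ _ ENNReal.ofReal_ne_top, ← lintegral_add_left' hm]
      refine lintegral_mono fun x => ?_
      rw [hψ, grad_smul hθ (φ m).contDiff]
      have e : θ x • grad (φ m) x + gradTensor θ (φ m) x - (θ x • G x + gradTensor θ v x) =
          θ x • (grad (φ m) x - G x) + gradTensor θ (⇑(φ m) - v) x := by
        rw [← gradTensor_sub, smul_sub]; abel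
      rw [e]
      refine (enorm_add_le _ _).trans (add_le_add (enorm_le_iff_norm_le.2 (hsm _ x)) ?_)
      have hL0 : 0 ≤ L := (norm_nonneg _).trans (hL x)
      rw [← ofReal_norm, ← ofReal_norm, ← ENNReal.ofReal_mul (mul_nonneg
        (ContinuousLinearMap.opNorm_nonneg _) hL0)]
      exact ENNReal.ofReal_le_ofReal (norm_gradTensor_le hL _ x)

/-- Boundedness of `v` is what makes this work: it keeps the product Hölder, and it makes the
additional term `v ⊗ ∇θ` bounded, hence of finite modular. -/
lemma Admissible.smul (hM : IsWeakNFunction Ω M) (hfin : volume (Ω : Set (Euc n)) ≠ ⊤) {γ : ℝ}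
    (hγ0 : 0 ≤ γ) (hγ1 : γ ≤ 1) {v : Euc n → Euc d} {G : Euc n → Grad n d}
    (h : Admissible Ω M γ v G)
    {θ : Euc n → ℝ} (hθ : ContDiff ℝ ∞ θ) (h0 : ∀ x, 0 ≤ θ x) (h1 : ∀ x, θ x ≤ 1) {L : ℝ}
    (hL : ∀ x, ‖fderiv ℝ θ x‖ ≤ L) :
    Admissible Ω M γ (fun x => θ x • v x) (fun x => θ x • G x + gradTensor θ v x) := by
  have hL0 : 0 ≤ L := (norm_nonneg _).trans (hL 0)
  obtain ⟨A, hA⟩ := h.bounded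
  have hA0 : 0 ≤ A := (norm_nonneg _).trans (hA 0)
  obtain ⟨A', hA'0, hA'⟩ := h.holder
  have hθn : ∀ x, ‖θ x‖ ≤ 1 := fun x => by rw [Real.norm_of_nonneg (h0 x)]; exact h1 x
  refine ⟨h.zeroPair.smul hθ h0 h1 hL, ⟨A, fun x => ?_⟩,
    ⟨A' + (L + 1) * A, by positivity, fun x y => ?_⟩, fun Λ hΛ => ?_⟩
  · rw [norm_smul]
    exact (mul_le_of_le_one_left (norm_nonneg _) (hθn x)).trans (hA x)
  · have e : θ x • v x - θ y • v y = θ x • (v x - v y) + (θ x - θ y) • v y := by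
      rw [smul_sub, sub_smul]; abel
    rw [e]
    refine (norm_add_le _ _).trans ?_
    rw [norm_smul, norm_smul, add_mul]
    refine add_le_add ((mul_le_of_le_one_left (norm_nonneg _) (hθn x)).trans (hA' x y)) ?_
    calc ‖θ x - θ y‖ * ‖v y‖ ≤ ((L + 1) * ‖x - y‖ ^ γ) * A :=
          mul_le_mul (abs_sub_le_rpow hθ h0 h1 hL0 hL hγ0 hγ1 x y) (hA y) (norm_nonneg _)
            (by positivity)
      _ = _ := by ring
  · obtain ⟨B, hB0, hB⟩ := hM.exists_bound (R := 2 * Λ *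
      (‖(gradL : (Euc n →L[ℝ] Euc d) →L[ℝ] Grad n d)‖ * L * A))
      (mul_nonneg (by positivity) (mul_nonneg (mul_nonneg
        (ContinuousLinearMap.opNorm_nonneg _) hL0) hA0))
    have hconst : ∫⁻ x in (Ω : Set (Euc n)),
        (ENNReal.ofReal (M x ((2 * Λ) • G x)) + ENNReal.ofReal B) ≠ ⊤ := by
      rw [lintegral_add_right _ measurable_const, setLIntegral_const]
      exact ENNReal.add_ne_top.2 ⟨h.modular _ (by positivity),
        ENNReal.mul_ne_top ENNReal.ofReal_ne_top hfin⟩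
    refine ne_top_of_le_ne_top hconst (lintegral_mono_ae ?_)
    filter_upwards [hM.ae_smul_add_le, hM.ae_smul_le, hB] with x hx1 hx2 hx3
    refine (hx1 Λ _ _).trans (add_le_add ?_ ?_)
    · rw [smul_comm]
      exact ENNReal.ofReal_le_ofReal (hx2 _ _ (h0 x) (h1 x))
    · refine ENNReal.ofReal_le_ofReal (hx3 _ ?_)
      rw [norm_smul, Real.norm_of_nonneg (by positivity)]
      refine mul_le_mul_of_nonneg_left ((norm_gradTensor_le hL v x).trans ?_) (by positivity)
      exact mul_le_mul_of_nonneg_left (hA x)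
        (mul_nonneg (ContinuousLinearMap.opNorm_nonneg _) hL0)

/-- Modular approximation of maps supported in a finite union of balls with inward directions. -/
lemma Admissible.approximable_of_cover (hM : IsWeakNFunction Ω M) (hΔ : DeltaTwo Ω M)
    (hbd : Bornology.IsBounded (Ω : Set (Euc n))) {γ : ℝ} (hγ0 : 0 ≤ γ) (hγ1 : γ ≤ 1)
    (hB : γ = 1 ∨ BGen γ Ω M) {a : Euc n → Euc n} {κ r : Euc n → ℝ} {t : Finset (Euc n)}
    (ht : t.Nonempty) (hin : ∀ p ∈ t, InwardAt Ω p (a p) (κ p) (r p)) {v : Euc n → Euc d}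
    {G : Euc n → Grad n d} (hvG : Admissible Ω M γ v G)
    (hsupp : ∀ x, v x ≠ 0 → ∃ p ∈ t, dist x p < r p / 2) : Approximable Ω M v G := by
  have hfin : volume (Ω : Set (Euc n)) ≠ ⊤ := hbd.measure_lt_top.ne
  induction ht using Finset.Nonempty.cons_induction generalizing v G with
  | singleton p =>
    have hp := hin p (by simp)
    refine hvG.approximable_of_inward hM hΔ hbd hγ0 hB hp fun x hx => ?_
    by_contra h
    obtain ⟨q, hq, hxq⟩ := hsupp x h
    rw [Finset.mem_singleton] at hq
    subst hq
    linarith [hp.2.1]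
  | cons p t hpt ht ih =>
    have hp := hin p (by simp)
    have hr : 0 < r p := hp.2.1
    -- `χ • v` lives in the ball of radius `r p` and is treated directly. `(1 - χ) • v` vanishes on
    -- the ball of radius `r p / 2`, so the remaining balls cover its nonzero set.
    let χ : ContDiffBump p := ⟨r p / 2, r p, half_pos hr, half_lt_self hr⟩
    have hχ : ContDiff ℝ ∞ χ := χ.contDiff
    have hχ' : ContDiff ℝ ∞ fun x => 1 - χ x := contDiff_const.sub hχ
    obtain ⟨L, hL⟩ := (hχ.continuous_fderiv (by simp)).bounded_above_of_compact_support
      (χ.hasCompactSupport.fderiv (𝕜 := ℝ))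
    have hder : ∀ x, fderiv ℝ (fun x => 1 - χ x) x = -fderiv ℝ χ x := fun x => fderiv_const_sub _
    have hL' : ∀ x, ‖fderiv ℝ (fun x => 1 - χ x) x‖ ≤ L := fun x => by
      rw [hder, norm_neg]; exact hL x
    have A1 := hvG.smul hM hfin hγ0 hγ1 hχ (fun _ => χ.nonneg) (fun _ => χ.le_one) hL
    have A2 := hvG.smul hM hfin hγ0 hγ1 hχ' (fun _ => sub_nonneg.2 χ.le_one)
      (fun _ => sub_le_self _ χ.nonneg) hL'
    have B1 := A1.approximable_of_inward hM hΔ hbd hγ0 hB hp fun x hx => by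
      rw [χ.zero_of_le_dist hx, zero_smul]
    have B2 := ih (fun q hq => hin q (by simp [hq])) A2 fun x hx => by
      obtain ⟨q, hq, hxq⟩ := hsupp x fun h => hx (by simp [h])
      rcases Finset.mem_cons.1 hq with rfl | hq
      · refine absurd ?_ hx
        rw [χ.one_of_mem_closedBall (by rw [Metric.mem_closedBall]; exact hxq.le)]
        simp
      · exact ⟨q, hq, hxq⟩
    have key := B1.add hM A1.zeroPair.integrable.aestronglyMeasurable
      A1.zeroPair.integrable_grad.aestronglyMeasurable B2
    convert key using 1
    · ext1 x
      simp [sub_smul]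
    · ext1 x
      have : gradTensor (fun x => 1 - χ x) v x = -gradTensor χ v x := by
        simp only [gradTensor, hder]
        rw [← map_neg]
        congr 1
        ext w i
        simp
      simp only [Pi.add_apply, this, sub_smul, one_smul]
      abel

end Cutoff

/-! ### Inward cones in Lipschitz domains. -/

section Geometry

variable {n : ℕ} {Ω : Opens (Euc n)}

/-- Moving up by `δ` raises a point above the graph by `δ`, while a further displacement `w` lowers
this height by at most `(1 + K) * ‖w‖`; hence the opening `(1 + K)⁻¹`. -/
lemma IsBoundedLipschitzDomain.exists_inwardAt (hΩ : IsBoundedLipschitzDomain Ω) {x₀ : Euc n}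
    (hx₀ : x₀ ∈ closure (Ω : Set (Euc n))) : ∃ a κ r, InwardAt Ω x₀ a κ r := by
  by_cases hx : x₀ ∈ Ω
  · obtain ⟨r, hr, hball⟩ := Metric.isOpen_iff.1 Ω.isOpen x₀ hx
    -- At an interior point there is room in all directions, so no shift is needed.
    refine ⟨0, 1, r / 2, one_pos, half_pos hr, r / 2, half_pos hr, fun y _ hy δ _ hδ z hz => ?_⟩
    refine hball ?_
    rw [smul_zero, add_zero, one_mul, Metric.mem_ball] at hz
    rw [Metric.mem_ball]
    linarith [dist_triangle z y x₀]
  · have hfr : x₀ ∈ frontier (Ω : Set (Euc n)) := by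
      rw [Ω.isOpen.frontier_eq]
      exact ⟨hx₀, hx⟩
    obtain ⟨e, g, K, r, he, hg, hr, hiff⟩ := hΩ.lipschitz x₀ hfr
    set p := (Submodule.span ℝ {e})ᗮ.orthogonalProjectionOnto with hp
    have hK : (0 : ℝ) ≤ K := K.2
    -- `r / 2` for `y`, plus less than `r / 4` for each of the shift and the displacement, keeps `z`
    -- in the ball where the graph describes `Ω`.
    refine ⟨e, (1 + K : ℝ)⁻¹, r / 2, by positivity, half_pos hr, r / 4, by positivity,
      fun y hyΩ hy δ hδ0 hδ z hz => ?_⟩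
    rw [Metric.mem_ball, dist_eq_norm] at hz
    set w := z - (y + δ • e) with hw
    have hκ : (1 + K : ℝ)⁻¹ ≤ 1 := inv_le_one_of_one_le₀ (by linarith)
    have hwδ : ‖w‖ < δ := hz.trans_le (mul_le_of_le_one_left hδ0.le hκ)
    have hze : z = y + δ • e + w := by rw [hw]; abel
    have hzr : z ∈ Metric.ball x₀ r := by
      rw [Metric.mem_ball]
      have h1 : dist z y ≤ δ + ‖w‖ := by
        rw [dist_eq_norm, hze]
        have : y + δ • e + w - y = δ • e + w := by abel
        rw [this]
        refine (norm_add_le _ _).trans ?_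
        rw [norm_smul, he, Real.norm_of_nonneg hδ0.le, mul_one]
      linarith [dist_triangle z y x₀]
    refine (hiff z hzr).2 ?_
    have hyb : y ∈ Metric.ball x₀ r := by rw [Metric.mem_ball]; linarith
    have h1 := (hiff y hyb).1 hyΩ
    have hpe : p e = 0 :=
      Submodule.orthogonalProjectionOnto_orthogonalComplement_singleton_eq_zero e
    have hpz : p z = p y + p w := by
      rw [hze, map_add, map_add, map_smul, hpe, smul_zero, add_zero]
    have h2 : g (p z) ≤ g (p y) + K * ‖w‖ := by
      have h3 := hg.dist_le_mul (p z) (p y)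
      rw [Real.dist_eq, dist_eq_norm, hpz, add_sub_cancel_left] at h3
      have h4 : ‖p w‖ ≤ ‖w‖ := Submodule.norm_orthogonalProjectionOnto_apply_le _ _
      have h5 : (K : ℝ) * ‖p w‖ ≤ K * ‖w‖ := mul_le_mul_of_nonneg_left h4 hK
      rw [hpz]
      linarith [le_abs_self (g (p y + p w) - g (p y))]
    have h6 : inner ℝ e z = inner ℝ e y + δ + inner ℝ e w := by
      rw [hze, inner_add_right, inner_add_right, inner_smul_right, real_inner_self_eq_norm_sq, he]
      ring
    have h7 : -‖w‖ ≤ inner ℝ e w := by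
      have := abs_real_inner_le_norm e w
      rw [he, one_mul] at this
      exact (abs_le.1 this).1
    have h8 : (1 + K) * ‖w‖ < δ := by
      have := mul_lt_mul_of_pos_left hz (by linarith : (0 : ℝ) < 1 + K)
      rwa [← mul_assoc, mul_inv_cancel₀ (by linarith), one_mul] at this
    rw [h6]
    linarith

variable {d : ℕ} {M : Euc n → Grad n d → ℝ}

/-- Modular density of test maps among admissible pairs on a bounded Lipschitz domain. -/
lemma Admissible.approximable (hΩ : IsBoundedLipschitzDomain Ω) (hM : IsWeakNFunction Ω M)
    (hΔ : DeltaTwo Ω M) {γ : ℝ} (hγ0 : 0 ≤ γ) (hγ1 : γ ≤ 1)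
    (hB : γ = 1 ∨ BGen γ Ω M) {v : Euc n → Euc d}
    {G : Euc n → Grad n d} (hvG : Admissible Ω M γ v G) : Approximable Ω M v G := by
  have hex : ∀ x : Euc n, ∃ (a : Euc n) (κ r : ℝ), x ∈ closure (Ω : Set (Euc n)) →
      InwardAt Ω x a κ r := by
    intro x
    by_cases hx : x ∈ closure (Ω : Set (Euc n))
    · obtain ⟨a, κ, r, h⟩ := hΩ.exists_inwardAt hx
      exact ⟨a, κ, r, fun _ => h⟩
    · exact ⟨0, 0, 0, fun h => absurd h hx⟩
  choose a κ r hin using hex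
  have hcomp : IsCompact (closure (Ω : Set (Euc n))) := hΩ.bounded.isCompact_closure
  obtain ⟨t, htsub, htcov⟩ := hcomp.elim_nhds_subcover (fun x => Metric.ball x (r x / 2))
    fun x hx => Metric.ball_mem_nhds x (half_pos (hin x hx).2.1)
  have hcov : ∀ x ∈ Ω, ∃ p ∈ t, dist x p < r p / 2 := fun x hx => by
    simpa using htcov (subset_closure hx)
  have hne : t.Nonempty := by
    obtain ⟨x, hx⟩ := hΩ.connected.nonempty
    obtain ⟨p, hp, -⟩ := hcov x hx
    exact ⟨p, hp⟩
  refine hvG.approximable_of_cover hM hΔ hΩ.bounded hγ0 hγ1 hB hne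
    (fun p hp => hin p (htsub p hp)) fun x hx => hcov x ?_
  by_contra h
  exact hx (hvG.zeroPair.support x h)

end Geometry

/-! ### Boundary behaviour and Hölder continuity of the zero extension. -/

section Boundary

variable {n d : ℕ} {Ω : Opens (Euc n)}

/-- A segment leaving `Ω` meets the frontier; otherwise `Ω` and the complement of its closure would
disconnect it. -/
lemma exists_frontier_mem_segment {x y : Euc n} (hx : x ∈ Ω) (hy : y ∉ Ω) :
    ∃ z ∈ frontier (Ω : Set (Euc n)), ‖x - z‖ ≤ ‖x - y‖ := by
  have hpre : IsPreconnected (segment ℝ x y) := (convex_segment x y).isPreconnected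
  by_contra! h
  have hno : ∀ z ∈ segment ℝ x y, z ∉ frontier (Ω : Set (Euc n)) := by
    intro z hz hzf
    have h1 := h z hzf
    rw [← dist_eq_norm, ← dist_eq_norm] at h1
    have := dist_add_dist_of_mem_segment hz
    linarith [dist_nonneg (x := z) (y := y)]
  have hcl : ∀ z ∈ segment ℝ x y, z ∉ Ω → z ∈ (closure (Ω : Set (Euc n)))ᶜ := by
    intro z hz hzΩ hzc
    refine hno z hz ?_
    rw [Ω.isOpen.frontier_eq]
    exact ⟨hzc, hzΩ⟩
  obtain ⟨z, -, hz1, hz2⟩ := hpre Ω (closure (Ω : Set (Euc n)))ᶜ Ω.isOpen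
    isClosed_closure.isOpen_compl
    (fun z hz => by
      by_cases hzΩ : z ∈ Ω
      · exact Or.inl hzΩ
      · exact Or.inr (hcl z hz hzΩ))
    ⟨x, left_mem_segment ℝ x y, hx⟩
    ⟨y, right_mem_segment ℝ x y, hcl y (right_mem_segment ℝ x y) hy⟩
  exact hz2 (subset_closure hz1)

lemma enorm_sub_le_lintegral_fderiv {u : Euc n → Euc d} (hu : ContDiff ℝ ∞ u) {e : Euc n}
    (he : ‖e‖ = 1) {h : ℝ} (hh : 0 ≤ h) (x : Euc n) :
    ‖u x - u (x - h • e)‖ₑ ≤ ∫⁻ t in Ioc 0 h, ‖fderiv ℝ u (x - t • e)‖ₑ := by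
  have hder : ∀ t : ℝ, HasDerivAt (fun t : ℝ => u (x - t • e)) (-(fderiv ℝ u (x - t • e) e)) t := by
    intro t
    have h1 : HasDerivAt (fun t : ℝ => x - t • e) (-e) t := by
      simpa using ((hasDerivAt_id t).smul_const e).const_sub x
    have h2 := (hu.differentiable (by simp) (x - t • e)).hasFDerivAt.comp_hasDerivAt t h1
    rw [map_neg] at h2
    exact h2
  have hcont : Continuous fun t : ℝ => -(fderiv ℝ u (x - t • e) e) := by
    have h1 : Continuous fun t : ℝ => fderiv ℝ u (x - t • e) :=
      (hu.continuous_fderiv (by simp)).comp (by fun_prop)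
    exact (h1.clm_apply continuous_const).neg
  have hint := intervalIntegral.integral_eq_sub_of_hasDerivAt (a := 0) (b := h)
    (fun t _ => hder t) (hcont.intervalIntegrable _ _)
  rw [zero_smul, sub_zero] at hint
  rw [enorm_sub_rev, ← hint, intervalIntegral.integral_of_le hh]
  refine (enorm_integral_le_lintegral_enorm _).trans (lintegral_mono fun t => ?_)
  rw [enorm_neg, enorm_le_iff_norm_le]
  simpa [he] using (fderiv ℝ u (x - t • e)).le_opNorm e

/-- An estimate for test maps on a layer `S` of thickness `h` along the boundary. -/
lemma setLIntegral_layer_le {S : Set (Euc n)} (hS : MeasurableSet S) {e : Euc n} (he : ‖e‖ = 1)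
    {h : ℝ} (hh : 0 ≤ h) (hout : ∀ x ∈ S, x - h • e ∉ Ω)
    (hin : ∀ x ∈ Ω, ∀ t, 0 < t → t ≤ h → x + t • e ∈ S → x ∈ S) (φ : 𝓓(Ω, Euc d)) :
    ∫⁻ x in S, ‖φ x‖ₑ ≤ ENNReal.ofReal h * ∫⁻ x in S, ‖grad φ x‖ₑ := by
  have hf0 : ∀ x, x ∉ Ω → ‖fderiv ℝ φ x‖ₑ = 0 := fun x hx => by
    have hz : fderiv ℝ φ x = 0 := by
      by_contra hne
      exact hx (φ.tsupport_subset (support_fderiv_subset ℝ hne))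
    rw [← ofReal_norm, hz, ContinuousLinearMap.opNorm_zero, ENNReal.ofReal_zero]
  have hφ0 : ∀ x, x ∉ Ω → φ x = 0 := fun x hx => by
    by_contra hne
    exact hx (φ.tsupport_subset (subset_tsupport _ hne))
  have hcf : Continuous (fderiv ℝ φ) := φ.contDiff.continuous_fderiv (by simp)
  have hmeas : Measurable fun p : Euc n × ℝ => ‖fderiv ℝ φ (p.1 - p.2 • e)‖ₑ :=
    (hcf.comp (by fun_prop : Continuous fun p : Euc n × ℝ => p.1 - p.2 • e)).enorm.measurable
  calc ∫⁻ x in S, ‖φ x‖ₑ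
      ≤ ∫⁻ x in S, ∫⁻ t in Ioc 0 h, ‖fderiv ℝ φ (x - t • e)‖ₑ := by
        refine setLIntegral_mono' hS fun x hx => ?_
        have := enorm_sub_le_lintegral_fderiv φ.contDiff he hh x
        rwa [hφ0 _ (hout x hx), sub_zero] at this
    _ = ∫⁻ t in Ioc 0 h, ∫⁻ x in S, ‖fderiv ℝ φ (x - t • e)‖ₑ :=
        lintegral_lintegral_swap hmeas.aemeasurable
    _ ≤ ∫⁻ _t in Ioc 0 h, ∫⁻ x in S, ‖fderiv ℝ φ x‖ₑ := by
        refine setLIntegral_mono' measurableSet_Ioc fun t ht => ?_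
        -- After the shift by `t • e` the integrand is the derivative at a point `x` with `x + t • e
        -- ∈ S`. It vanishes off `Ω`, and `hin` places the remaining points in `S`.
        rw [← lintegral_indicator hS, ← lintegral_indicator hS,
          ← lintegral_add_right_eq_self _ (t • e)]
        refine lintegral_mono fun x => ?_
        by_cases hxS : x + t • e ∈ S
        · rw [indicator_of_mem hxS, add_sub_cancel_right]
          by_cases hxΩ : x ∈ Ω
          · rw [indicator_of_mem (hin x hxΩ t ht.1 ht.2 hxS)]
          · exact (hf0 x hxΩ).le.trans zero_le
        · rw [indicator_of_notMem hxS]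
          exact zero_le
    _ = ENNReal.ofReal h * ∫⁻ x in S, ‖fderiv ℝ φ x‖ₑ := by
        rw [setLIntegral_const, Real.volume_Ioc, sub_zero, mul_comm]
    _ ≤ ENNReal.ofReal h * ∫⁻ x in S, ‖grad φ x‖ₑ := by
        gcongr with x
        exact enorm_le_iff_norm_le.2 (norm_le_norm_gradL _)

lemma ZeroPair.setLIntegral_layer_le {v : Euc n → Euc d} {G : Euc n → Grad n d}
    (hv : ZeroPair Ω v G) {S : Set (Euc n)} (hS : MeasurableSet S) {e : Euc n} (he : ‖e‖ = 1)
    {h : ℝ} (hh : 0 ≤ h) (hout : ∀ x ∈ S, x - h • e ∉ Ω)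
    (hin : ∀ x ∈ Ω, ∀ t, 0 < t → t ≤ h → x + t • e ∈ S → x ∈ S) :
    ∫⁻ x in S, ‖v x‖ₑ ≤ ENNReal.ofReal h * ∫⁻ x in S, ‖G x‖ₑ := by
  obtain ⟨φ, t1, t2⟩ := hv.approx
  have hlim : Tendsto (fun m => ENNReal.ofReal h * ((∫⁻ x in S, ‖G x‖ₑ) +
      ∫⁻ x, ‖grad (φ m) x - G x‖ₑ) + ∫⁻ x, ‖φ m x - v x‖ₑ) atTop
      (𝓝 (ENNReal.ofReal h * ((∫⁻ x in S, ‖G x‖ₑ) + 0) + 0)) :=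
    (ENNReal.Tendsto.const_mul (tendsto_const_nhds.add t2)
      (Or.inr ENNReal.ofReal_ne_top)).add t1
  rw [add_zero, add_zero] at hlim
  refine ge_of_tendsto' hlim fun m => ?_
  have h1 : ∫⁻ x in S, ‖v x‖ₑ ≤ (∫⁻ x in S, ‖φ m x‖ₑ) + ∫⁻ x, ‖φ m x - v x‖ₑ := by
    have hm : AEMeasurable (fun x => ‖φ m x‖ₑ) (volume.restrict S) :=
      (φ m).continuous.aestronglyMeasurable.enorm
    refine le_trans ?_ (add_le_add_right (setLIntegral_le_lintegral S _) _)
    rw [← lintegral_add_left' hm]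
    refine lintegral_mono fun x => ?_
    have : v x = φ m x - (φ m x - v x) := by abel
    conv_lhs => rw [this]
    exact enorm_sub_le
  have h2 : ∫⁻ x in S, ‖grad (φ m) x‖ₑ ≤ (∫⁻ x in S, ‖G x‖ₑ) +
      ∫⁻ x, ‖grad (φ m) x - G x‖ₑ := by
    have hm : AEMeasurable (fun x => ‖G x‖ₑ) (volume.restrict S) :=
      hv.integrable_grad.aestronglyMeasurable.restrict.enorm
    refine le_trans ?_ (add_le_add_right (setLIntegral_le_lintegral S _) _)
    rw [← lintegral_add_left' hm]
    refine lintegral_mono fun x => ?_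
    have : grad (φ m) x = G x + (grad (φ m) x - G x) := by abel
    conv_lhs => rw [this]
    exact enorm_add_le _ _
  refine h1.trans (add_le_add_left ?_ _)
  exact (MusielakOrlicz.setLIntegral_layer_le hS he hh hout hin (φ m)).trans (by gcongr)

/-- A map in the zero-boundary class cannot stay away from zero near a boundary point. -/
lemma ZeroPair.exists_norm_lt (hΩ : IsBoundedLipschitzDomain Ω) {v : Euc n → Euc d}
    {G : Euc n → Grad n d} (hv : ZeroPair Ω v G) {z : Euc n}
    (hz : z ∈ frontier (Ω : Set (Euc n))) {ρ c : ℝ} (hρ : 0 < ρ) (hc : 0 < c) :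
    ∃ y ∈ Ω, dist y z < ρ ∧ ‖v y‖ < c := by
  by_contra! hbig
  obtain ⟨e, g, K, r, he, hg, hr, hiff⟩ := hΩ.lipschitz z hz
  set p := (Submodule.span ℝ {e})ᗮ.orthogonalProjectionOnto with hp
  have hK : (0 : ℝ) ≤ K := K.2
  have hpe : p e = 0 :=
    Submodule.orthogonalProjectionOnto_orthogonalComplement_singleton_eq_zero e
  -- Height above the graph: near `z` it is positive exactly on `Ω`, it vanishes at `z`, and it
  -- grows at unit speed in direction `e`.
  let τ : Euc n → ℝ := fun x => inner ℝ e x - g (p x)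
  have hpc : Continuous p := p.continuous
  have hτc : Continuous τ :=
    (continuous_const.inner continuous_id).sub (hg.continuous.comp hpc)
  have hpt : ∀ (x : Euc n) (t : ℝ), p (x + t • e) = p x := fun x t => by
    rw [map_add, map_smul, hpe, smul_zero, add_zero]
  have hτt : ∀ (x : Euc n) (t : ℝ), τ (x + t • e) = τ x + t := fun x t => by
    simp only [τ]
    rw [hpt, inner_add_right, inner_smul_right, real_inner_self_eq_norm_sq, he]
    ring
  have hmem : ∀ x ∈ Metric.ball z r, (x ∈ Ω ↔ 0 < τ x) := fun x hx => by
    rw [hiff x hx]; exact sub_pos.symm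
  have hzb : z ∈ Metric.ball z r := Metric.mem_ball_self hr
  rw [Ω.isOpen.frontier_eq] at hz
  have hτz : τ z = 0 := by
    refine le_antisymm (not_lt.1 fun h => hz.2 ((hmem z hzb).2 h)) (not_lt.1 fun h => ?_)
    have hopen : IsOpen ({x | τ x < 0} ∩ Metric.ball z r) :=
      (isOpen_lt hτc continuous_const).inter Metric.isOpen_ball
    obtain ⟨y, ⟨hy1, hy2⟩, hyΩ⟩ := mem_closure_iff.1 hz.1 _ hopen ⟨h, hzb⟩
    exact absurd ((hmem y hy2).1 hyΩ) (not_lt.2 (le_of_lt hy1))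
  set ρ' : ℝ := min ρ r with hρ'
  have hρ'pos : 0 < ρ' := lt_min hρ hr
  set s₀ : ℝ := ρ' / 4 with hs₀
  have hs₀pos : 0 < s₀ := by positivity
  -- Height at most `s₀` and horizontal distance below `σ` then give distance at most `s₀ + K * σ +
  -- σ = ρ' / 2` from `z`.
  set σ : ℝ := ρ' / (4 * (K + 1)) with hσ
  have hσpos : 0 < σ := by positivity
  have hσK : (K + 1) * σ = ρ' / 4 := by rw [hσ]; field_simp
  have hloc : ∀ x, ‖p x - p z‖ < σ → |τ x| ≤ s₀ → dist x z < ρ' := by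
    intro x hx hτx
    have hdec : x - z = inner ℝ e (x - z) • e + (p (x - z) : Euc n) := by
      conv_lhs => rw [← (Submodule.span ℝ {e}).starProjection_add_starProjection_orthogonal (x - z)]
      rw [Submodule.starProjection_unit_singleton ℝ he]
      rfl
    have h1 : |inner ℝ e (x - z)| ≤ s₀ + K * σ := by
      have e1 : inner ℝ e (x - z) = τ x + (g (p x) - g (p z)) := by
        have : τ x - τ z = inner ℝ e (x - z) - (g (p x) - g (p z)) := by
          simp only [τ]; rw [inner_sub_right]; ring
        rw [hτz] at this
        linarith
      have h2 : |g (p x) - g (p z)| ≤ K * ‖p x - p z‖ := by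
        have := hg.dist_le_mul (p x) (p z)
        rwa [Real.dist_eq, dist_eq_norm] at this
      rw [e1]
      refine (abs_add_le _ _).trans (add_le_add hτx (h2.trans ?_))
      gcongr
    have h3 : ‖(p (x - z) : Euc n)‖ < σ := by
      rw [map_sub]; exact hx
    have h4 : dist x z ≤ |inner ℝ e (x - z)| + ‖(p (x - z) : Euc n)‖ := by
      rw [dist_eq_norm]
      conv_lhs => rw [hdec]
      refine (norm_add_le _ _).trans ?_
      rw [norm_smul, he, mul_one, Real.norm_eq_abs]
    nlinarith
  let S : ℝ → Set (Euc n) := fun h => {x | ‖p x - p z‖ < σ ∧ 0 < τ x ∧ τ x ≤ h}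
  have hpo : IsOpen {x | ‖p x - p z‖ < σ} :=
    isOpen_lt (hpc.sub continuous_const).norm continuous_const
  have hSm : ∀ h, MeasurableSet (S h) := fun h =>
    hpo.measurableSet.inter ((isOpen_lt continuous_const hτc).measurableSet.inter
      (isClosed_le hτc continuous_const).measurableSet)
  have hlayer : ∀ h, 0 ≤ h → h ≤ s₀ →
      ENNReal.ofReal c * volume (S h) ≤ ENNReal.ofReal h * ∫⁻ x in S h, ‖G x‖ₑ := by
    intro h hh hhs
    refine le_trans ?_ (hv.setLIntegral_layer_le (hSm h) he hh ?_ ?_)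
    · rw [← setLIntegral_const]
      refine setLIntegral_mono' (hSm h) fun x hx => ?_
      have hd := hloc x hx.1 (by rw [abs_of_pos hx.2.1]; exact hx.2.2.trans hhs)
      have hxΩ : x ∈ Ω := (hmem x (Metric.mem_ball.2 (hd.trans_le (min_le_right _ _)))).2 hx.2.1
      rw [← ofReal_norm]
      exact ENNReal.ofReal_le_ofReal (hbig x hxΩ (hd.trans_le (min_le_left _ _)))
    · intro x hx hxΩ
      have e1 : x - h • e = x + (-h) • e := by rw [neg_smul, sub_eq_add_neg]
      rw [e1] at hxΩ
      have h1 := hτt x (-h)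
      have hd := hloc (x + (-h) • e) (by rw [hpt]; exact hx.1) (by
        rw [h1, abs_le]; constructor <;> linarith [hx.2.1, hx.2.2])
      have := (hmem _ (Metric.mem_ball.2 (hd.trans_le (min_le_right _ _)))).1 hxΩ
      rw [h1] at this
      linarith [hx.2.2]
    · intro x hxΩ t ht0 hth hxt
      obtain ⟨h1, h2, h3⟩ := hxt
      rw [hpt] at h1
      rw [hτt] at h2 h3
      have hd := hloc x h1 (by rw [abs_le]; constructor <;> linarith)
      exact ⟨h1, (hmem x (Metric.mem_ball.2 (hd.trans_le (min_le_right _ _)))).1 hxΩ, by linarith⟩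
  have hTpos : 0 < volume (S s₀) := by
    have hopen : IsOpen {x | ‖p x - p z‖ < σ ∧ 0 < τ x ∧ τ x < s₀} :=
      hpo.inter ((isOpen_lt continuous_const hτc).inter (isOpen_lt hτc continuous_const))
    refine (hopen.measure_pos volume ⟨z + (s₀ / 2) • e, ?_, ?_, ?_⟩).trans_le
      (measure_mono fun x hx => ⟨hx.1, hx.2.1, hx.2.2.le⟩)
    · rw [hpt, sub_self, norm_zero]; exact hσpos
    · rw [hτt, hτz]; linarith
    · rw [hτt, hτz]; linarith
  -- Vertical translates of the thin layer fill the thick one, so the volume of a layer is at least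
  -- proportional to its thickness. Against `hlayer` this cancels the factor `h`, leaving the
  -- integral of `‖G‖` over a shrinking layer, which tends to zero.
  have hcover : ∀ N : ℕ, volume (S s₀) ≤ (N + 1 : ℕ) * volume (S (s₀ / (N + 1 : ℕ))) := by
    intro N
    set h : ℝ := s₀ / (N + 1 : ℕ) with hh
    have hN : (0 : ℝ) < (N + 1 : ℕ) := by positivity
    have hhpos : 0 < h := by positivity
    have hNh : (N + 1 : ℕ) * h = s₀ := by rw [hh]; field_simp
    have hsub : S s₀ ⊆ ⋃ j ∈ Finset.range (N + 1), (fun x => x + (-(j * h : ℝ)) • e) ⁻¹' S h := by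
      intro x hx
      obtain ⟨hx1, hx2, hx3⟩ := hx
      -- Layers are open below and closed above, so the ceiling picks the `m` with `m * h < τ x ≤ (m
      -- + 1) * h`.
      obtain ⟨m, hm⟩ : ∃ m, ⌈τ x / h⌉₊ = m + 1 :=
        Nat.exists_eq_succ_of_ne_zero (Nat.ceil_pos.2 (by positivity)).ne'
      have hle : τ x ≤ (m + 1 : ℕ) * h := by
        rw [← div_le_iff₀ hhpos, ← hm]; exact Nat.le_ceil _
      have hlt : (m : ℝ) * h < τ x := by
        rw [← lt_div_iff₀ hhpos]
        exact Nat.lt_ceil.1 (by omega)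
      have hmN : m < N + 1 := by
        have h1 : (m : ℝ) * h < (N + 1 : ℕ) * h := by linarith
        exact_mod_cast lt_of_mul_lt_mul_right h1 hhpos.le
      refine mem_iUnion₂.2 ⟨m, Finset.mem_range.2 hmN, ?_, ?_, ?_⟩
      · rw [hpt]; exact hx1
      · rw [hτt]; linarith
      · rw [hτt]; push_cast at hle; linarith
    calc volume (S s₀) ≤ ∑ j ∈ Finset.range (N + 1),
          volume ((fun x => x + (-(j * h : ℝ)) • e) ⁻¹' S h) :=
          (measure_mono hsub).trans (measure_biUnion_finset_le _ _)
      _ = (N + 1 : ℕ) * volume (S h) := by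
          simp only [measure_preimage_add_right, Finset.sum_const, Finset.card_range, nsmul_eq_mul]
  have hbound : ∀ N : ℕ, ENNReal.ofReal c * volume (S s₀) ≤
      ENNReal.ofReal s₀ * ∫⁻ x in S (s₀ / (N + 1 : ℕ)), ‖G x‖ₑ := by
    intro N
    have hN : (0 : ℝ) < (N + 1 : ℕ) := by positivity
    have hN1 : (1 : ℝ) ≤ (N + 1 : ℕ) := by simp
    have h1 := hlayer (s₀ / (N + 1 : ℕ)) (by positivity) (div_le_self hs₀pos.le hN1)
    calc ENNReal.ofReal c * volume (S s₀)
        ≤ ENNReal.ofReal c * ((N + 1 : ℕ) * volume (S (s₀ / (N + 1 : ℕ)))) := by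
          gcongr; exact hcover N
      _ = (N + 1 : ℕ) * (ENNReal.ofReal c * volume (S (s₀ / (N + 1 : ℕ)))) := by ring
      _ ≤ (N + 1 : ℕ) * (ENNReal.ofReal (s₀ / (N + 1 : ℕ)) *
            ∫⁻ x in S (s₀ / (N + 1 : ℕ)), ‖G x‖ₑ) := by gcongr
      _ = ENNReal.ofReal s₀ * ∫⁻ x in S (s₀ / (N + 1 : ℕ)), ‖G x‖ₑ := by
          rw [← mul_assoc, ← ENNReal.ofReal_natCast, ← ENNReal.ofReal_mul hN.le,
            mul_div_cancel₀ _ hN.ne']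
  have hlim : Tendsto (fun N : ℕ => ∫⁻ x in S (s₀ / (N + 1 : ℕ)), ‖G x‖ₑ) atTop (𝓝 0) := by
    simp only [← lintegral_indicator (hSm _)]
    have := tendsto_lintegral_of_dominated_convergence' (μ := volume)
      (F := fun (N : ℕ) => (S (s₀ / (N + 1 : ℕ))).indicator fun x => ‖G x‖ₑ) (f := fun _ => 0)
      (fun x => ‖G x‖ₑ)
      (fun N => hv.integrable_grad.aestronglyMeasurable.enorm.indicator (hSm _))
      (fun N => ae_of_all _ fun x => indicator_le_self _ _ x)
      hv.integrable_grad.hasFiniteIntegral.ne (ae_of_all _ fun x => ?_)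
    · simpa using this
    · have hz0 : Tendsto (fun N : ℕ => s₀ / (N + 1 : ℕ)) atTop (𝓝 0) := by
        have := (tendsto_const_div_atTop_nhds_zero_nat s₀).comp (tendsto_add_atTop_nat 1)
        exact this
      refine tendsto_const_nhds.congr' ?_
      by_cases hx : 0 < τ x
      · filter_upwards [hz0.eventually (gt_mem_nhds hx)] with N hN
        rw [indicator_of_notMem]
        exact fun h => absurd h.2.2 (not_le.2 hN)
      · filter_upwards with N
        rw [indicator_of_notMem]
        exact fun h => hx h.2.1
  have hlim2 := ENNReal.Tendsto.const_mul hlim (Or.inr (ENNReal.ofReal_ne_top (r := s₀)))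
  rw [mul_zero] at hlim2
  have h0 := ge_of_tendsto' hlim2 hbound
  have h1 : 0 < ENNReal.ofReal c * volume (S s₀) :=
    ENNReal.mul_pos (ENNReal.ofReal_pos.2 hc).ne' hTpos.ne'
  exact absurd h0 (not_le.2 h1)

/-- The zero extension of a Hölder map in the zero-boundary class is Hölder. -/
lemma ZeroPair.holder (hΩ : IsBoundedLipschitzDomain Ω) {v : Euc n → Euc d}
    {G : Euc n → Grad n d} (hv : ZeroPair Ω v G) {γ A : ℝ} (hγ : 0 < γ) (hA : 0 ≤ A)
    (hh : ∀ x ∈ Ω, ∀ y ∈ Ω, ‖v x - v y‖ ≤ A * ‖x - y‖ ^ γ) (x y : Euc n) :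
    ‖v x - v y‖ ≤ A * ‖x - y‖ ^ γ := by
  -- Near `z` there are points of `Ω` at which `v` is arbitrarily small; comparing `v x` with its
  -- value there bounds it by the distance to `z`.
  have hbd : ∀ x ∈ Ω, ∀ z ∈ frontier (Ω : Set (Euc n)), ‖v x‖ ≤ A * ‖x - z‖ ^ γ := by
    intro x hx z hz
    refine le_of_forall_pos_le_add fun ε hε => ?_
    have hcont : Continuous fun y : Euc n => A * ‖x - y‖ ^ γ :=
      continuous_const.mul ((continuous_const.sub continuous_id).norm.rpow_const
        fun _ => Or.inr hγ.le)
    have hev := hcont.tendsto z |>.eventually (gt_mem_nhds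
      (show A * ‖x - z‖ ^ γ < A * ‖x - z‖ ^ γ + ε / 2 by linarith))
    obtain ⟨ρ, hρ, hball⟩ := Metric.eventually_nhds_iff.1 hev
    obtain ⟨y, hyΩ, hyz, hvy⟩ := hv.exists_norm_lt hΩ hz hρ (half_pos hε)
    have h1 := hball hyz
    have h2 := hh x hx y hyΩ
    have h3 : ‖v x‖ ≤ ‖v x - v y‖ + ‖v y‖ := by simpa using norm_add_le (v x - v y) (v y)
    linarith
  have hout : ∀ x ∈ Ω, ∀ y, y ∉ Ω → ‖v x‖ ≤ A * ‖x - y‖ ^ γ := by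
    intro x hx y hy
    obtain ⟨z, hz, hle⟩ := exists_frontier_mem_segment hx hy
    exact (hbd x hx z hz).trans (mul_le_mul_of_nonneg_left
      (Real.rpow_le_rpow (norm_nonneg _) hle hγ.le) hA)
  by_cases hx : x ∈ Ω <;> by_cases hy : y ∈ Ω
  · exact hh x hx y hy
  · rw [hv.support y hy, sub_zero]; exact hout x hx y hy
  · rw [hv.support x hx, zero_sub, norm_neg, norm_sub_rev x y]; exact hout y hy x hx
  · rw [hv.support x hx, hv.support y hy, sub_zero, norm_zero]; positivity

end Boundary

/-! ### Componentwise truncation and the case without regularity. -/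

section Truncation

variable {n d : ℕ} {Ω : Opens (Euc n)} {M : Euc n → Grad n d → ℝ}

/-- A smooth bounded truncation at height `K`. -/
noncomputable def trunc (K s : ℝ) : ℝ := K * Real.arctan (s / K)

/-- The derivative of the truncation. -/
noncomputable def truncDeriv (K s : ℝ) : ℝ := 1 / (1 + (s / K) ^ 2)

lemma hasDerivAt_trunc {K : ℝ} (hK : K ≠ 0) (s : ℝ) :
    HasDerivAt (trunc K) (truncDeriv K s) s := by
  have h1 : HasDerivAt (fun s : ℝ => s / K) (1 / K) s := (hasDerivAt_id s).div_const K
  have h2 := (h1.arctan).const_mul K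
  refine h2.congr_deriv ?_
  rw [truncDeriv]
  field_simp

lemma truncDeriv_nonneg (K s : ℝ) : 0 ≤ truncDeriv K s := by
  rw [truncDeriv]; positivity

lemma truncDeriv_le_one (K s : ℝ) : truncDeriv K s ≤ 1 := by
  rw [truncDeriv]
  exact div_le_one_of_le₀ (by nlinarith [sq_nonneg (s / K)]) (by positivity)

lemma abs_trunc_sub_le {K : ℝ} (hK : K ≠ 0) (s t : ℝ) : |trunc K s - trunc K t| ≤ |s - t| := by
  have h := convex_univ.norm_image_sub_le_of_norm_hasDerivWithin_le (C := 1)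
    (fun x _ => (hasDerivAt_trunc hK x).hasDerivWithinAt)
    (fun x _ => by
      rw [Real.norm_of_nonneg (truncDeriv_nonneg K x)]; exact truncDeriv_le_one K x)
    (mem_univ t) (mem_univ s)
  simpa using h

lemma trunc_zero (K : ℝ) : trunc K 0 = 0 := by simp [trunc]

lemma abs_trunc_le {K : ℝ} (hK : 0 < K) (s : ℝ) : |trunc K s| ≤ K * 2 := by
  rw [trunc, abs_mul, abs_of_pos hK]
  refine mul_le_mul_of_nonneg_left ?_ hK.le
  rw [abs_le]
  constructor <;> linarith [Real.neg_pi_div_two_lt_arctan (s / K), Real.arctan_lt_pi_div_two (s / K),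
    Real.pi_le_four]

lemma contDiff_trunc (K : ℝ) : ContDiff ℝ ∞ (trunc K) :=
  contDiff_const.mul ((contDiff_id.div_const K).arctan)

/-- `K * arctan (s / K)` is the difference quotient at 0 of `h ↦ arctan (s * h)` with increment `1 /
K`. -/
lemma tendsto_trunc (s : ℝ) :
    Tendsto (fun m : ℕ => trunc ((m : ℝ) + 1) s) atTop (𝓝 s) := by
  have h1 : HasDerivAt (fun h : ℝ => Real.arctan (s * h)) s 0 := by
    have h := ((hasDerivAt_id (0 : ℝ)).const_mul s).arctan
    simpa using h
  have h2 := (hasDerivAt_iff_tendsto_slope_zero.1 h1)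
  have h3 : Tendsto (fun m : ℕ => 1 / ((m : ℝ) + 1)) atTop (𝓝[≠] 0) := by
    refine tendsto_nhdsWithin_iff.2 ⟨tendsto_one_div_add_atTop_nhds_zero_nat, ?_⟩
    filter_upwards with m
    have : (0 : ℝ) < 1 / ((m : ℝ) + 1) := by positivity
    exact this.ne'
  refine (h2.comp h3).congr fun m => ?_
  simp [trunc, div_eq_mul_inv]

lemma tendsto_truncDeriv (s : ℝ) :
    Tendsto (fun m : ℕ => truncDeriv ((m : ℝ) + 1) s) atTop (𝓝 1) := by
  have h1 : Tendsto (fun m : ℕ => s / ((m : ℝ) + 1)) atTop (𝓝 0) := by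
    have := tendsto_one_div_add_atTop_nhds_zero_nat (𝕜 := ℝ) |>.const_mul s
    simpa [div_eq_mul_inv] using this
  have h2 : Tendsto (fun m : ℕ => 1 / (1 + (s / ((m : ℝ) + 1)) ^ 2)) atTop
      (𝓝 (1 / (1 + 0 ^ 2))) :=
    tendsto_const_nhds.div (tendsto_const_nhds.add (h1.pow 2)) (by norm_num)
  simpa [truncDeriv] using h2

lemma continuous_truncDeriv (K : ℝ) : Continuous (truncDeriv K) := by
  unfold truncDeriv
  refine continuous_const.div (by fun_prop) fun s => ?_
  positivity

/-- Componentwise truncation of a vector. -/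
noncomputable def truncVec (K : ℝ) (w : Euc d) : Euc d := WithLp.toLp 2 fun i => trunc K (w i)

/-- Componentwise multiplication of a tuple of gradients by scalars. -/
noncomputable def scaleGrad (c : Fin d → ℝ) (ξ : Grad n d) : Grad n d :=
  WithLp.toLp 2 fun i => c i • ξ i

@[simp] lemma truncVec_apply (K : ℝ) (w : Euc d) (i : Fin d) :
    truncVec K w i = trunc K (w i) := rfl

@[simp] lemma scaleGrad_apply (c : Fin d → ℝ) (ξ : Grad n d) (i : Fin d) :
    scaleGrad c ξ i = c i • ξ i := rfl

lemma norm_le_norm_of_apply_le {w z : Euc d} (h : ∀ i, |w i| ≤ |z i|) : ‖w‖ ≤ ‖z‖ := by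
  refine le_of_sq_le_sq ?_ (norm_nonneg _)
  rw [EuclideanSpace.norm_sq_eq, EuclideanSpace.norm_sq_eq]
  exact Finset.sum_le_sum fun i _ => pow_le_pow_left₀ (norm_nonneg _) (h i) 2

lemma norm_scaleGrad_le {c : Fin d → ℝ} (hc : ∀ i, |c i| ≤ 1) (ξ : Grad n d) :
    ‖scaleGrad c ξ‖ ≤ ‖ξ‖ := by
  refine le_of_sq_le_sq ?_ (norm_nonneg _)
  rw [PiLp.norm_sq_eq_of_L2, PiLp.norm_sq_eq_of_L2]
  refine Finset.sum_le_sum fun i _ => pow_le_pow_left₀ (norm_nonneg _) ?_ 2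
  rw [scaleGrad_apply, norm_smul]
  exact mul_le_of_le_one_left (norm_nonneg _) (hc i)

lemma continuous_scaleGrad :
    Continuous fun p : (Fin d → ℝ) × Grad n d => scaleGrad p.1 p.2 := by
  refine (PiLp.continuous_toLp 2 _).comp (continuous_pi fun i => ?_)
  exact ((continuous_apply i).comp continuous_fst).smul
    ((PiLp.continuous_apply 2 _ i).comp continuous_snd)

lemma continuous_truncVec {K : ℝ} : Continuous (truncVec K : Euc d → Euc d) := by
  refine (PiLp.continuous_toLp 2 _).comp (continuous_pi fun i => ?_)
  exact (contDiff_trunc K).continuous.comp (PiLp.continuous_apply 2 _ i)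

lemma norm_truncVec_sub_le {K : ℝ} (hK : K ≠ 0) (w z : Euc d) :
    ‖truncVec K w - truncVec K z‖ ≤ ‖w - z‖ :=
  norm_le_norm_of_apply_le fun _ => by simpa using abs_trunc_sub_le hK _ _

lemma truncVec_zero (K : ℝ) : truncVec K (0 : Euc d) = 0 := by
  ext i; simp [trunc_zero]

lemma exists_norm_truncVec_le {K : ℝ} (hK : 0 < K) : ∃ A, ∀ w : Euc d, ‖truncVec K w‖ ≤ A := by
  refine ⟨√(∑ _i : Fin d, (K * 2) ^ 2), fun w => ?_⟩
  rw [EuclideanSpace.norm_eq]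
  exact Real.sqrt_le_sqrt (Finset.sum_le_sum fun i _ =>
    pow_le_pow_left₀ (norm_nonneg _) (abs_trunc_le hK _) 2)

/-- Because the truncation is smooth and fixes 0, it maps test maps to test maps and the classical
chain rule applies. -/
lemma exists_testMap_truncVec {K : ℝ} (hK : K ≠ 0) (φ : 𝓓(Ω, Euc d)) :
    ∃ ψ : 𝓓(Ω, Euc d), (∀ x, ψ x = truncVec K (φ x)) ∧
      ∀ x, grad ψ x = scaleGrad (fun i => truncDeriv K (φ x i)) (grad φ x) := by
  have hcd : ContDiff ℝ ∞ fun x => truncVec K (φ x) := by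
    rw [contDiff_euclidean]
    intro i
    exact (contDiff_trunc K).comp (contDiff_euclidean.1 φ.contDiff i)
  have hsub : tsupport (fun x => truncVec K (φ x)) ⊆ tsupport φ := by
    refine closure_mono fun x hx h => hx ?_
    simp only [h, truncVec_zero]
  refine ⟨⟨fun x => truncVec K (φ x), hcd, φ.hasCompactSupport.of_isClosed_subset
    (isClosed_tsupport _) hsub, hsub.trans φ.tsupport_subset⟩, fun x => rfl, fun x => ?_⟩
  ext i k
  have h1 : HasFDerivAt (fun x => truncVec K (φ x) i)
      ((EuclideanSpace.proj i : Euc d →L[ℝ] ℝ).comp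
        (fderiv ℝ (fun x => truncVec K (φ x)) x)) x :=
    (EuclideanSpace.proj i : Euc d →L[ℝ] ℝ).hasFDerivAt.comp x
      (hcd.differentiable (by simp) x).hasFDerivAt
  have h2 : HasFDerivAt (fun x => φ x i)
      ((EuclideanSpace.proj i : Euc d →L[ℝ] ℝ).comp (fderiv ℝ φ x)) x :=
    (EuclideanSpace.proj i : Euc d →L[ℝ] ℝ).hasFDerivAt.comp x
      (φ.contDiff.differentiable (by simp) x).hasFDerivAt
  have h3 : HasFDerivAt (fun x => truncVec K (φ x) i) (truncDeriv K (φ x i) •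
      ((EuclideanSpace.proj i : Euc d →L[ℝ] ℝ).comp (fderiv ℝ φ x))) x :=
    HasDerivAt.comp_hasFDerivAt (f := fun x => φ x i) (h₂ := trunc K) x
      (hasDerivAt_trunc hK (φ x i)) h2
  have h4 := congrArg (fun A : Euc n →L[ℝ] ℝ => A (EuclideanSpace.single k 1)) (h1.unique h3)
  exact h4

lemma ZeroPair.truncate {v : Euc n → Euc d} {G : Euc n → Grad n d} (h : ZeroPair Ω v G) {K : ℝ}
    (hK : K ≠ 0) : ZeroPair Ω (fun x => truncVec K (v x))
      (fun x => scaleGrad (fun i => truncDeriv K (v x i)) (G x)) := by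
  have hc1 : ∀ s, |truncDeriv K s| ≤ 1 := fun s => by
    rw [abs_of_nonneg (truncDeriv_nonneg K s)]; exact truncDeriv_le_one K s
  have hcont : Continuous fun w : Euc d => fun i => truncDeriv K (w i) :=
    continuous_pi fun i => (continuous_truncDeriv K).comp (PiLp.continuous_apply 2 _ i)
  have hvm := h.integrable.aestronglyMeasurable
  have hGm := h.integrable_grad.aestronglyMeasurable
  obtain ⟨φ, t1, t2⟩ := h.approx
  refine ⟨?_, ?_, fun x hx => by rw [h.support x hx, truncVec_zero], fun x hx => ?_, ?_⟩
  · refine h.integrable.mono (continuous_truncVec.comp_aestronglyMeasurable hvm)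
      (ae_of_all _ fun x => ?_)
    have := norm_truncVec_sub_le hK (v x) 0
    rwa [truncVec_zero, sub_zero, sub_zero] at this
  · exact h.integrable_grad.mono (continuous_scaleGrad.comp_aestronglyMeasurable
      ((hcont.comp_aestronglyMeasurable hvm).prodMk hGm))
      (ae_of_all _ fun x => norm_scaleGrad_le (fun i => hc1 _) _)
  · ext i k
    simp [h.support_grad x hx]
  -- Almost everywhere convergence is needed for the factors `truncDeriv K (φ m x i)` to converge;
  -- they multiply the fixed integrable function `G`.
  · obtain ⟨ns, hns, hae⟩ := exists_subseq_tendsto_ae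
      (fun m => (φ m).continuous.aestronglyMeasurable) hvm t1
    choose ψ hψ hψg using fun m => exists_testMap_truncVec (Ω := Ω) hK (φ m)
    refine ⟨fun m => ψ (ns m), ?_, ?_⟩
    · refine tendsto_of_tendsto_of_tendsto_of_le_of_le tendsto_const_nhds
        (t1.comp hns.tendsto_atTop) (fun _ => zero_le) fun m => lintegral_mono fun x => ?_
      rw [hψ]
      exact enorm_le_iff_norm_le.2 (norm_truncVec_sub_le hK _ _)
    · let c : ℕ → Euc n → Fin d → ℝ :=
        fun m x i => truncDeriv K (φ (ns m) x i) - truncDeriv K (v x i)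
      have hcm : ∀ m, AEStronglyMeasurable (c m) := fun m =>
        (hcont.comp_aestronglyMeasurable (φ (ns m)).continuous.aestronglyMeasurable).sub
          (hcont.comp_aestronglyMeasurable hvm)
      have hc : ∀ m x i, |c m x i| ≤ 1 := fun m x i => by
        rw [abs_le]
        constructor <;> linarith [truncDeriv_nonneg K (φ (ns m) x i),
          truncDeriv_nonneg K (v x i), truncDeriv_le_one K (φ (ns m) x i),
          truncDeriv_le_one K (v x i)]
      have hm : ∀ m, AEStronglyMeasurable fun x => scaleGrad (c m x) (G x) := fun m =>
        continuous_scaleGrad.comp_aestronglyMeasurable ((hcm m).prodMk hGm)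
      have t3 : Tendsto (fun m => ∫⁻ x, ‖scaleGrad (c m x) (G x)‖ₑ) atTop (𝓝 0) := by
        refine tendsto_lintegral_zero_of_le_add (a := fun x => ‖G x‖ₑ) (b := fun _ _ => 0)
          (fun m => (hm m).enorm) hGm.enorm
          (fun m => ae_of_all _ fun x => ?_) h.integrable_grad.hasFiniteIntegral.ne (by simp) ?_
        · rw [add_zero]
          exact enorm_le_iff_norm_le.2 (norm_scaleGrad_le (hc m x) _)
        · filter_upwards [hae] with x hx
          have h1 : Tendsto (fun m => c m x) atTop (𝓝 0) := by
            have := ((hcont.tendsto (v x)).comp hx).sub_const (fun i => truncDeriv K (v x i))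
            rw [sub_self] at this
            exact this
          have h2 := (continuous_scaleGrad.tendsto ((0 : Fin d → ℝ), G x)).comp
            (h1.prodMk_nhds tendsto_const_nhds)
          have h3 : scaleGrad (0 : Fin d → ℝ) (G x) = 0 := by ext i k; simp
          have h4 := h2.enorm
          simp only [h3, enorm_zero] at h4
          exact h4
      have t4 := (t2.comp hns.tendsto_atTop).add t3
      rw [add_zero] at t4
      refine tendsto_of_tendsto_of_tendsto_of_le_of_le tendsto_const_nhds t4
        (fun _ => zero_le) fun m => ?_
      dsimp only [Function.comp]
      rw [← lintegral_add_right' _ (hm m).enorm]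
      refine lintegral_mono fun x => ?_
      rw [hψg]
      have e : scaleGrad (fun i => truncDeriv K (φ (ns m) x i)) (grad (φ (ns m)) x) -
          scaleGrad (fun i => truncDeriv K (v x i)) (G x) =
          scaleGrad (fun i => truncDeriv K (φ (ns m) x i)) (grad (φ (ns m)) x - G x) +
            scaleGrad (c m x) (G x) := by
        ext i k
        simp [c]
        ring
      rw [e]
      refine (enorm_add_le _ _).trans (add_le_add ?_ le_rfl)
      exact enorm_le_iff_norm_le.2 (norm_scaleGrad_le (fun i => hc1 _) _)

/-- Truncation multiplies each row of the gradient by its own factor. The splitting over rows makes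
this harmless: each summand is even and nondecreasing along rays. -/
lemma ae_scaleGrad_le {Mi : Fin d → Euc n → Euc n → ℝ} (hMi : ∀ i, IsWeakNFunction Ω (Mi i))
    (hsplit : ∀ x ∈ Ω, ∀ ξ : Grad n d, M x ξ = ∑ i, Mi i x (ξ i)) :
    ∀ᵐ x ∂(volume.restrict (Ω : Set (Euc n))), ∀ (c : Fin d → ℝ) (ξ : Grad n d),
      (∀ i, |c i| ≤ 1) → M x (scaleGrad c ξ) ≤ M x ξ := by
  have h : ∀ᵐ x ∂(volume.restrict (Ω : Set (Euc n))), ∀ i,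
      (∀ (s : ℝ) (ξ : Euc n), 0 ≤ s → s ≤ 1 → Mi i x (s • ξ) ≤ Mi i x ξ) ∧
        ∀ ξ, Mi i x (-ξ) = Mi i x ξ :=
    ae_all_iff.2 fun i => (hMi i).ae_smul_le.and (hMi i).even
  filter_upwards [h, ae_restrict_mem Ω.isOpen.measurableSet] with x hx hxΩ c ξ hc
  rw [hsplit x hxΩ, hsplit x hxΩ]
  refine Finset.sum_le_sum fun i _ => ?_
  rw [scaleGrad_apply]
  rcases le_total 0 (c i) with h0 | h0
  · exact (hx i).1 _ _ h0 ((le_abs_self _).trans (hc i))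
  · have h1 := (hx i).1 (-c i) (ξ i) (neg_nonneg.2 h0) ((neg_le_abs _).trans (hc i))
    rwa [neg_smul, (hx i).2] at h1

/-- Modular density of test maps in the zero-boundary class, without regularity of the map. -/
lemma ZeroPair.approximable (hΩ : IsBoundedLipschitzDomain Ω) (hM : IsWeakNFunction Ω M)
    (hΔ : DeltaTwo Ω M) {Mi : Fin d → Euc n → Euc n → ℝ} (hMi : ∀ i, IsWeakNFunction Ω (Mi i))
    (hsplit : ∀ x ∈ Ω, ∀ ξ : Grad n d, M x ξ = ∑ i, Mi i x (ξ i)) (hB : BGen 0 Ω M)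
    {v : Euc n → Euc d} {G : Euc n → Grad n d} (h : ZeroPair Ω v G)
    (hGM : ∀ Λ : ℝ, 0 ≤ Λ → ∫⁻ x in Ω, ENNReal.ofReal (M x (Λ • G x)) ≠ ⊤) :
    Approximable Ω M v G := by
  have hK : ∀ m : ℕ, (0 : ℝ) < (m : ℝ) + 1 := fun m => by positivity
  have hscale := ae_scaleGrad_le hMi hsplit
  have hvm := h.integrable.aestronglyMeasurable
  have hGm := h.integrable_grad.aestronglyMeasurable
  have hsmul : ∀ (Λ : ℝ) (c : Fin d → ℝ) (ξ : Grad n d),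
      Λ • scaleGrad c ξ = scaleGrad c (Λ • ξ) := fun Λ c ξ => by
    ext i k
    simp
    ring
  have hZ := fun m : ℕ => h.truncate (hK m).ne'
  refine Approximable.of_limit hM fun Λ hΛ η hη => ?_
  have hadm : ∀ m : ℕ, Admissible Ω M 0 (fun x => truncVec ((m : ℝ) + 1) (v x))
      (fun x => scaleGrad (fun i => truncDeriv ((m : ℝ) + 1) (v x i)) (G x)) := by
    intro m
    obtain ⟨A, hA⟩ := exists_norm_truncVec_le (d := d) (hK m)
    refine ⟨hZ m, ⟨A, fun x => hA _⟩, ⟨A + A, ?_, fun x y => ?_⟩, fun Λ hΛ => ?_⟩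
    · have := (norm_nonneg _).trans (hA 0); linarith
    -- Hölder continuity with exponent 0 is just bounded oscillation, so boundedness suffices.
    · rw [Real.rpow_zero, mul_one]
      exact (norm_sub_le _ _).trans (add_le_add (hA _) (hA _))
    · refine ne_top_of_le_ne_top (hGM Λ hΛ) (lintegral_mono_ae ?_)
      filter_upwards [hscale] with x hx
      rw [hsmul]
      exact ENNReal.ofReal_le_ofReal (hx _ _ fun i => by
        rw [abs_of_nonneg (truncDeriv_nonneg _ _)]; exact truncDeriv_le_one _ _)
  let c : ℕ → Euc n → Fin d → ℝ := fun m x i => truncDeriv ((m : ℝ) + 1) (v x i) - 1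
  have hdiff : ∀ (m : ℕ) x, scaleGrad (fun i => truncDeriv ((m : ℝ) + 1) (v x i)) (G x) - G x =
      scaleGrad (c m x) (G x) := fun m x => by
    ext i k
    simp [c]
    ring
  have hc : ∀ m x i, |c m x i| ≤ 1 := fun m x i => by
    rw [abs_le]
    constructor <;> linarith [truncDeriv_nonneg ((m : ℝ) + 1) (v x i),
      truncDeriv_le_one ((m : ℝ) + 1) (v x i)]
  have hc0 : ∀ x, Tendsto (fun m => c m x) atTop (𝓝 0) := fun x => by
    refine tendsto_pi_nhds.2 fun i => ?_
    have := (tendsto_truncDeriv (v x i)).sub_const 1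
    rwa [sub_self] at this
  have hs0 : ∀ x, Tendsto (fun m => scaleGrad (c m x) (G x)) atTop (𝓝 0) := fun x => by
    have h2 := (continuous_scaleGrad.tendsto ((0 : Fin d → ℝ), G x)).comp
      ((hc0 x).prodMk_nhds tendsto_const_nhds)
    have h3 : scaleGrad (0 : Fin d → ℝ) (G x) = 0 := by ext i k; simp
    simp only [h3] at h2
    exact h2
  have hdm : ∀ m, AEStronglyMeasurable fun x => scaleGrad (c m x) (G x) := fun m => by
    simp only [← hdiff]
    exact (hZ m).integrable_grad.aestronglyMeasurable.sub hGm
  have t1 : Tendsto (fun m : ℕ => ∫⁻ x, ‖truncVec ((m : ℝ) + 1) (v x) - v x‖ₑ) atTop (𝓝 0) := by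
    refine tendsto_lintegral_zero_of_le_add (a := fun x => ‖v x‖ₑ + ‖v x‖ₑ) (b := fun _ _ => 0)
      (fun m => ((hZ m).integrable.aestronglyMeasurable.sub hvm).enorm) (hvm.enorm.add hvm.enorm)
      (fun m => ae_of_all _ fun x => ?_) ?_ (by simp) (ae_of_all _ fun x => ?_)
    · rw [add_zero]
      refine enorm_sub_le.trans (add_le_add ?_ le_rfl)
      have := norm_truncVec_sub_le (hK m).ne' (v x) 0
      rw [truncVec_zero, sub_zero, sub_zero] at this
      exact enorm_le_iff_norm_le.2 this
    · rw [lintegral_add_left' hvm.enorm]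
      exact ENNReal.add_ne_top.2 ⟨h.integrable.hasFiniteIntegral.ne,
        h.integrable.hasFiniteIntegral.ne⟩
    · have h1 : Tendsto (fun m : ℕ => truncVec ((m : ℝ) + 1) (v x)) atTop (𝓝 (v x)) := by
        have : Tendsto (fun m : ℕ => fun i => trunc ((m : ℝ) + 1) (v x i)) atTop
            (𝓝 (WithLp.ofLp (v x))) := tendsto_pi_nhds.2 fun i => tendsto_trunc _
        exact ((PiLp.continuous_toLp 2 _).tendsto _).comp this
      have h2 := (h1.sub_const (v x)).enorm
      rwa [sub_self, enorm_zero] at h2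
  have t2 : Tendsto (fun m => ∫⁻ x, ‖scaleGrad (c m x) (G x)‖ₑ) atTop (𝓝 0) := by
    refine tendsto_lintegral_zero_of_le_add (a := fun x => ‖G x‖ₑ) (b := fun _ _ => 0)
      (fun m => (hdm m).enorm) hGm.enorm (fun m => ae_of_all _ fun x => ?_)
      h.integrable_grad.hasFiniteIntegral.ne (by simp) (ae_of_all _ fun x => ?_)
    · rw [add_zero]
      exact enorm_le_iff_norm_le.2 (norm_scaleGrad_le (hc m x) _)
    · have h2 := (hs0 x).enorm
      rwa [enorm_zero] at h2
  have t3 : Tendsto (fun m => ∫⁻ x in Ω, ENNReal.ofReal (M x (Λ • scaleGrad (c m x) (G x))))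
      atTop (𝓝 0) := by
    refine tendsto_lintegral_zero_of_le_add (a := fun x => ENNReal.ofReal (M x (Λ • G x)))
      (b := fun _ _ => 0)
      (fun m => (hM.aemeasurable_comp ((hdm m).restrict.const_smul Λ)).ennreal_ofReal)
      (hM.aemeasurable_comp (hGm.restrict.const_smul Λ)).ennreal_ofReal (fun m => ?_)
      (hGM Λ hΛ) (by simp) ?_
    · filter_upwards [hscale] with x hx
      rw [add_zero, hsmul]
      exact ENNReal.ofReal_le_ofReal (hx _ _ (hc m x))
    · filter_upwards [hM.zero, ae_restrict_mem Ω.isOpen.measurableSet] with x hx0 hx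
      have h1 : Tendsto (fun m => Λ • scaleGrad (c m x) (G x)) atTop (𝓝 0) := by
        simpa using (hs0 x).const_smul Λ
      have h2 := ((hM.continuous x hx).tendsto 0).comp h1
      rw [hx0] at h2
      simpa using ENNReal.tendsto_ofReal h2
  have hall := (t1.add t2).add t3
  simp only [add_zero] at hall
  obtain ⟨m, hm⟩ := (hall.eventually (gt_mem_nhds hη)).exists
  refine ⟨_, _, (hZ m).integrable.aestronglyMeasurable,
    (hZ m).integrable_grad.aestronglyMeasurable,
    (hadm m).approximable hΩ hM hΔ le_rfl zero_le_one (Or.inr hB), ?_⟩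
  simp only [← hdiff] at hm
  exact hm

end Truncation

/-! ### Calculus of distributional gradients. -/

section WeakGradients

variable {n d : ℕ} {Ω : Opens (Euc n)} {u v : Euc n → Euc d} {G H : Euc n → Grad n d}

lemma integrable_mul_of_hasCompactSupport {g f : Euc n → ℝ} (hg : Continuous g)
    (hgc : HasCompactSupport g) (hgs : tsupport g ⊆ Ω)
    (hf : LocallyIntegrableOn f (Ω : Set (Euc n))) : Integrable fun x => g x * f x := by
  have h1 : IntegrableOn f (tsupport g) := hf.integrableOn_compact_subset hgs hgc
  have h2 : IntegrableOn (fun x => g x * f x) (tsupport g) :=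
    h1.continuousOn_mul hg.continuousOn hgc
  refine (integrableOn_iff_integrable_of_support_subset fun x hx => ?_).1 h2
  exact subset_tsupport g (left_ne_zero_of_mul hx)

lemma LocallyIntegrableOn.clm_comp {V W : Type*} [NormedAddCommGroup V] [NormedSpace ℝ V]
    [NormedAddCommGroup W] [NormedSpace ℝ W] {f : Euc n → V} {s : Set (Euc n)}
    (hf : LocallyIntegrableOn f s) (A : V →L[ℝ] W) : LocallyIntegrableOn (fun x => A (f x)) s :=
  fun x hx => by
    obtain ⟨t, ht, hi⟩ := hf x hx
    exact ⟨t, ht, A.integrable_comp hi⟩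

lemma locallyIntegrableOn_apply (hu : LocallyIntegrableOn u (Ω : Set (Euc n))) (i : Fin d) :
    LocallyIntegrableOn (fun x => u x i) (Ω : Set (Euc n)) :=
  LocallyIntegrableOn.clm_comp hu (EuclideanSpace.proj i : Euc d →L[ℝ] ℝ)

lemma locallyIntegrableOn_apply_apply (hG : LocallyIntegrableOn G (Ω : Set (Euc n)))
    (i : Fin d) (k : Fin n) : LocallyIntegrableOn (fun x => G x i k) (Ω : Set (Euc n)) :=
  LocallyIntegrableOn.clm_comp hG ((EuclideanSpace.proj k : Euc n →L[ℝ] ℝ).comp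
    (PiLp.proj 2 (fun _ : Fin d => Euc n) i))

lemma integrable_testMap_mul {f : Euc n → ℝ} (φ : 𝓓(Ω, ℝ))
    (hf : LocallyIntegrableOn f (Ω : Set (Euc n))) : Integrable fun x => φ x * f x :=
  integrable_mul_of_hasCompactSupport φ.continuous φ.hasCompactSupport φ.tsupport_subset hf

lemma integrable_fderiv_testMap_mul {f : Euc n → ℝ} (φ : 𝓓(Ω, ℝ)) (w : Euc n)
    (hf : LocallyIntegrableOn f (Ω : Set (Euc n))) : Integrable fun x => fderiv ℝ φ x w * f x := by
  have hs : tsupport (fun x => fderiv ℝ φ x w) ⊆ tsupport φ :=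
    closure_minimal (fun x hx => support_fderiv_subset ℝ fun h => hx (by simp [h]))
      (isClosed_tsupport _)
  exact integrable_mul_of_hasCompactSupport
    ((φ.contDiff.continuous_fderiv (by simp)).clm_apply continuous_const)
    (φ.hasCompactSupport.of_isClosed_subset (isClosed_tsupport _) hs)
    (hs.trans φ.tsupport_subset) hf

lemma testMap_eq_zero {V : Type*} [NormedAddCommGroup V] [NormedSpace ℝ V] (φ : 𝓓(Ω, V))
    {x : Euc n} (hx : x ∉ Ω) : φ x = 0 :=
  image_eq_zero_of_notMem_tsupport fun h => hx (φ.tsupport_subset h)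

lemma fderiv_testMap_eq_zero {V : Type*} [NormedAddCommGroup V] [NormedSpace ℝ V] (φ : 𝓓(Ω, V))
    {x : Euc n} (hx : x ∉ Ω) : fderiv ℝ φ x = 0 := by
  by_contra h
  exact hx (φ.tsupport_subset (support_fderiv_subset ℝ h))

lemma grad_testMap_eq_zero (φ : 𝓓(Ω, Euc d)) {x : Euc n} (hx : x ∉ Ω) : grad φ x = 0 := by
  rw [grad, fderiv_testMap_eq_zero φ hx, map_zero]

/-- Distributional gradients are unique up to null sets. -/
lemma IsWeakGrad.ae_eq (hG : IsWeakGrad Ω u G) (hH : IsWeakGrad Ω u H) :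
    G =ᵐ[volume.restrict (Ω : Set (Euc n))] H := by
  have key : ∀ (i : Fin d) (k : Fin n), ∀ᵐ x, x ∈ (Ω : Set (Euc n)) →
      (fun x => G x i k - H x i k) x = 0 := by
    intro i k
    have h1 := locallyIntegrableOn_apply_apply hG.2.1 i k
    have h2 := locallyIntegrableOn_apply_apply hH.2.1 i k
    refine Ω.isOpen.ae_eq_zero_of_integral_contDiff_smul_eq_zero (h1.sub h2)
      fun g hg hgc hgs => ?_
    let φ : 𝓓(Ω, ℝ) := ⟨g, hg, hgc, hgs⟩
    have h3 := (hG.2.2 φ i k).symm.trans (hH.2.2 φ i k)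
    rw [neg_inj, setIntegral_eq_integral_of_forall_compl_eq_zero fun x hx => by
        rw [testMap_eq_zero φ hx, zero_mul],
      setIntegral_eq_integral_of_forall_compl_eq_zero fun x hx => by
        rw [testMap_eq_zero φ hx, zero_mul]] at h3
    have h4 := integral_sub (integrable_testMap_mul φ h1) (integrable_testMap_mul φ h2)
    rw [h3, sub_self] at h4
    rw [← h4]
    refine integral_congr_ae (ae_of_all _ fun x => ?_)
    exact mul_sub _ _ _
  refine (ae_restrict_iff' Ω.isOpen.measurableSet).2 ?_
  filter_upwards [ae_all_iff.2 fun i => ae_all_iff.2 (key i)] with x hx hxΩ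
  ext i k
  exact sub_eq_zero.1 (hx i k hxΩ)

lemma isWeakGrad_weakGrad (h : ∃ G, IsWeakGrad Ω u G) : IsWeakGrad Ω u (weakGrad Ω u) := by
  rw [weakGrad, dif_pos h]
  exact h.choose_spec

lemma IsWeakGrad.weakGrad_ae_eq (hG : IsWeakGrad Ω u G) :
    weakGrad Ω u =ᵐ[volume.restrict (Ω : Set (Euc n))] G :=
  (isWeakGrad_weakGrad ⟨G, hG⟩).ae_eq hG

/-- The coefficient `c` covers sums and differences at once. -/
lemma IsWeakGrad.add_smul (hu : IsWeakGrad Ω u G) (hv : IsWeakGrad Ω v H) (c : ℝ) :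
    IsWeakGrad Ω (u + c • v) (G + c • H) := by
  refine ⟨hu.1.add (hv.1.smul c), hu.2.1.add (hv.2.1.smul c), fun φ i k => ?_⟩
  have e1 : ∀ x, fderiv ℝ φ x (EuclideanSpace.single k 1) * (u + c • v) x i =
      fderiv ℝ φ x (EuclideanSpace.single k 1) * u x i +
        c * (fderiv ℝ φ x (EuclideanSpace.single k 1) * v x i) := fun x => by
    simp
    ring
  have e2 : ∀ x, φ x * (G + c • H) x i k = φ x * G x i k + c * (φ x * H x i k) := fun x => by
    simp
    ring
  simp only [e1, e2]
  rw [integral_add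
      (integrable_fderiv_testMap_mul φ _ (locallyIntegrableOn_apply hu.1 i)).integrableOn
      ((integrable_fderiv_testMap_mul φ _
        (locallyIntegrableOn_apply hv.1 i)).integrableOn.const_mul c),
    integral_add
      (integrable_testMap_mul φ (locallyIntegrableOn_apply_apply hu.2.1 i k)).integrableOn
      ((integrable_testMap_mul φ
        (locallyIntegrableOn_apply_apply hv.2.1 i k)).integrableOn.const_mul c),
    integral_const_mul, integral_const_mul, hu.2.2 φ i k, hv.2.2 φ i k]
  ring

lemma isWeakGrad_testMap (φ : 𝓓(Ω, Euc d)) : IsWeakGrad Ω φ (grad φ) := by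
  refine ⟨(integrable_testMap φ).locallyIntegrable.locallyIntegrableOn _,
    (integrable_grad_testMap φ).locallyIntegrable.locallyIntegrableOn _, fun ψ i k => ?_⟩
  have hloc := (integrable_testMap φ).locallyIntegrable.locallyIntegrableOn (Ω : Set (Euc n))
  have hlocg := (integrable_grad_testMap φ).locallyIntegrable.locallyIntegrableOn
    (Ω : Set (Euc n))
  have hd : ∀ x, HasFDerivAt (fun x => φ x i)
      ((EuclideanSpace.proj i : Euc d →L[ℝ] ℝ).comp (fderiv ℝ φ x)) x := fun x =>
    (EuclideanSpace.proj i : Euc d →L[ℝ] ℝ).hasFDerivAt.comp x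
      (φ.contDiff.differentiable (by simp) x).hasFDerivAt
  have e : ∀ x, fderiv ℝ (fun x => φ x i) x (EuclideanSpace.single k 1) = grad φ x i k :=
    fun x => by rw [(hd x).fderiv]; rfl
  have h1 := integrable_testMap_mul ψ (locallyIntegrableOn_apply_apply hlocg i k)
  have h2 := integrable_fderiv_testMap_mul ψ (EuclideanSpace.single k 1)
    (locallyIntegrableOn_apply hloc i)
  have h3 := integrable_testMap_mul ψ (locallyIntegrableOn_apply hloc i)
  have h := integral_mul_fderiv_eq_neg_fderiv_mul_of_integrable (μ := volume)
    (f := fun x => φ x i) (g := ψ) (v := EuclideanSpace.single k (1 : ℝ))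
    (by simpa only [e, mul_comm] using h1) (by simpa only [mul_comm] using h2)
    (by simpa only [mul_comm] using h3) (fun x _ => (hd x).differentiableAt)
    (fun x _ => ψ.contDiff.differentiable (by simp) x)
  simp only [e] at h
  rw [setIntegral_eq_integral_of_forall_compl_eq_zero fun x hx => by
      rw [testMap_eq_zero φ hx, PiLp.zero_apply, mul_zero],
    setIntegral_eq_integral_of_forall_compl_eq_zero fun x hx => by
      rw [testMap_eq_zero ψ hx, zero_mul]]
  simpa only [mul_comm] using h

end WeakGradients

/-! ### The function spaces of the theorem in terms of zero extensions. -/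

section Spaces

variable {n d : ℕ} {Ω : Opens (Euc n)} {M : Euc n → Grad n d → ℝ} {u v : Euc n → Euc d}

lemma weakGrad_add (hu : u ∈ sobolev Ω d) (hv : v ∈ sobolev Ω d) :
    weakGrad Ω (u + v) =ᵐ[volume.restrict (Ω : Set (Euc n))] weakGrad Ω u + weakGrad Ω v := by
  have h := (isWeakGrad_weakGrad hu.2.1).add_smul (isWeakGrad_weakGrad hv.2.1) 1
  rw [one_smul, one_smul] at h
  exact h.weakGrad_ae_eq

lemma weakGrad_sub (hu : u ∈ sobolev Ω d) (hv : v ∈ sobolev Ω d) :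
    weakGrad Ω (u - v) =ᵐ[volume.restrict (Ω : Set (Euc n))] weakGrad Ω u - weakGrad Ω v := by
  have h := (isWeakGrad_weakGrad hu.2.1).add_smul (isWeakGrad_weakGrad hv.2.1) (-1)
  rw [neg_one_smul, neg_one_smul, ← sub_eq_add_neg, ← sub_eq_add_neg] at h
  exact h.weakGrad_ae_eq

lemma testMap_mem_sobolev (φ : 𝓓(Ω, Euc d)) : (φ : Euc n → Euc d) ∈ sobolev Ω d :=
  ⟨(integrable_testMap φ).integrableOn, ⟨_, isWeakGrad_testMap φ⟩,
    (integrable_grad_testMap φ).integrableOn.congr (isWeakGrad_testMap φ).weakGrad_ae_eq.symm⟩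

lemma testMap_mem_sobolevZero (φ : 𝓓(Ω, Euc d)) : (φ : Euc n → Euc d) ∈ sobolevZero Ω d := by
  refine ⟨testMap_mem_sobolev φ, fun ε hε => ⟨φ, ⟨φ, rfl⟩, ?_⟩⟩
  have h := weakGrad_sub (testMap_mem_sobolev φ) (testMap_mem_sobolev φ)
  rw [sobolevNorm, eLpNorm_congr_ae h, sub_self, sub_self, eLpNorm_zero, eLpNorm_zero, add_zero]
  exact hε

lemma testMap_mem_V1L0 (hM : IsWeakNFunction Ω M) (hfin : volume (Ω : Set (Euc n)) ≠ ⊤)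
    (φ : 𝓓(Ω, Euc d)) : (φ : Euc n → Euc d) ∈ V1L0 Ω M := by
  refine ⟨testMap_mem_sobolevZero φ, Submodule.subset_span
    ⟨(testMap_mem_sobolev φ).2.2.aestronglyMeasurable, ?_⟩⟩
  obtain ⟨C, hC⟩ := (continuous_grad φ.contDiff).bounded_above_of_compact_support
    (hasCompactSupport_grad φ.hasCompactSupport)
  obtain ⟨B, -, hB⟩ := hM.exists_bound ((norm_nonneg _).trans (hC 0))
  have h : ∫⁻ x in (Ω : Set (Euc n)), ENNReal.ofReal (M x (weakGrad Ω φ x)) ≤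
      ∫⁻ _x in (Ω : Set (Euc n)), ENNReal.ofReal B := by
    refine lintegral_mono_ae ?_
    filter_upwards [hB, (isWeakGrad_testMap φ).weakGrad_ae_eq] with x hx hg
    rw [hg]
    exact ENNReal.ofReal_le_ofReal (hx _ (hC x))
  refine h.trans_lt ?_
  rw [lintegral_const, Measure.restrict_apply_univ]
  exact ENNReal.mul_lt_top ENNReal.ofReal_lt_top hfin.lt_top

lemma holderOnWith_iff_norm {C γ : ℝ≥0} {s : Set (Euc n)} :
    HolderOnWith C γ u s ↔ ∀ x ∈ s, ∀ y ∈ s, ‖u x - u y‖ ≤ C * ‖x - y‖ ^ (γ : ℝ) := by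
  refine forall₂_congr fun x _ => forall₂_congr fun y _ => ?_
  rw [edist_dist, edist_dist, dist_eq_norm, dist_eq_norm,
    ENNReal.ofReal_rpow_of_nonneg (norm_nonneg (x - y)) γ.coe_nonneg, ← ENNReal.ofReal_coe_nnreal,
    ← ENNReal.ofReal_mul C.coe_nonneg, ENNReal.ofReal_le_ofReal_iff (by positivity)]

lemma testMap_mem_holderMaps (φ : 𝓓(Ω, Euc d)) {γ : ℝ≥0} (hγ1 : γ ≤ 1) :
    (φ : Euc n → Euc d) ∈ holderMaps Ω d γ := by
  obtain ⟨C, hC⟩ := (φ.contDiff.continuous_fderiv (by simp)).bounded_above_of_compact_support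
    (φ.hasCompactSupport.fderiv (𝕜 := ℝ))
  obtain ⟨A, hA⟩ := φ.continuous.bounded_above_of_compact_support φ.hasCompactSupport
  have hC0 : 0 ≤ C := (norm_nonneg _).trans (hC 0)
  have hA0 : 0 ≤ A := (norm_nonneg _).trans (hA 0)
  have hLip : ∀ x y, ‖φ x - φ y‖ ≤ C * ‖x - y‖ := fun x y =>
    convex_univ.norm_image_sub_le_of_norm_fderiv_le
      (fun z _ => φ.contDiff.differentiable (by simp) z) (fun z _ => hC z) (mem_univ y) (mem_univ x)
  refine ⟨Real.toNNReal (C + 2 * A), holderOnWith_iff_norm.2 fun x _ y _ => ?_⟩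
  rw [Real.coe_toNNReal _ (by positivity)]
  rcases le_total ‖x - y‖ 1 with h | h
  · have h1 : ‖x - y‖ ≤ ‖x - y‖ ^ (γ : ℝ) := by
      have := Real.rpow_le_rpow_of_exponent_ge' (norm_nonneg (x - y)) h γ.2
        (show (γ : ℝ) ≤ 1 by exact_mod_cast hγ1)
      rwa [Real.rpow_one] at this
    calc ‖φ x - φ y‖ ≤ C * ‖x - y‖ := hLip x y
      _ ≤ (C + 2 * A) * ‖x - y‖ ^ (γ : ℝ) :=
        mul_le_mul (by linarith) h1 (norm_nonneg _) (by positivity)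
  · have h1 : (1 : ℝ) ≤ ‖x - y‖ ^ (γ : ℝ) := Real.one_le_rpow h γ.2
    have h2 := (norm_sub_le (φ x) (φ y)).trans (add_le_add (hA x) (hA y))
    nlinarith

/-- By Δ₂ a finite modular is finite at every scale, and this stronger form is stable under sums and
multiples, hence holds on the whole span. -/
lemma orliczSpace_modular {E : Type} [NormedAddCommGroup E] [NormedSpace ℝ E]
    {M : Euc n → E → ℝ} (hM : IsWeakNFunction Ω M) (hΔ : DeltaTwo Ω M)
    (hfin : volume (Ω : Set (Euc n)) ≠ ⊤) {G : Euc n → E} (hG : G ∈ orliczSpace Ω M) :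
    AEStronglyMeasurable G (volume.restrict (Ω : Set (Euc n))) ∧
      ∀ Λ : ℝ, 0 ≤ Λ → ∫⁻ x in Ω, ENNReal.ofReal (M x (Λ • G x)) ≠ ⊤ := by
  induction hG using Submodule.span_induction with
  | mem G hG =>
    refine ⟨hG.1, fun Λ hΛ => ?_⟩
    obtain ⟨c, h, hc, hm, hh, hle⟩ := hΔ.exists_scale hM hfin hΛ
    refine ne_top_of_le_ne_top (b := (c * ∫⁻ x in Ω, ENNReal.ofReal (M x (G x))) +
      ∫⁻ x in Ω, h x) (ENNReal.add_ne_top.2 ⟨ENNReal.mul_ne_top hc hG.2.ne, hh⟩) ?_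
    rw [← lintegral_const_mul' _ _ hc, ← lintegral_add_right' _ hm]
    refine lintegral_mono_ae ?_
    filter_upwards [hle] with x hx
    exact hx _
  | zero =>
    refine ⟨aestronglyMeasurable_const, fun Λ _ => ?_⟩
    have : ∫⁻ x in (Ω : Set (Euc n)), ENNReal.ofReal (M x (Λ • (0 : Euc n → E) x)) = 0 := by
      rw [← lintegral_zero (μ := volume.restrict (Ω : Set (Euc n)))]
      refine lintegral_congr_ae ?_
      filter_upwards [hM.zero] with x hx
      simp [hx]
    rw [this]
    exact ENNReal.zero_ne_top
  | add G H _ _ h1 h2 =>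
    refine ⟨h1.1.add h2.1, fun Λ hΛ => ?_⟩
    have hm := (hM.aemeasurable_comp (h1.1.const_smul (2 * Λ))).ennreal_ofReal
    refine ne_top_of_le_ne_top (ENNReal.add_ne_top.2
      ⟨h1.2 (2 * Λ) (by positivity), h2.2 (2 * Λ) (by positivity)⟩) ?_
    refine le_trans (lintegral_mono_ae ?_) (lintegral_add_left' hm _).le
    filter_upwards [hM.ae_smul_add_le] with x hx
    exact hx _ _ _
  | smul c G _ h1 =>
    refine ⟨h1.1.const_smul c, fun Λ hΛ => ?_⟩
    refine ne_top_of_le_ne_top (h1.2 (Λ * |c|) (by positivity)) (lintegral_mono_ae ?_)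
    filter_upwards [hM.even] with x hx
    rw [Pi.smul_apply, smul_smul]
    rcases abs_choice c with h | h
    · rw [h]
    · rw [h, mul_neg, neg_smul, hx]

/-- Test maps vanish outside `Ω`, so the `W^{1,1}` distance on `Ω` equals that of the zero
extensions on the whole space. -/
lemma sobolevZero_zeroPair (hv : v ∈ sobolevZero Ω d) :
    ZeroPair Ω ((Ω : Set (Euc n)).indicator v) ((Ω : Set (Euc n)).indicator (weakGrad Ω v)) := by
  have hms := Ω.isOpen.measurableSet
  have hpos : ∀ m : ℕ, (0 : ℝ≥0∞) < ((m : ℝ≥0∞) + 1)⁻¹ := fun m =>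
    ENNReal.inv_pos.2 (by finiteness)
  have hex : ∀ m : ℕ, ∃ φ : 𝓓(Ω, Euc d), sobolevNorm Ω (v - ⇑φ) < ((m : ℝ≥0∞) + 1)⁻¹ := by
    intro m
    obtain ⟨_, ⟨φ, rfl⟩, hφ⟩ := hv.2 _ (hpos m)
    exact ⟨φ, hφ⟩
  choose φ hφ using hex
  have hlim : Tendsto (fun m : ℕ => ((m : ℝ≥0∞) + 1)⁻¹) atTop (𝓝 0) := by
    have h := (tendsto_add_atTop_iff_nat 1).2 ENNReal.tendsto_inv_nat_nhds_zero
    simpa using h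
  refine ⟨hv.1.1.integrable_indicator hms, hv.1.2.2.integrable_indicator hms,
    fun x hx => indicator_of_notMem hx _, fun x hx => indicator_of_notMem hx _, φ, ?_, ?_⟩
  · refine tendsto_of_tendsto_of_tendsto_of_le_of_le tendsto_const_nhds hlim
      (fun _ => zero_le) fun m => ?_
    refine le_trans (le_of_eq ?_) ((le_self_add).trans (hφ m).le)
    rw [eLpNorm_one_eq_lintegral_enorm, ← lintegral_indicator hms]
    refine lintegral_congr fun x => ?_
    by_cases hx : x ∈ (Ω : Set (Euc n))
    · rw [indicator_of_mem hx, indicator_of_mem hx, Pi.sub_apply, ← enorm_neg, neg_sub]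
    · rw [indicator_of_notMem hx, indicator_of_notMem hx, testMap_eq_zero (φ m) hx, sub_zero,
        enorm_zero]
  · refine tendsto_of_tendsto_of_tendsto_of_le_of_le tendsto_const_nhds hlim
      (fun _ => zero_le) fun m => ?_
    refine le_trans (le_of_eq ?_) ((le_add_self).trans (hφ m).le)
    rw [eLpNorm_one_eq_lintegral_enorm]
    have h2 : ∫⁻ x in (Ω : Set (Euc n)), ‖weakGrad Ω (v - ⇑(φ m)) x‖ₑ =
        ∫⁻ x in (Ω : Set (Euc n)), ‖grad (φ m) x - weakGrad Ω v x‖ₑ := by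
      refine lintegral_congr_ae ?_
      filter_upwards [weakGrad_sub hv.1 (testMap_mem_sobolev (φ m)),
        (isWeakGrad_testMap (φ m)).weakGrad_ae_eq] with x h3 h4
      rw [h3, Pi.sub_apply, h4, ← enorm_neg, neg_sub]
    rw [h2, ← lintegral_indicator hms]
    refine lintegral_congr fun x => ?_
    by_cases hx : x ∈ (Ω : Set (Euc n))
    · rw [indicator_of_mem hx, indicator_of_mem hx]
    · rw [indicator_of_notMem hx, indicator_of_notMem hx, grad_testMap_eq_zero (φ m) hx, sub_zero,
        enorm_zero]

lemma modular_indicator_ne_top (hM : IsWeakNFunction Ω M) (hΔ : DeltaTwo Ω M)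
    (hfin : volume (Ω : Set (Euc n)) ≠ ⊤) (hv : v ∈ V1L0 Ω M) (Λ : ℝ) (hΛ : 0 ≤ Λ) :
    ∫⁻ x in Ω, ENNReal.ofReal (M x (Λ • (Ω : Set (Euc n)).indicator (weakGrad Ω v) x)) ≠ ⊤ := by
  refine ne_top_of_le_ne_top ((orliczSpace_modular hM hΔ hfin hv.2).2 Λ hΛ) (lintegral_mono_ae ?_)
  filter_upwards [ae_restrict_mem Ω.isOpen.measurableSet] with x hx
  rw [indicator_of_mem hx]

/-- Boundedness comes from the bounded domain and the Hölder bound; the Hölder bound on the whole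
space comes from `ZeroPair.holder`. -/
lemma admissible_of_mem_holderMaps (hΩ : IsBoundedLipschitzDomain Ω) (hM : IsWeakNFunction Ω M)
    (hΔ : DeltaTwo Ω M) {γ : ℝ≥0} (hγ : 0 < γ) (hv : v ∈ V1L0 Ω M ∩ holderMaps Ω d γ) :
    Admissible Ω M γ ((Ω : Set (Euc n)).indicator v)
      ((Ω : Set (Euc n)).indicator (weakGrad Ω v)) := by
  obtain ⟨hv1, C, hC⟩ := hv
  have hfin : volume (Ω : Set (Euc n)) ≠ ⊤ := hΩ.bounded.measure_lt_top.ne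
  have hzp := sobolevZero_zeroPair hv1.1
  have hγ' : (0 : ℝ) < γ := by exact_mod_cast hγ
  have hin := holderOnWith_iff_norm.1 hC
  have hh := hzp.holder hΩ hγ' C.2 fun x hx y hy => by
    rw [indicator_of_mem hx, indicator_of_mem hy]; exact hin x hx y hy
  obtain ⟨x₀, hx₀⟩ := hΩ.connected.nonempty
  obtain ⟨R, hR⟩ := hΩ.bounded.subset_closedBall x₀
  refine ⟨hzp, ⟨‖v x₀‖ + C * |R| ^ (γ : ℝ), fun x => ?_⟩, ⟨C, C.2, hh⟩,
    modular_indicator_ne_top hM hΔ hfin hv1⟩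
  by_cases hx : x ∈ (Ω : Set (Euc n))
  · rw [indicator_of_mem hx]
    have h1 : ‖x - x₀‖ ≤ |R| := by
      rw [← dist_eq_norm]; exact (Metric.mem_closedBall.1 (hR hx)).trans (le_abs_self R)
    have h2 : ‖x - x₀‖ ^ (γ : ℝ) ≤ |R| ^ (γ : ℝ) :=
      Real.rpow_le_rpow (norm_nonneg _) h1 hγ'.le
    have h3 := norm_le_norm_add_norm_sub' (v x) (v x₀)
    have h4 := hin x hx x₀ hx₀
    have h5 := mul_le_mul_of_nonneg_left h2 C.2
    exact h3.trans (add_le_add le_rfl (h4.trans h5))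
  · rw [indicator_of_notMem hx, norm_zero]
    positivity

end Spaces

/-! ### From modular approximation to the energy. -/

section Energy

variable {n d : ℕ} {Ω : Opens (Euc n)} {M : Euc n → Grad n d → ℝ}

lemma infEnergy_testMaps_le (hM : IsWeakNFunction Ω M) (hΔ : DeltaTwo Ω M)
    (hfin : volume (Ω : Set (Euc n)) ≠ ⊤) {F : Euc n → Euc d → Grad n d → ℝ}
    (hFmeas : ∀ z ξ, AEMeasurable (fun x => F x z ξ) (volume.restrict Ω))
    (hFcont : ∀ x ∈ Ω, Continuous (fun p : Euc d × Grad n d => F x p.1 p.2)) {L : ℝ} (hL : 0 ≤ L)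
    (hF : ∀ x ∈ Ω, ∀ z ξ, F x z ξ ≤ L * (M x ξ + 1)) {u₀ v : Euc n → Euc d} (hu₀ : u₀ ∈ V1L Ω M)
    (hv : v ∈ V1L0 Ω M) (happ : Approximable Ω M ((Ω : Set (Euc n)).indicator v)
      ((Ω : Set (Euc n)).indicator (weakGrad Ω v))) :
    infEnergy Ω F u₀ (testMaps Ω d) ≤ energy Ω F (u₀ + v) := by
  have hms := Ω.isOpen.measurableSet
  set V := (Ω : Set (Euc n)).indicator v
  set G := (Ω : Set (Euc n)).indicator (weakGrad Ω v)
  have hzp : ZeroPair Ω V G := sobolevZero_zeroPair hv.1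
  have hVm := hzp.integrable.aestronglyMeasurable
  have hGm := hzp.integrable_grad.aestronglyMeasurable
  have hpos : ∀ m : ℕ, (0 : ℝ≥0∞) < ((m : ℝ≥0∞) + 1)⁻¹ := fun m =>
    ENNReal.inv_pos.2 (by finiteness)
  have hlim : Tendsto (fun m : ℕ => ((m : ℝ≥0∞) + 1)⁻¹) atTop (𝓝 0) := by
    have h := (tendsto_add_atTop_iff_nat 1).2 ENNReal.tendsto_inv_nat_nhds_zero
    simpa using h
  -- Scale 2 is what convexity asks for: the modular at `W + D` is bounded by those at `2 • W` and
  -- `2 • D`.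
  choose ψ hψ using fun m : ℕ => happ 2 zero_le_two _ (hpos m)
  have hsq : ∀ f : ℕ → ℝ≥0∞, (∀ m, f m ≤ size Ω M 2 (⇑(ψ m) - V) (grad (ψ m) - G)) →
      Tendsto f atTop (𝓝 0) := fun f hf =>
    tendsto_of_tendsto_of_tendsto_of_le_of_le tendsto_const_nhds hlim (fun _ => zero_le)
      fun m => (hf m).trans (hψ m).le
  have t1 : Tendsto (fun m => ∫⁻ x, ‖ψ m x - V x‖ₑ) atTop (𝓝 0) :=
    hsq _ fun m => le_self_add.trans le_self_add
  have t2 : Tendsto (fun m => ∫⁻ x, ‖grad (ψ m) x - G x‖ₑ) atTop (𝓝 0) :=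
    hsq _ fun m => le_add_self.trans le_self_add
  have t3 : Tendsto (fun m => ∫⁻ x in Ω, ENNReal.ofReal (M x ((2 : ℝ) • (grad (ψ m) x - G x))))
      atTop (𝓝 0) := hsq _ fun m => le_add_self
  obtain ⟨ns, hns, hae1⟩ := exists_subseq_tendsto_ae
    (fun m => (ψ m).continuous.aestronglyMeasurable) hVm t1
  obtain ⟨ms, hms', hae2⟩ := exists_subseq_tendsto_ae
    (fun m => (continuous_grad (ψ (ns m)).contDiff).aestronglyMeasurable) hGm
    (t2.comp hns.tendsto_atTop)
  let φ : ℕ → 𝓓(Ω, Euc d) := fun m => ψ (ns (ms m))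
  have t4 : Tendsto (fun m => ∫⁻ x in Ω, ENNReal.ofReal (M x ((2 : ℝ) • (grad (φ m) x - G x))))
      atTop (𝓝 0) := t3.comp (hns.comp hms').tendsto_atTop
  let W : Euc n → Grad n d := weakGrad Ω u₀ + weakGrad Ω v
  have hWm : AEStronglyMeasurable W (volume.restrict (Ω : Set (Euc n))) :=
    hu₀.1.2.2.aestronglyMeasurable.add hv.1.1.2.2.aestronglyMeasurable
  have hWfin := (orliczSpace_modular hM hΔ hfin
    ((orliczSpace Ω M).add_mem hu₀.2 hv.2)).2 2 zero_le_two
  let f₀ : Euc n → ℝ≥0∞ := fun x => ENNReal.ofReal (F x (u₀ x + v x) (W x))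
  -- The gradient of `u₀ + φ m` is written as that of `u₀ + v` plus an error small in the modular.
  let f₁ : ℕ → Euc n → ℝ≥0∞ := fun m x =>
    ENNReal.ofReal (F x (u₀ x + φ m x) (W x + (grad (φ m) x - G x)))
  have hcar : ∀ (z : Euc n → Euc d) (ξ : Euc n → Grad n d),
      AEStronglyMeasurable z (volume.restrict (Ω : Set (Euc n))) →
      AEStronglyMeasurable ξ (volume.restrict (Ω : Set (Euc n))) →
      AEMeasurable (fun x => ENNReal.ofReal (F x (z x) (ξ x)))
        (volume.restrict (Ω : Set (Euc n))) := fun z ξ hz hξ => by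
    refine (aemeasurable_caratheodory (f := fun x (p : Euc d × Grad n d) => F x p.1 p.2)
      (fun p => hFmeas p.1 p.2) ?_ (hz.prodMk hξ)).ennreal_ofReal
    filter_upwards [ae_restrict_mem hms] with x hx
    exact hFcont x hx
  have hum := hu₀.1.1.aestronglyMeasurable
  have hDm : ∀ m, AEStronglyMeasurable (fun x => grad (φ m) x - G x)
      (volume.restrict (Ω : Set (Euc n))) := fun m =>
    ((continuous_grad (φ m).contDiff).aestronglyMeasurable.sub hGm).restrict
  have hf₀ : AEMeasurable f₀ (volume.restrict (Ω : Set (Euc n))) :=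
    hcar _ _ (hum.add hv.1.1.1.aestronglyMeasurable) hWm
  have hf₁ : ∀ m, AEMeasurable (f₁ m) (volume.restrict (Ω : Set (Euc n))) := fun m =>
    hcar _ _ (hum.add (φ m).continuous.aestronglyMeasurable) (hWm.add (hDm m))
  have hMW : AEMeasurable (fun x => ENNReal.ofReal (M x ((2 : ℝ) • W x)))
      (volume.restrict (Ω : Set (Euc n))) := (hM.aemeasurable_comp (hWm.const_smul (2 : ℝ))).ennreal_ofReal
  -- Only an upper bound on the energies of the approximants is needed, so the truncated difference
  -- suffices; it is dominated through `f₁ m` alone.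
  have t5 : Tendsto (fun m => ∫⁻ x in Ω, (f₁ m x - f₀ x)) atTop (𝓝 0) := by
    refine tendsto_lintegral_zero_of_le_add
      (a := fun x => ENNReal.ofReal L * (ENNReal.ofReal (M x ((2 : ℝ) • W x)) + 1))
      (b := fun m x => ENNReal.ofReal L * ENNReal.ofReal (M x ((2 : ℝ) • (grad (φ m) x - G x))))
      (fun m => (hf₁ m).sub hf₀) ((hMW.add_const 1).const_mul _) (fun m => ?_) ?_ ?_ ?_
    · filter_upwards [hM.ae_smul_add_le, ae_restrict_mem hms] with x hx hxΩ
      refine tsub_le_self.trans ((ENNReal.ofReal_le_ofReal (hF x hxΩ _ _)).trans ?_)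
      rw [ENNReal.ofReal_mul hL, ENNReal.ofReal_add (hM.nonneg x hxΩ _) zero_le_one,
        ENNReal.ofReal_one, ← mul_add]
      refine mul_le_mul_right ?_ _
      have h := hx 1 (W x) (grad (φ m) x - G x)
      rw [one_smul, mul_one] at h
      refine (add_le_add h le_rfl).trans (le_of_eq ?_)
      ring
    · rw [lintegral_const_mul' _ _ ENNReal.ofReal_ne_top, lintegral_add_left' hMW]
      refine ENNReal.mul_ne_top ENNReal.ofReal_ne_top (ENNReal.add_ne_top.2 ⟨hWfin, ?_⟩)
      simpa using hfin
    · have h := ENNReal.Tendsto.const_mul t4 (Or.inr (ENNReal.ofReal_ne_top (r := L)))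
      rw [mul_zero] at h
      refine h.congr fun m => ?_
      rw [lintegral_const_mul' _ _ ENNReal.ofReal_ne_top]
    · filter_upwards [ae_restrict_of_ae hae1, ae_restrict_of_ae hae2, ae_restrict_mem hms]
        with x h1 h2 hx
      have hVx : V x = v x := indicator_of_mem hx _
      have h3 : Tendsto (fun m => φ m x) atTop (𝓝 (v x)) := by
        rw [← hVx]; exact h1.comp hms'.tendsto_atTop
      have h4 : Tendsto (fun m => W x + (grad (φ m) x - G x)) atTop (𝓝 (W x)) := by
        have h5 : Tendsto (fun m => grad (φ m) x) atTop (𝓝 (G x)) := h2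
        have h6 := (h5.sub_const (G x)).const_add (W x)
        rwa [sub_self, add_zero] at h6
      have h7 := ((hFcont x hx).tendsto (u₀ x + v x, W x)).comp
        ((h3.const_add (u₀ x)).prodMk_nhds h4)
      have h8 : Tendsto (fun m => f₁ m x) atTop (𝓝 (f₀ x)) := ENNReal.tendsto_ofReal h7
      have h9 := ENNReal.Tendsto.sub h8 (tendsto_const_nhds (x := f₀ x))
        (Or.inl ENNReal.ofReal_ne_top)
      rwa [tsub_self] at h9
  have e₀ : energy Ω F (u₀ + v) = ∫⁻ x in Ω, f₀ x := by
    refine lintegral_congr_ae ?_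
    filter_upwards [weakGrad_add hu₀.1 hv.1.1] with x hx
    rw [hx, Pi.add_apply]
  have e₁ : ∀ m, energy Ω F (u₀ + φ m) = ∫⁻ x in Ω, f₁ m x := fun m => by
    refine lintegral_congr_ae ?_
    filter_upwards [weakGrad_add hu₀.1 (testMap_mem_sobolev (φ m)),
      (isWeakGrad_testMap (φ m)).weakGrad_ae_eq, ae_restrict_mem hms] with x h1 h2 hx
    have hGx : G x = weakGrad Ω v x := indicator_of_mem hx _
    have h3 : weakGrad Ω (u₀ + ⇑(φ m)) x = W x + (grad (φ m) x - G x) := by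
      rw [h1, Pi.add_apply, h2, hGx]
      simp only [W, Pi.add_apply]
      abel
    rw [h3, Pi.add_apply]
  have t6 := t5.const_add (∫⁻ x in Ω, f₀ x)
  rw [add_zero, ← e₀] at t6
  refine ge_of_tendsto' t6 fun m => ?_
  have h : infEnergy Ω F u₀ (testMaps Ω d) ≤ energy Ω F (u₀ + ⇑(φ m)) :=
    sInf_le ⟨φ m, ⟨φ m, rfl⟩, rfl⟩
  refine (h.trans (e₁ m).le).trans ?_
  rw [e₀, ← lintegral_add_left' hf₀]
  exact lintegral_mono fun x => le_add_tsub

end Energy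

end MusielakOrlicz

/-! ### Equality of the infima. -/

theorem mainTheorem7 {n d : ℕ} (hn : 1 ≤ n) (hd : 1 ≤ d)
    (Ω : Opens (Euc n)) (hΩ : IsBoundedLipschitzDomain Ω)
    (M : Euc n → Grad n d → ℝ) (hM : IsWeakNFunction Ω M)
    (hMcont : ContinuousOn (fun p : Euc n × Grad n d => M p.1 p.2) ((Ω : Set (Euc n)) ×ˢ univ))
    (hMΔ : DeltaTwo Ω M)
    (Mi : Fin d → Euc n → Euc n → ℝ) (hMi : ∀ i, IsWeakNFunction Ω (Mi i))
    (hsplit : ∀ x ∈ Ω, ∀ ξ : Grad n d, M x ξ = ∑ i, Mi i x (ξ i))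
    (F : Euc n → Euc d → Grad n d → ℝ)
    (hFmeas : ∀ z ξ, AEMeasurable (fun x => F x z ξ) (volume.restrict Ω))
    (hFcont : ∀ x ∈ Ω, Continuous (fun p : Euc d × Grad n d => F x p.1 p.2))
    (ν β L : ℝ) (hν : 0 < ν) (hν1 : ν < 1) (hβ : 0 < β) (hβ1 : β < 1) (hL : 1 < L)
    (hF : ∀ x ∈ Ω, ∀ z ξ, ν * M x (β • ξ) ≤ F x z ξ ∧ F x z ξ ≤ L * (M x ξ + 1)) :
    (∀ u₀ ∈ V1L Ω M, BGen 0 Ω M →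
      infEnergy Ω F u₀ (V1L0 Ω M) = infEnergy Ω F u₀ (testMaps Ω d)) ∧
    (∀ γ : ℝ≥0, 0 < γ → γ < 1 → ∀ u₀ ∈ V1L Ω M ∩ holderMaps Ω d γ, BGen γ Ω M →
      infEnergy Ω F u₀ (V1L0 Ω M ∩ holderMaps Ω d γ) = infEnergy Ω F u₀ (testMaps Ω d)) ∧
    (∀ u₀ ∈ V1L Ω M ∩ holderMaps Ω d 1,
      infEnergy Ω F u₀ (V1L0 Ω M ∩ holderMaps Ω d 1) = infEnergy Ω F u₀ (testMaps Ω d)) := by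
  have hfin : volume (Ω : Set (Euc n)) ≠ ⊤ := hΩ.bounded.measure_lt_top.ne
  -- Common core of the three cases: they differ only in the reason why the elements of `S` are
  -- approximable.
  have hle : ∀ (u₀ : Euc n → Euc d) (S : Set (Euc n → Euc d)), u₀ ∈ V1L Ω M → S ⊆ V1L0 Ω M →
      testMaps Ω d ⊆ S →
      (∀ v ∈ S, Approximable Ω M ((Ω : Set (Euc n)).indicator v)
        ((Ω : Set (Euc n)).indicator (weakGrad Ω v))) →
      infEnergy Ω F u₀ S = infEnergy Ω F u₀ (testMaps Ω d) := by
    intro u₀ S hu₀ hS hT happ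
    refine le_antisymm (sInf_le_sInf (image_mono hT)) (le_sInf ?_)
    rintro _ ⟨v, hv, rfl⟩
    exact infEnergy_testMaps_le hM hMΔ hfin hFmeas hFcont (by linarith)
      (fun x hx z ξ => (hF x hx z ξ).2) hu₀ (hS hv) (happ v hv)
  refine ⟨fun u₀ hu₀ hB => ?_, fun γ hγ hγ1 u₀ hu₀ hB => ?_, fun u₀ hu₀ => ?_⟩
  · refine hle u₀ _ hu₀ Subset.rfl ?_ fun v hv => ?_
    · rintro _ ⟨φ, rfl⟩
      exact testMap_mem_V1L0 hM hfin φ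
    · exact (sobolevZero_zeroPair hv.1).approximable hΩ hM hMΔ hMi hsplit hB
        (modular_indicator_ne_top hM hMΔ hfin hv)
  · refine hle u₀ _ hu₀.1 inter_subset_left ?_ fun v hv => ?_
    · rintro _ ⟨φ, rfl⟩
      exact ⟨testMap_mem_V1L0 hM hfin φ, testMap_mem_holderMaps φ hγ1.le⟩
    · exact (admissible_of_mem_holderMaps hΩ hM hMΔ hγ hv).approximable hΩ hM hMΔ γ.2
        (by exact_mod_cast hγ1.le) (Or.inr hB)
  · refine hle u₀ _ hu₀.1 inter_subset_left ?_ fun v hv => ?_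
    · rintro _ ⟨φ, rfl⟩
      exact ⟨testMap_mem_V1L0 hM hfin φ, testMap_mem_holderMaps φ le_rfl⟩
    · exact (admissible_of_mem_holderMaps hΩ hM hMΔ one_pos hv).approximable hΩ hM hMΔ
        (by simp) (by simp) (Or.inl (by simp))
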